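/- Let $n\ge 1$, $p>1$, $\Lambda\ge 1$, $s_0\in(0,1)$ and $q>n$. Then there are constants $C>0$ and $\bar p\in(0,1)$, depending only on $n,p,s_0,q,\Lambda$, such that the following holds. Let $s_1,\dots,s_n\in[s_0,1)$, $s_{\max}=\max_k s_k$, $\bar s=\big(\frac1n\sum_{k=1}^n\frac1{s_k}\big)^{-1}$, and assume $p<n/\bar s$. For $x\in\mathbb R^n$ and $\rho>0$ put $E^k_\rho(x)=\{y\in\mathbb R^n: |x_k-y_k|<\rho^{s_{\max}/s_k}\}$ and $M_\rho(x)=\bigcap_{k=1}^n E^k_\rho(x)$, and let $$\mu_{\mathrm{axes}}(x,dy)=\sum_{k=1}^n s_k(1-s_k)|x_k-y_k|^{-1-s_kp}\,dy_k\prod_{i\ne k}\delta_{x_i}(dy_i).$$ For a family $\mu=(\mu(x,\cdot))_{x\in\mathbb R^n}$ of Borel measures on $\mathbb R^n$, with $x\mapsto\mu(x,A)$ measurable for each Borel set $A$, and for $\Omega\subset\mathbb R^n$ open, write $$\mathcal E^\mu_\Omega(u,v)=\int_\Omega\int_\Omega|u(y)-u(x)|^{p-2}(u(y)-u(x))(v(y)-v(x))\,\mu(x,dy)\,dx,\qquad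 \mathcal E^\mu=\mathcal E^\mu_{\mathbb R^n}.$$ Let $\mu$ be admissible with constant $\Lambda$, that is: (i) $\sup_x\int(|x-y|^p\wedge1)\,\mu(x,dy)<\infty$, and $\int_A\mu(x,B)\,dx=\int_B\mu(x,A)\,dx$ for all Borel sets $A,B$; (ii) $\mu(x,\mathbb R^n\setminus E^k_\rho(x))\le\Lambda(1-s_k)\rho^{-ps_{\max}}$ for all $x\in\mathbb R^n$, $k\in\{1,\dots,n\}$ and $\rho>0$; (iii) $\Lambda^{-1}\mathcal E^\mu_{M}(v,v)\le\mathcal E^{\mu_{\mathrm{axes}}}_{M}(v,v)\le\Lambda\,\mathcal E^\mu_{M}(v,v)$ (as values in $[0,\infty]$) for $M=M_\rho(x)$, all $x\in\mathbb R^n$, $\rho\in(0,3)$ and $v\in L^p(M)$. Let $x_0\in\mathbb R^n$, $r\in(0,1]$, write $M_\rho=M_\rho(x_0)$, and let $f\in L^{q/(p\bar s)}(M_{5r/4})$. Let $u:\mathbb R^n\to\mathbb R$ be measurable with $u\in L^p(M_{5r/4})$ and $\int_{M_{5r/4}}\int_{\mathbb R^n}|u(y)-u(x)|^p\,\mu(x,dy)\,dx<\infty$,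 and suppose that $$\mathcal E^\mu(u,\varphi)\ge\int_{M_{5r/4}}f\varphi\,dx$$ for every measurable $\varphi:\mathbb R^n\to[0,\infty)$ that vanishes outside $M_{5r/4}$ and satisfies $\int_{M_{5r/4}}|\varphi|^p\,dx+\int_{\mathbb R^n}\int_{\mathbb R^n}|\varphi(y)-\varphi(x)|^p\,\mu(x,dy)\,dx<\infty$. Suppose further that $u\ge\epsilon$ a.e. in $M_{5r/4}$ for some $$\epsilon>r^{\delta}\|f\|_{L^{q/(p\bar s)}(M_{5r/4})}^{\frac1{p-1}}+\Big(r^{ps_{\max}}\sup_{x\in M_{9r/8}}\int_{\mathbb R^n\setminus M_{5r/4}}u_-(y)^{p-1}\,\mu(x,dy)\Big)^{\frac1{p-1}},\qquad\delta=\frac{ps_{\max}}{p-1}\,\frac{q-n}{q},$$ where $u_-=\max(-u,0)$. Then $u^{\bar p}$ and $u^{-\bar p}$ are integrable on $M_r$, and $$\Big(\frac1{|M_r|}\int_{M_r}u^{\bar p}\,dx\Big)^{1/\bar p}\le C\Big(\frac1{|M_r|}\int_{M_r}u^{-\bar p}\,dx\Big)^{-1/\bar p}.$$ -/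

import Mathlib

open MeasureTheory ProbabilityTheory
open scoped ENNReal

noncomputable section

namespace AnisoNonlocal

variable {n : ℕ}

/-- The largest order of differentiability `s_max = max {s_1, …, s_n}`. -/
def sMax (s : Fin n → ℝ) : ℝ := ⨆ k, s k

/-- The harmonic mean `((1/n) ∑ 1/s_k)⁻¹` of the orders `s_1, …, s_n`. -/
def sBar (s : Fin n → ℝ) : ℝ := ((1 / (n : ℝ)) * ∑ k, 1 / s k)⁻¹

/-- The Euclidean distance on `ℝⁿ`. -/
def eDist (x y : Fin n → ℝ) : ℝ := Real.sqrt (∑ k, (x k - y k) ^ 2)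

/-- The slab `E_r^k(x) = {y : |x_k - y_k| < r ^ (s_max / s_k)}`. -/
def slab (s : Fin n → ℝ) (k : Fin n) (r : ℝ) (x : Fin n → ℝ) : Set (Fin n → ℝ) :=
  {y | |x k - y k| < r ^ (sMax s / s k)}

/-- The open anisotropic rectangle `M_r(x)`, the product of the intervals
`(x_k - r ^ (s_max / s_k), x_k + r ^ (s_max / s_k))`. -/
def rect (s : Fin n → ℝ) (r : ℝ) (x : Fin n → ℝ) : Set (Fin n → ℝ) :=
  Set.pi Set.univ fun k => Set.Ioo (x k - r ^ (sMax s / s k)) (x k + r ^ (sMax s / s k))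

/-- The reference family
`μ_axes(x, dy) = ∑ₖ s_k (1 - s_k) |x_k - y_k| ^ (-1 - s_k p) dy_k ∏_{i ≠ k} δ_{x_i}(dy_i)`:
the `k`-th summand is the image of the weighted Lebesgue measure on `ℝ` under the
parametrization `t ↦ (x_1, …, x_{k-1}, t, x_{k+1}, …, x_n)` of the line through `x` parallel to
the `k`-th coordinate axis. -/
def muAxes (p : ℝ) (s : Fin n → ℝ) (x : Fin n → ℝ) : Measure (Fin n → ℝ) :=
  ∑ k, ENNReal.ofReal (s k * (1 - s k)) •
    ((volume : Measure ℝ).withDensity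
      (fun t => ENNReal.ofReal (|x k - t| ^ (-1 - s k * p)))).map (fun t => Function.update x k t)

/-- The energy `∫_A ∫_B |u(y) - u(x)| ^ p μ(x, dy) dx ∈ [0, ∞]`. For `A = B = Ω` it is
`𝓔_Ω^μ(u, u)`, and for `A = Ω`, `B = ℝⁿ` it is `(u, u)_{V^{p,μ}(Ω|ℝⁿ)}`. -/
def energy (p : ℝ) (μ : (Fin n → ℝ) → Measure (Fin n → ℝ)) (A B : Set (Fin n → ℝ))
    (u : (Fin n → ℝ) → ℝ) : ℝ≥0∞ :=
  ∫⁻ x in A, ∫⁻ y in B, ENNReal.ofReal (|u y - u x| ^ p) ∂(μ x)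

/-- The form
`𝓔^μ(u, v) = ∫_{ℝⁿ} ∫_{ℝⁿ} |u(y) - u(x)| ^ (p-2) (u(y) - u(x)) (v(y) - v(x)) μ(x, dy) dx`. -/
def form (p : ℝ) (μ : (Fin n → ℝ) → Measure (Fin n → ℝ)) (u v : (Fin n → ℝ) → ℝ) : ℝ :=
  ∫ x, ∫ y, |u y - u x| ^ (p - 2) * (u y - u x) * (v y - v x) ∂(μ x)

/-- Admissible families of measures, i.e. the class `𝒦(p, s₀, Λ)` for the orders
`s_1, …, s_n ∈ [s₀, 1)`. -/
structure Admissible (p Λ : ℝ) (s : Fin n → ℝ) (μ : Kernel (Fin n → ℝ) (Fin n → ℝ)) : Prop where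
  /-- `sup_x ∫ (|x - y| ^ p ∧ 1) μ(x, dy) < ∞`. -/
  levy : ⨆ x, ∫⁻ y, ENNReal.ofReal (min (eDist x y ^ p) 1) ∂(μ x) < ∞
  /-- `∫_A ∫_B μ(x, dy) dx = ∫_B ∫_A μ(x, dy) dx` for all Borel sets `A`, `B`. -/
  symm : ∀ A B : Set (Fin n → ℝ), MeasurableSet A → MeasurableSet B →
    ∫⁻ x in A, μ x B = ∫⁻ x in B, μ x A
  /-- `μ(x₀, ℝⁿ ∖ E_r^k(x₀)) ≤ Λ (1 - s_k) r ^ (- p s_max)`. -/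
  tail : ∀ (x₀ : Fin n → ℝ) (k : Fin n) (r : ℝ), 0 < r →
    μ x₀ (slab s k r x₀)ᶜ ≤ ENNReal.ofReal (Λ * (1 - s k) * r ^ (-(p * sMax s)))
  /-- Local comparability of the energies of `μ` and of `μ_axes`
  (the common value of the two may be infinite). -/
  comparable : ∀ (x₀ : Fin n → ℝ) (ρ : ℝ), 0 < ρ → ρ < 3 →
    ∀ u : (Fin n → ℝ) → ℝ, Measurable u →
      MemLp u (ENNReal.ofReal p) (volume.restrict (rect s ρ x₀)) →
      (ENNReal.ofReal Λ)⁻¹ * energy p μ (rect s ρ x₀) (rect s ρ x₀) u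
          ≤ energy p (muAxes p s) (rect s ρ x₀) (rect s ρ x₀) u ∧
        energy p (muAxes p s) (rect s ρ x₀) (rect s ρ x₀) u
          ≤ ENNReal.ofReal Λ * energy p μ (rect s ρ x₀) (rect s ρ x₀) u

/-- `u ∈ V^{p,μ}(Ω|ℝⁿ)`. -/
def MemV (p : ℝ) (μ : (Fin n → ℝ) → Measure (Fin n → ℝ)) (Ω : Set (Fin n → ℝ))
    (u : (Fin n → ℝ) → ℝ) : Prop :=
  Measurable u ∧ MemLp u (ENNReal.ofReal p) (volume.restrict Ω) ∧ energy p μ Ω Set.univ u < ∞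

/-- `φ ∈ H^{p,μ}_Ω(ℝⁿ)`. -/
def MemH (p : ℝ) (μ : (Fin n → ℝ) → Measure (Fin n → ℝ)) (Ω : Set (Fin n → ℝ))
    (φ : (Fin n → ℝ) → ℝ) : Prop :=
  Measurable φ ∧ (∀ x ∉ Ω, φ x = 0) ∧
    (∫⁻ x in Ω, ENNReal.ofReal (|φ x| ^ p)) + energy p μ Set.univ Set.univ φ < ∞

/-- `𝓔^μ(u, φ) ≥ (f, φ)` for every nonnegative `φ ∈ H^{p,μ}_Ω(ℝⁿ)`, where
`(f, φ) = ∫_Ω f φ dx`. -/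
def WeakSupersolution (p : ℝ) (μ : (Fin n → ℝ) → Measure (Fin n → ℝ)) (Ω : Set (Fin n → ℝ))
    (f u : (Fin n → ℝ) → ℝ) : Prop :=
  ∀ φ : (Fin n → ℝ) → ℝ, MemH p μ Ω φ → (∀ x, 0 ≤ φ x) →
    ∫ x in Ω, f x * φ x ≤ form p μ u φ

/-- The tail `sup_{x ∈ A} ∫_{ℝⁿ ∖ Ω} u_-(y) ^ (p-1) μ(x, dy) ∈ [0, ∞]`, with
`u_- = max (-u) 0`. -/
def tailTerm (p : ℝ) (μ : (Fin n → ℝ) → Measure (Fin n → ℝ)) (A Ω : Set (Fin n → ℝ))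
    (u : (Fin n → ℝ) → ℝ) : ℝ≥0∞ :=
  ⨆ x ∈ A, ∫⁻ y in Ωᶜ, ENNReal.ofReal (max (-u y) 0 ^ (p - 1)) ∂(μ x)

end AnisoNonlocal

end

open MeasureTheory ProbabilityTheory
open scoped ENNReal

noncomputable section

namespace AnisoNonlocal

variable {n : ℕ}

/-! The theorem holds because `log u` has bounded mean oscillation on `M_r`, with a bound depending
only on `n, p, s₀, q, Λ`. By John–Nirenberg, `exp (c |log u - g₀|)` is then integrable for some
constant `g₀` and a small `c`. Multiplying the averages of `u ^ c` and `u ^ (-c)` makes `g₀` cancel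
(`rpow_average_le`).

The oscillation bound starts from testing the inequality with `τ ^ p u ^ (1 - p)`, where `τ` is a
cutoff for `M_ρ(z)`. By `exists_log_inequality` the integrand is at most `-c |log u(y) - log u(x)| ^
p` where `τ = 1` at both points, plus a multiple of `|τ(y) - τ(x)| ^ p`. The tail condition bounds
the energy of `τ` by `ρ ^ (-p s_max) |M_ρ|`, up to constants. The lower bound on `ε` is exactly what
brings the source `f` (by Hölder) and the negative part of `u` far away to the same size. The
outcome is `exists_log_energy_le`.

Comparability then replaces `μ` by `μ_axes`, whose energy splits into one-dimensional fractional
energies. The one-dimensional Poincaré inequality `fractional_poincare` carries the factor `1 - σ`,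
which matches the weight `s_k (1 - s_k)`, so nothing degenerates as `s_k → 1`. Changing coordinates
one at a time yields `poincare_box`. This bounds the mean oscillation on every cell of a nested
anisotropic dyadic grid, and `john_nirenberg`, a stopping-time argument along the filtration of the
grid, finishes the proof.

One technical point concerns the kernel. It need not be s-finite and may charge the diagonal, so
Fubini is not available for `μ` itself. The integrands vanish on the diagonal, and the Lévy
condition makes the off-diagonal part `κ` s-finite. The symmetry of `μ` becomes swap invariance of
the measure `dx κ(x, dy)`. -/

/-! ### Algebraic inequalities for the logarithmic test function -/

lemma one_sub_exp_neg_ge {x : ℝ} (h0 : 0 ≤ x) (h1 : x ≤ 1) : x / 2 ≤ 1 - Real.exp (-x) := by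
  have h := Real.add_one_le_exp x
  have h2 : Real.exp (-x) ≤ (1 + x)⁻¹ := by
    rw [Real.exp_neg]
    exact inv_anti₀ (by linarith) (by linarith)
  have h3 : (1 + x)⁻¹ ≤ 1 - x / 2 := by
    rw [inv_le_iff_one_le_mul₀ (by linarith)]
    nlinarith
  linarith

/-- Quantitative lower bound for `(1 - 1/t)^(p-1) (t^(p-1) - 1)` in terms of `log t`. -/
lemma exists_rpow_le_log_gap {p : ℝ} (hp : 1 < p) :
    ∃ c : ℝ, 0 < c ∧ ∀ l : ℝ, 0 ≤ l →
      c * l ^ p ≤ (1 - Real.exp (-l)) ^ (p - 1) * (Real.exp ((p - 1) * l) - 1) := by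
  have ha : 0 < p - 1 := by linarith
  set a := p - 1 with ha'
  have hea : 0 < 1 - Real.exp (-a) := by
    have : Real.exp (-a) < 1 := by rw [Real.exp_lt_one_iff]; linarith
    linarith
  -- The first entry serves `l ≤ 1`, where both factors are linear in `l`. The second serves `l ≥
  -- 1`, where the first factor is at least `(1 / 2) ^ a` and the exponential dominates `l ^ p`.
  refine ⟨min ((1 / 2) ^ a * a) ((1 / 2) ^ a * ((1 - Real.exp (-a)) * (a / p) ^ p)),
    by positivity, fun l hl => ?_⟩
  have hlp : 0 ≤ l ^ p := by positivity
  rcases le_total l 1 with h1 | h1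
  · have hθ := one_sub_exp_neg_ge hl h1
    have h2 : (l / 2) ^ a ≤ (1 - Real.exp (-l)) ^ a :=
      Real.rpow_le_rpow (by positivity) hθ ha.le
    have h3 : a * l ≤ Real.exp (a * l) - 1 := by linarith [Real.add_one_le_exp (a * l)]
    calc _ ≤ ((1 / 2) ^ a * a) * l ^ p := by gcongr; exact min_le_left _ _
      _ = (l / 2) ^ a * (a * l) := by
        rcases hl.eq_or_lt with rfl | hl0
        · simp [Real.zero_rpow (by linarith : p ≠ 0)]
        · rw [show p = a + 1 by rw [ha']; ring, Real.rpow_add_one hl0.ne',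
            show l / 2 = (1 / 2) * l by ring, Real.mul_rpow (by norm_num) hl]
          ring
      _ ≤ _ := by
        have : 0 ≤ a * l := by positivity
        have : 0 ≤ (1 - Real.exp (-l)) ^ a := le_trans (by positivity) h2
        gcongr
  · have hθ : 1 / 2 ≤ 1 - Real.exp (-l) := by
      have := one_sub_exp_neg_ge (x := 1) (by norm_num) le_rfl
      have h4 : Real.exp (-l) ≤ Real.exp (-1) := Real.exp_le_exp.2 (by linarith)
      linarith
    have h2 : (1 / 2 : ℝ) ^ a ≤ (1 - Real.exp (-l)) ^ a :=
      Real.rpow_le_rpow (by positivity) hθ ha.le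
    have h3 : (a / p) ^ p * l ^ p ≤ Real.exp (a * l) := by
      rw [← Real.mul_rpow (by positivity) hl]
      calc (a / p * l) ^ p ≤ (Real.exp (a * l / p)) ^ p := by
            apply Real.rpow_le_rpow (by positivity) _ (by linarith)
            have := Real.add_one_le_exp (a * l / p)
            have e : a / p * l = a * l / p := by ring
            linarith
        _ = _ := by
            rw [← Real.exp_mul]; congr 1; field_simp
    have h4 : (1 - Real.exp (-a)) * Real.exp (a * l) ≤ Real.exp (a * l) - 1 := by
      have : 1 ≤ Real.exp (-a) * Real.exp (a * l) := by
        rw [← Real.exp_add]; apply Real.one_le_exp; nlinarith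
      nlinarith
    calc _ ≤ ((1 / 2) ^ a * ((1 - Real.exp (-a)) * (a / p) ^ p)) * l ^ p := by
          gcongr; exact min_le_right _ _
      _ = (1 / 2) ^ a * ((1 - Real.exp (-a)) * ((a / p) ^ p * l ^ p)) := by ring
      _ ≤ (1 / 2) ^ a * ((1 - Real.exp (-a)) * Real.exp (a * l)) := by gcongr
      _ ≤ (1 / 2) ^ a * (Real.exp (a * l) - 1) := by gcongr
      _ ≤ _ := by
        have : 0 ≤ Real.exp (a * l) - 1 := le_trans (by positivity) h4
        gcongr

/-- Convexity of `t ↦ t^p`, in the form of a weighted binomial inequality. -/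
lemma add_rpow_le_weighted {p η σ d : ℝ} (hp : 1 < p) (hη : 0 < η) (hη1 : η < 1)
    (hσ : 0 ≤ σ) (hd : 0 ≤ d) :
    (σ + d) ^ p ≤ (1 - η) ^ (1 - p) * σ ^ p + η ^ (1 - p) * d ^ p := by
  have h1 : 0 < 1 - η := by linarith
  have h := (convexOn_rpow hp.le).2 (x := σ / (1 - η)) (y := d / η)
    (Set.mem_Ici.2 (by positivity)) (Set.mem_Ici.2 (by positivity)) h1.le hη.le (by ring)
  have key : ∀ w z : ℝ, 0 < w → 0 ≤ z → w * (z / w) ^ p = w ^ (1 - p) * z ^ p := by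
    intro w z hw hz
    rw [Real.div_rpow hz hw.le, Real.rpow_sub hw, Real.rpow_one]
    ring
  simp only [smul_eq_mul] at h
  rw [key _ _ h1 hσ, key _ _ hη hd] at h
  have e : (1 - η) * (σ / (1 - η)) + η * (d / η) = σ + d := by field_simp
  rwa [e] at h

/-- Follows from `log (1 - x) ≥ -2x` near zero. The bound `1 / (8p)` keeps the resulting exponent
below `1 / 4`, so the exponential is again linear. The linear excess is what the logarithmic term
can absorb. -/
lemma one_sub_rpow_le {p x : ℝ} (hp : 1 < p) (hx : 0 ≤ x) (hx1 : x ≤ 1 / (8 * p)) :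
    (1 - x) ^ (1 - p) ≤ 1 + 4 * (p - 1) * x := by
  have hxp : p * x ≤ 1 / 8 := by
    have := mul_le_mul_of_nonneg_left hx1 (by linarith : (0 : ℝ) ≤ p)
    rwa [show p * (1 / (8 * p)) = 1 / 8 by field_simp] at this
  have hxx : x ≤ 1 / 8 := by nlinarith
  have h1 : 0 < 1 - x := by linarith
  rw [Real.rpow_def_of_pos h1]
  have hl : -(2 * x) ≤ Real.log (1 - x) := by
    have := Real.one_sub_inv_le_log_of_pos h1
    have h2 : (1 - x)⁻¹ ≤ 1 + 2 * x := by
      rw [inv_le_iff_one_le_mul₀ h1]; nlinarith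
    linarith
  set y := 2 * (p - 1) * x with hy
  have hy0 : 0 ≤ y := by have : 0 ≤ p - 1 := by linarith
                         positivity
  have hy1 : y ≤ 1 / 4 := by nlinarith
  calc Real.exp (Real.log (1 - x) * (1 - p)) ≤ Real.exp y := by
        apply Real.exp_le_exp.2; rw [hy]; nlinarith
    _ ≤ 1 + 2 * y := by
        have h4 := Real.add_one_le_exp (-y)
        have h5 : Real.exp y * Real.exp (-y) = 1 := by rw [← Real.exp_add]; simp
        have h6 : 0 < Real.exp y := Real.exp_pos y
        have h7 : Real.exp y * (1 - y) ≤ 1 := by nlinarith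
        rw [← mul_le_mul_iff_of_pos_right (by linarith : 0 < 1 - y)]
        nlinarith
    _ = _ := by rw [hy]; ring

/-- The algebraic inequality behind the logarithmic energy estimate. -/
lemma exists_log_inequality {p : ℝ} (hp : 1 < p) :
    ∃ c C : ℝ, 0 < c ∧ 0 < C ∧ ∀ a b σ τ : ℝ, 0 < a → 0 < b → 0 ≤ σ → 0 ≤ τ →
      |b - a| ^ (p - 2) * (b - a) * (τ ^ p * b ^ (1 - p) - σ ^ p * a ^ (1 - p)) ≤
        -(c * (min σ τ ^ p * |Real.log b - Real.log a| ^ p)) + C * |τ - σ| ^ p := by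
  obtain ⟨c, hc, hcl⟩ := exists_rpow_le_log_gap hp
  refine ⟨c / 2, (8 * p) ^ (p - 1), by positivity, by positivity, ?_⟩
  intro a b σ τ ha hb hσ hτ
  -- Exchanging `(a, σ)` with `(b, τ)` changes the sign of two factors on the left and leaves the
  -- right side alone.
  wlog hab : a ≤ b generalizing a b σ τ with H
  · have := H b a τ σ hb ha hτ hσ (by linarith)
    rw [abs_sub_comm b a, min_comm, abs_sub_comm (Real.log b), abs_sub_comm τ]
    linarith
  rcases hab.eq_or_lt with rfl | hab
  · simp only [sub_self, abs_zero, mul_zero, zero_mul]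
    rw [Real.zero_rpow (by linarith)]
    have : 0 ≤ (8 * p) ^ (p - 1) * |τ - σ| ^ p := by positivity
    linarith
  set l := Real.log b - Real.log a with hl
  have hl0 : 0 < l := sub_pos.2 (Real.log_lt_log ha hab)
  have hbe : b = a * Real.exp l := by
    rw [hl, Real.exp_sub, Real.exp_log hb, Real.exp_log ha]; field_simp
  set θ := 1 - Real.exp (-l) with hθ
  have hee : Real.exp l * Real.exp (-l) = 1 := by rw [← Real.exp_add]; simp
  have hbθ : b - a = b * θ := by
    rw [hθ, hbe]; linear_combination a * hee
  have hθ0 : 0 < θ := by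
    have : Real.exp (-l) < 1 := by rw [Real.exp_lt_one_iff]; linarith
    linarith
  have hθ1 : θ < 1 := by have := Real.exp_pos (-l); linarith
  -- With `θ = (b - a) / b`, homogeneity turns the left side into `θ ^ (p-1) (τ ^ p - σ ^ p) - σ ^ p
  -- G`. The good term `G` dominates both `l ^ p` and `θ ^ p`.
  set G := θ ^ (p - 1) * (Real.exp ((p - 1) * l) - 1) with hG
  have hGl : c * l ^ p ≤ G := hcl l hl0.le
  have hGθ : (p - 1) * θ ^ p ≤ G := by
    have h1 : θ ≤ l := by linarith [Real.add_one_le_exp (-l)]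
    have h2 : (p - 1) * θ ≤ Real.exp ((p - 1) * l) - 1 := by
      have := Real.add_one_le_exp ((p - 1) * l)
      have : (p - 1) * θ ≤ (p - 1) * l := by gcongr
      linarith
    calc (p - 1) * θ ^ p = θ ^ (p - 1) * ((p - 1) * θ) := by
          rw [Real.rpow_sub_one hθ0.ne']; field_simp
      _ ≤ _ := by rw [hG]; gcongr
  have hG0 : 0 ≤ G := le_trans (by positivity) hGl
  have hpos : 0 < b - a := by linarith
  have hLHS : |b - a| ^ (p - 2) * (b - a) * (τ ^ p * b ^ (1 - p) - σ ^ p * a ^ (1 - p)) =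
      θ ^ (p - 1) * (τ ^ p - σ ^ p) - σ ^ p * G := by
    rw [abs_of_pos hpos]
    have e1 : (b - a) ^ (p - 2) * (b - a) = (b * θ) ^ (p - 1) := by
      rw [← hbθ, ← Real.rpow_add_one hpos.ne']; congr 1; ring
    have e2 : b ^ (p - 1) * b ^ (1 - p) = 1 := by
      rw [← Real.rpow_add hb]; simp
    have e3 : b ^ (p - 1) * a ^ (1 - p) = Real.exp ((p - 1) * l) := by
      rw [hbe, Real.mul_rpow ha.le (Real.exp_pos _).le, ← Real.exp_mul]
      have : a ^ (p - 1) * a ^ (1 - p) = 1 := by rw [← Real.rpow_add ha]; simp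
      rw [mul_right_comm, this, one_mul, mul_comm]
    rw [e1, Real.mul_rpow hb.le hθ0.le, hG]
    linear_combination (θ ^ (p - 1) * τ ^ p) * e2 - (θ ^ (p - 1) * σ ^ p) * e3
  rw [hLHS, abs_of_pos hl0]
  rcases le_total τ σ with hτσ | hτσ
  · rw [min_eq_right hτσ]
    have h1 : τ ^ p ≤ σ ^ p := Real.rpow_le_rpow hτ hτσ (by linarith)
    have h2 : 0 ≤ θ ^ (p - 1) * (σ ^ p - τ ^ p) := mul_nonneg (by positivity) (by linarith)
    have h3 : τ ^ p * (c * l ^ p) ≤ σ ^ p * G := by gcongr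
    have h4 : 0 ≤ (8 * p) ^ (p - 1) * |τ - σ| ^ p := by positivity
    have h5 : 0 ≤ τ ^ p * (c * l ^ p) := by positivity
    nlinarith
  · rw [min_eq_left hτσ, abs_of_nonneg (by linarith : 0 ≤ τ - σ)]
    set d := τ - σ with hd
    have hd0 : 0 ≤ d := by linarith
    -- Proportionality to `θ` serves two purposes: `θ ^ (p-1) η ^ (1-p)` becomes a constant, and the
    -- excess `θ ^ (p-1) 4 (p-1) η` is at most `G / 2`, so half of the good term survives.
    set η := θ / (8 * p) with hη
    have hη0 : 0 < η := by positivity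
    have hη1 : η ≤ 1 / (8 * p) := by rw [hη]; gcongr
    have hη2 : η < 1 := by
      refine hη1.trans_lt ?_
      rw [div_lt_one (by positivity)]; linarith
    have h1 : τ ^ p ≤ (1 - η) ^ (1 - p) * σ ^ p + η ^ (1 - p) * d ^ p := by
      have := add_rpow_le_weighted hp hη0 hη2 hσ hd0
      rwa [show σ + d = τ by rw [hd]; ring] at this
    have h2 := one_sub_rpow_le hp hη0.le hη1
    have h3 : θ ^ (p - 1) * η ^ (1 - p) = (8 * p) ^ (p - 1) := by
      rw [hη, show (1 : ℝ) - p = -(p - 1) by ring, Real.rpow_neg (by positivity),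
        Real.div_rpow hθ0.le (by positivity)]
      field_simp
    have h4 : θ ^ (p - 1) * (4 * (p - 1) * η) ≤ G / 2 := by
      have e : θ ^ (p - 1) * (4 * (p - 1) * η) = ((p - 1) * θ ^ p) / (2 * p) := by
        rw [hη, Real.rpow_sub_one hθ0.ne']; field_simp; ring
      rw [e]
      calc ((p - 1) * θ ^ p) / (2 * p) ≤ G / (2 * p) := by gcongr
        _ ≤ G / 2 := by gcongr; linarith
    have hσp : 0 ≤ σ ^ p := by positivity
    have hθp : 0 ≤ θ ^ (p - 1) := by positivity
    have h5 : θ ^ (p - 1) * (τ ^ p - σ ^ p) ≤ σ ^ p * (G / 2) + (8 * p) ^ (p - 1) * d ^ p := by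
      calc θ ^ (p - 1) * (τ ^ p - σ ^ p) ≤
            θ ^ (p - 1) * ((1 + 4 * (p - 1) * η) * σ ^ p + η ^ (1 - p) * d ^ p - σ ^ p) := by
            gcongr
            refine h1.trans ?_
            gcongr
        _ = σ ^ p * (θ ^ (p - 1) * (4 * (p - 1) * η)) +
              (θ ^ (p - 1) * η ^ (1 - p)) * d ^ p := by ring
        _ ≤ _ := by rw [h3]; gcongr
    have h6 : σ ^ p * (c * l ^ p) ≤ σ ^ p * G := by gcongr
    nlinarith

/-- The pointwise bound for the energy integrand when one point lies outside the domain. -/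
lemma cross_inequality {p a b ε τ : ℝ} (hp : 1 < p) (hε : 0 < ε) (ha : ε ≤ a) (hτ : 0 ≤ τ) :
    |b - a| ^ (p - 2) * (b - a) * (0 - τ ^ p * a ^ (1 - p)) ≤
      2 ^ (p - 1) * τ ^ p + 2 ^ (p - 1) * (ε ^ (1 - p) * (τ ^ p * max (-b) 0 ^ (p - 1))) := by
  have ha0 : 0 < a := by linarith
  have hR : 0 ≤ 2 ^ (p - 1) * τ ^ p +
      2 ^ (p - 1) * (ε ^ (1 - p) * (τ ^ p * max (-b) 0 ^ (p - 1))) := by positivity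
  rcases le_or_gt a b with hab | hab
  · refine le_trans ?_ hR
    have : 0 ≤ |b - a| ^ (p - 2) * (b - a) * (τ ^ p * a ^ (1 - p)) := by
      have : 0 ≤ b - a := by linarith
      positivity
    linarith
  · have hpos : 0 < a - b := by linarith
    have e : |b - a| ^ (p - 2) * (b - a) * (0 - τ ^ p * a ^ (1 - p)) =
        (a - b) ^ (p - 1) * (τ ^ p * a ^ (1 - p)) := by
      rw [abs_sub_comm, abs_of_pos hpos, show p - 1 = p - 2 + 1 by ring,
        Real.rpow_add_one hpos.ne']
      ring
    rw [e]
    set m := max (-b) 0 with hm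
    have hm0 : 0 ≤ m := le_max_right _ _
    -- Only `b < a` gives a positive contribution. Then `a - b ≤ 2 max (a, b_-)`: the part with `a ^
    -- (p-1)` cancels `a ^ (1-p)`, and the other part becomes the tail of `u_-`.
    have h1 : (a - b) ^ (p - 1) ≤ 2 ^ (p - 1) * a ^ (p - 1) + 2 ^ (p - 1) * m ^ (p - 1) := by
      have hb : a - b ≤ 2 * max a m := by
        have := le_max_left (-b) 0
        have := le_max_left a m
        have := le_max_right a m
        linarith
      calc (a - b) ^ (p - 1) ≤ (2 * max a m) ^ (p - 1) :=
            Real.rpow_le_rpow hpos.le hb (by linarith)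
        _ = 2 ^ (p - 1) * max a m ^ (p - 1) := by
            rw [Real.mul_rpow (by norm_num) (le_max_of_le_right hm0)]
        _ ≤ _ := by
            have q1 : 0 ≤ 2 ^ (p - 1) * a ^ (p - 1) := by positivity
            have q2 : 0 ≤ 2 ^ (p - 1) * m ^ (p - 1) := by positivity
            rcases max_choice a m with h | h <;> rw [h] <;> linarith
    have h2 : a ^ (p - 1) * a ^ (1 - p) = 1 := by rw [← Real.rpow_add ha0]; simp
    have h3 : a ^ (1 - p) ≤ ε ^ (1 - p) :=
      Real.rpow_le_rpow_of_nonpos hε ha (by linarith)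
    calc (a - b) ^ (p - 1) * (τ ^ p * a ^ (1 - p)) ≤
        (2 ^ (p - 1) * a ^ (p - 1) + 2 ^ (p - 1) * m ^ (p - 1)) * (τ ^ p * a ^ (1 - p)) := by
          gcongr
      _ = 2 ^ (p - 1) * τ ^ p * (a ^ (p - 1) * a ^ (1 - p)) +
          2 ^ (p - 1) * (a ^ (1 - p) * (τ ^ p * m ^ (p - 1))) := by ring
      _ ≤ _ := by rw [h2, mul_one]; gcongr

/-! ### S-finiteness and symmetry of the off-diagonal part of a kernel -/

section OffDiagonal

variable {X : Type*} [MeasurableSpace X]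

/-- A countable family of measurable kernels can be evaluated at a measurable random index. -/
lemma measurable_select {ι : Type*} [Countable ι] [MeasurableSpace ι]
    [MeasurableSingletonClass ι] {β : Type*} [MeasurableSpace β] {F : ι → X → β}
    (hF : ∀ i, Measurable (F i)) {g : X → ι} (hg : Measurable g) :
    Measurable fun x => F (g x) x := by
  have h : Measurable fun z : ι × X => F z.1 z.2 :=
    measurable_from_prod_countable_right fun i => hF i
  exact h.comp (hg.prodMk measurable_id)

/-- If the sections of `μ x` along countably many "cells", indexed measurably by `x`, are
finite and exhaust the complement of `{x}`, then the off-diagonal part of `μ` is an s-finite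
kernel. -/
lemma exists_sFinite_offDiagonal (μ : Kernel X X) (c : ℕ → X → ℕ) (hc : ∀ m, Measurable (c m))
    (U : ℕ → ℕ → Set X) (hU : ∀ m i, MeasurableSet (U m i))
    (K : ℕ → ℝ≥0∞) (hK : ∀ m, K m < ∞) (hfin : ∀ m x, μ x (U m (c m x)) ≤ K m)
    (hcover : ∀ x, ⋃ m, U m (c m x) = {x}ᶜ) :
    ∃ κ : Kernel X X, IsSFiniteKernel κ ∧ ∀ x, κ x = (μ x).restrict {x}ᶜ := by
  have hms : ∀ m (x : X), MeasurableSet (U m (c m x)) := fun m x => hU m _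
  have hdis : ∀ m (x : X), MeasurableSet (disjointed (fun m => U m (c m x)) m) :=
    fun m x => MeasurableSet.disjointed (fun i => hms i x) m
  have hmeas : ∀ m, Measurable fun x => (μ x).restrict (disjointed (fun m => U m (c m x)) m) := by
    intro m
    refine Measure.measurable_of_measurable_coe _ fun B hB => ?_
    -- The `m`-th disjoint piece depends on `x` only through the indices `c 0 x, …, c m x`, a
    -- countable choice, so measurability reduces to that of `μ` on fixed sets.
    have hsel : Measurable fun x => fun i : Fin (m + 1) => c i x :=
      measurable_pi_iff.2 fun i => hc i
    have := measurable_select (F := fun (v : Fin (m + 1) → ℕ) x =>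
      μ x (B ∩ (U m (v (Fin.last m)) \ ⋃ i : Fin m, U i (v i.castSucc))))
      (fun v => Kernel.measurable_coe μ
        (hB.inter ((hU _ _).diff (MeasurableSet.iUnion fun i => hU _ _)))) hsel
    convert this using 2 with x
    rw [Measure.restrict_apply hB, disjointed_eq_inter_compl]
    congr 2
    ext y
    simp only [Set.mem_inter_iff, Set.mem_iInter, Set.mem_compl_iff, Set.mem_sdiff,
      Set.mem_iUnion, not_exists, Fin.val_last, Fin.val_castSucc]
    exact and_congr_right fun _ =>
      ⟨fun h i => h i i.2, fun h i hi => h ⟨i, hi⟩⟩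
  let κm : ℕ → Kernel X X := fun m => ⟨_, hmeas m⟩
  have hκm : ∀ m, IsFiniteKernel (κm m) := fun m => by
    refine ⟨⟨K m, hK m, fun x => ?_⟩⟩
    change (μ x).restrict _ Set.univ ≤ _
    rw [Measure.restrict_apply_univ]
    exact (measure_mono (disjointed_subset _ m)).trans (hfin m x)
  refine ⟨Kernel.sum κm, inferInstance, fun x => ?_⟩
  rw [Kernel.sum_apply]
  change Measure.sum (fun m => (μ x).restrict (disjointed (fun m => U m (c m x)) m)) = _
  rw [← Measure.restrict_iUnion (disjoint_disjointed _) (fun m => hdis m x),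
    iUnion_disjointed, hcover]

end OffDiagonal

section Metric

variable {X : Type*} [MetricSpace X] [SecondCountableTopology X] [MeasurableSpace X] [BorelSpace X]

/-- A kernel with uniformly bounded mass away from the diagonal is s-finite off the diagonal. -/
lemma exists_sFinite_offDiagonal_of_bound [Nonempty X] (μ : Kernel X X)
    (hb : ∀ δ : ℝ, 0 < δ → ∃ K : ℝ≥0∞, K < ∞ ∧ ∀ x, μ x {y | δ ≤ dist x y} ≤ K) :
    ∃ κ : Kernel X X, IsSFiniteKernel κ ∧ ∀ x, κ x = (μ x).restrict {x}ᶜ := by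
  classical
  let d := TopologicalSpace.denseSeq X
  let δ : ℕ → ℝ := fun m => 1 / ((m : ℝ) + 1)
  have hδ : ∀ m, 0 < δ m := fun m => by positivity
  have hex : ∀ m (x : X), ∃ i, dist x (d i) < δ m := fun m x => by
    exact (TopologicalSpace.denseRange_denseSeq X).exists_dist_lt x (hδ m)
  choose K hK hKb using fun m => hb (δ m) (hδ m)
  -- The cell of `x` is the complement of the `2 δ`-ball about the first dense point within `δ` of
  -- `x`. It stays at distance at least `δ` from `x`, so `hb` bounds its mass, and the choice of
  -- dense point is measurable in `x`.
  refine exists_sFinite_offDiagonal μ (fun m x => Nat.find (hex m x)) (fun m => ?_)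
    (fun m i => (Metric.ball (d i) (2 * δ m))ᶜ) (fun m i => Metric.isOpen_ball.measurableSet.compl)
    K hK (fun m x => ?_) (fun x => ?_)
  · refine measurable_find (hex m) fun i => ?_
    exact measurableSet_lt (measurable_id.dist measurable_const) measurable_const
  · refine (measure_mono ?_).trans (hKb m x)
    intro y hy
    have h1 := Nat.find_spec (hex m x)
    simp only [Set.mem_compl_iff, Metric.mem_ball, not_lt] at hy
    have h2 := dist_triangle y x (d (Nat.find (hex m x)))
    rw [dist_comm y x] at h2
    simp only [Set.mem_ofPred_eq]
    linarith
  · ext y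
    simp only [Set.mem_iUnion, Set.mem_compl_iff, Metric.mem_ball, not_lt,
      Set.mem_singleton_iff]
    constructor
    · rintro ⟨m, hm⟩ rfl
      have h1 := Nat.find_spec (hex m y)
      have := hδ m
      linarith
    · intro hxy
      obtain ⟨m, hm⟩ := exists_nat_one_div_lt (K := ℝ) (ε := dist y x / 3)
        (by have := dist_pos.2 hxy; positivity)
      refine ⟨m, ?_⟩
      have h1 := Nat.find_spec (hex m x)
      have h2 := dist_triangle y (d (Nat.find (hex m x))) x
      rw [dist_comm (d _) x] at h2
      change δ m < _ at hm
      linarith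

/-- The off-diagonal part of a symmetric kernel induces a swap-invariant measure. -/
lemma swap_invariant_of_symm (ν : Measure X) [SFinite ν] [IsLocallyFiniteMeasure ν]
    (μ κ : Kernel X X) [IsSFiniteKernel κ]
    (hb : ∀ δ : ℝ, 0 < δ → ∃ K : ℝ≥0∞, K < ∞ ∧ ∀ x, μ x {y | δ ≤ dist x y} ≤ K)
    (hκ : ∀ x, κ x = (μ x).restrict {x}ᶜ)
    (hsymm : ∀ A B : Set X, MeasurableSet A → MeasurableSet B →
      ∫⁻ x in A, μ x B ∂ν = ∫⁻ x in B, μ x A ∂ν) :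
    (ν ⊗ₘ κ).map Prod.swap = ν ⊗ₘ κ := by
  classical
  set m := ν ⊗ₘ κ with hm
  have hdisj : ∀ A B : Set X, MeasurableSet A → MeasurableSet B → Disjoint A B →
      m (A ×ˢ B) = ∫⁻ x in A, μ x B ∂ν := by
    intro A B hA hB hAB
    rw [hm, Measure.compProd_apply_prod hA hB]
    refine setLIntegral_congr_fun hA fun x hx => ?_
    rw [hκ, Measure.restrict_apply hB, Set.inter_eq_left.2]
    intro y hy hyx
    exact Set.disjoint_left.1 hAB hx (by rwa [Set.mem_singleton_iff.1 hyx] at hy)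
  have hdiag : m {z | z.1 = z.2} = 0 := by
    have hdm : MeasurableSet {z : X × X | z.1 = z.2} := measurableSet_diagonal
    rw [hm, Measure.compProd_apply hdm]
    refine (lintegral_congr fun x => ?_).trans lintegral_zero
    have : Prod.mk x ⁻¹' {z : X × X | z.1 = z.2} = {x} := by
      ext y; simp [eq_comm]
    rw [this, hκ, Measure.restrict_apply (measurableSet_singleton x)]
    simp
  obtain ⟨b, hbc, -, hbb⟩ := TopologicalSpace.exists_countable_basis X
  -- admissible pairs of balls
  have hcov : ∀ x y : X, x ≠ y → ∃ U ∈ b, ∃ V ∈ b, x ∈ U ∧ y ∈ V ∧ ν U < ∞ ∧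
      ∃ δ > 0, ∀ z ∈ U, ∀ w ∈ V, δ ≤ dist z w := by
    intro x y hxy
    have hd : 0 < dist x y := dist_pos.2 hxy
    obtain ⟨O, hxO, hO, hνO⟩ := ν.exists_isOpen_measure_lt_top x
    obtain ⟨U, hUb, hxU, hU⟩ := hbb.exists_subset_of_mem_open
      (show x ∈ O ∩ Metric.ball x (dist x y / 3) from ⟨hxO, Metric.mem_ball_self (by positivity)⟩)
      (hO.inter Metric.isOpen_ball)
    obtain ⟨V, hVb, hyV, hV⟩ := hbb.exists_subset_of_mem_open
      (Metric.mem_ball_self (x := y) (by positivity : 0 < dist x y / 3)) Metric.isOpen_ball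
    refine ⟨U, hUb, V, hVb, hxU, hyV, (measure_mono (hU.trans Set.inter_subset_left)).trans_lt hνO,
      dist x y / 3, by positivity, fun z hz w hw => ?_⟩
    have h1 : dist z x < dist x y / 3 := (hU hz).2
    have h2 : dist w y < dist x y / 3 := hV hw
    have h3 := dist_triangle4 x z w y
    rw [dist_comm x z] at h3
    linarith
  -- Off the diagonal the space is a countable union of products `U × V` of basic open sets at
  -- positive distance with `ν U < ∞`. Each has finite measure, so agreement on subrectangles, where
  -- symmetry applies, determines the measure there.
  let T : Set (Set X × Set X) := {P | P.1 ∈ b ∧ P.2 ∈ b ∧ ν P.1 < ∞ ∧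
      ∃ δ > 0, ∀ z ∈ P.1, ∀ w ∈ P.2, δ ≤ dist z w}
  have hT : T.Countable :=
    (hbc.prod hbc).mono fun P hP => Set.mem_prod.2 ⟨hP.1, hP.2.1⟩
  have hTm : ∀ P ∈ T, MeasurableSet P.1 ∧ MeasurableSet P.2 := fun P hP =>
    ⟨(hbb.isOpen hP.1).measurableSet, (hbb.isOpen hP.2.1).measurableSet⟩
  have hunion : (⋃ P ∈ T, P.1 ×ˢ P.2) = {z : X × X | z.1 = z.2}ᶜ := by
    ext ⟨x, y⟩
    simp only [Set.mem_iUnion, Set.mem_prod, Set.mem_compl_iff, Set.mem_ofPred_eq, exists_prop]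
    constructor
    · rintro ⟨P, ⟨-, -, -, δ, hδ, hPd⟩, hx, hy⟩ rfl
      have := hPd x hx x hy
      rw [dist_self] at this
      linarith
    · intro hxy
      obtain ⟨U, hU, V, hV, hx, hy, hν, hδ⟩ := hcov x y hxy
      exact ⟨(U, V), ⟨hU, hV, hν, hδ⟩, hx, hy⟩
  have hrect : ∀ P ∈ T, (m.map Prod.swap).restrict (P.1 ×ˢ P.2) = m.restrict (P.1 ×ˢ P.2) := by
    intro P hP
    obtain ⟨hP1, hP2⟩ := hTm P hP
    obtain ⟨-, -, hν, δ, hδ, hPd⟩ := hP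
    have hPdisj : Disjoint P.1 P.2 := Set.disjoint_left.2 fun x hx hy => by
      have := hPd x hx x hy
      rw [dist_self] at this
      linarith
    have hfin : m (P.1 ×ˢ P.2) < ∞ := by
      obtain ⟨K, hK, hKb⟩ := hb δ hδ
      rw [hdisj _ _ hP1 hP2 hPdisj]
      calc ∫⁻ x in P.1, μ x P.2 ∂ν ≤ ∫⁻ x in P.1, K ∂ν :=
            setLIntegral_mono measurable_const fun x hx =>
              (measure_mono fun y hy => hPd x hx y hy).trans (hKb x)
        _ = K * ν P.1 := by simp
        _ < ∞ := ENNReal.mul_lt_top hK hν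
    have hsw : ∀ A B : Set X, MeasurableSet A → MeasurableSet B →
        (m.map Prod.swap) ((A ×ˢ B) ∩ (P.1 ×ˢ P.2)) = m ((A ×ˢ B) ∩ (P.1 ×ˢ P.2)) := by
      intro A B hA hB
      rw [Set.prod_inter_prod, Measure.map_apply measurable_swap
        ((hA.inter hP1).prod (hB.inter hP2)), Set.preimage_swap_prod]
      have hd : Disjoint (A ∩ P.1) (B ∩ P.2) :=
        hPdisj.mono Set.inter_subset_right Set.inter_subset_right
      rw [hdisj _ _ (hB.inter hP2) (hA.inter hP1) hd.symm,
        hdisj _ _ (hA.inter hP1) (hB.inter hP2) hd,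
        hsymm _ _ (hA.inter hP1) (hB.inter hP2)]
    have hfr : IsFiniteMeasure (m.restrict (P.1 ×ˢ P.2)) := ⟨by simpa using hfin⟩
    refine (MeasureTheory.ext_of_generate_finite _ generateFrom_prod.symm isPiSystem_prod
      ?_ ?_).symm
    · rintro _ ⟨A, hA, B, hB, rfl⟩
      rw [Measure.restrict_apply (hA.prod hB), Measure.restrict_apply (hA.prod hB), hsw A B hA hB]
    · have := hsw Set.univ Set.univ MeasurableSet.univ MeasurableSet.univ
      rw [Set.univ_prod_univ] at this
      rw [Measure.restrict_apply MeasurableSet.univ, Measure.restrict_apply MeasurableSet.univ, this]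
  have hall : (m.map Prod.swap).restrict {z : X × X | z.1 = z.2}ᶜ =
      m.restrict {z : X × X | z.1 = z.2}ᶜ := by
    rw [← hunion]
    exact (Measure.restrict_biUnion_congr hT).2 hrect
  have hdm : MeasurableSet {z : X × X | z.1 = z.2} := measurableSet_diagonal
  rw [← Measure.restrict_add_restrict_compl (μ := m.map Prod.swap) hdm, hall,
    ← Measure.restrict_add_restrict_compl (μ := m) hdm]
  have h1 : (m.map Prod.swap).restrict {z : X × X | z.1 = z.2} = 0 := by
    rw [Measure.restrict_eq_zero, Measure.map_apply measurable_swap hdm]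
    convert hdiag using 2
    ext z; simp [eq_comm]
  have h2 : m.restrict {z : X × X | z.1 = z.2} = 0 := Measure.restrict_eq_zero.2 hdiag
  rw [Measure.restrict_add_restrict_compl (μ := m) hdm, h1, zero_add]
  conv_rhs => rw [← Measure.restrict_add_restrict_compl (μ := m) hdm, h2, zero_add]

end Metric

/-! ### Anisotropic rectangles -/

section Geometry

variable {s : Fin n → ℝ} {s₀ : ℝ}

lemma le_sMax (s : Fin n → ℝ) (k : Fin n) : s k ≤ sMax s :=
  le_ciSup (Set.finite_range s).bddAbove k

lemma sMax_le_one [Nonempty (Fin n)] (hs : ∀ k, s₀ ≤ s k ∧ s k < 1) : sMax s ≤ 1 :=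
  ciSup_le fun k => (hs k).2.le

lemma s_pos (hs₀ : 0 < s₀) (hs : ∀ k, s₀ ≤ s k ∧ s k < 1) (k : Fin n) : 0 < s k :=
  hs₀.trans_le (hs k).1

lemma sMax_pos [Nonempty (Fin n)] (hs₀ : 0 < s₀) (hs : ∀ k, s₀ ≤ s k ∧ s k < 1) : 0 < sMax s :=
  (s_pos hs₀ hs (Classical.arbitrary _)).trans_le (le_sMax s _)

lemma one_le_ratio (hs₀ : 0 < s₀) (hs : ∀ k, s₀ ≤ s k ∧ s k < 1) (k : Fin n) :
    1 ≤ sMax s / s k := by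
  rw [one_le_div (s_pos hs₀ hs k)]
  exact le_sMax s k

lemma ratio_le (hs₀ : 0 < s₀) (hs : ∀ k, s₀ ≤ s k ∧ s k < 1) (k : Fin n) :
    sMax s / s k ≤ 1 / s₀ := by
  have : Nonempty (Fin n) := ⟨k⟩
  have := s_pos hs₀ hs k
  have := sMax_le_one hs
  have := (hs k).1
  gcongr

lemma mem_rect {ρ : ℝ} {x y : Fin n → ℝ} :
    y ∈ rect s ρ x ↔ ∀ k, |y k - x k| < ρ ^ (sMax s / s k) := by
  simp only [rect, Set.mem_pi, Set.mem_univ, true_imp_iff, Set.mem_Ioo, abs_lt]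
  refine forall_congr' fun k => ⟨fun h => ⟨?_, ?_⟩, fun h => ⟨?_, ?_⟩⟩ <;> linarith [h.1, h.2]

lemma measurableSet_rect (s : Fin n → ℝ) (ρ : ℝ) (x : Fin n → ℝ) : MeasurableSet (rect s ρ x) :=
  MeasurableSet.univ_pi fun _ => measurableSet_Ioo

lemma volume_rect {ρ : ℝ} (hρ : 0 < ρ) (x : Fin n → ℝ) :
    volume (rect s ρ x) = ENNReal.ofReal (2 ^ n * ρ ^ (∑ k, sMax s / s k)) := by
  rw [rect, Real.volume_pi_Ioo]
  have h : ∀ k, (x k + ρ ^ (sMax s / s k)) - (x k - ρ ^ (sMax s / s k)) =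
      2 * ρ ^ (sMax s / s k) := fun k => by ring
  simp only [h]
  rw [← ENNReal.ofReal_prod_of_nonneg fun k _ => by positivity, Finset.prod_mul_distrib,
    Real.rpow_sum_of_pos hρ]
  simp

lemma volume_rect_lt_top {ρ : ℝ} (hρ : 0 < ρ) (x : Fin n → ℝ) : volume (rect s ρ x) < ∞ := by
  rw [volume_rect hρ]; exact ENNReal.ofReal_lt_top

lemma rect_mono (hs₀ : 0 < s₀) (hs : ∀ k, s₀ ≤ s k ∧ s k < 1) {ρ ρ' : ℝ} (hρ : 0 ≤ ρ)
    (h : ρ ≤ ρ') (x : Fin n → ℝ) : rect s ρ x ⊆ rect s ρ' x := by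
  intro y hy
  rw [mem_rect] at hy ⊢
  intro k
  have : 0 ≤ sMax s / s k := zero_le_one.trans (one_le_ratio hs₀ hs k)
  exact (hy k).trans_le (Real.rpow_le_rpow hρ h this)

end Geometry

/-! ### Truncated moments and cutoff functions -/

/-- Bernoulli's inequality for an exponent in `[0, 1]`. Applied with `x = 1 - s_k`, it lets the
factor `1 - s_k` of the tail condition compensate the sum of a geometric series whose ratio tends to
one. -/
lemma half_rpow_le {x : ℝ} (h0 : 0 ≤ x) (h1 : x ≤ 1) : (1 / 2 : ℝ) ^ x ≤ 1 - x / 2 := by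
  have := rpow_one_add_le_one_add_mul_self (s := -1 / 2) (by norm_num) h0 h1
  norm_num at this ⊢
  linarith

/-- A dyadic layer decomposition of the truncated power `min(1, t)^p`. -/
lemma ofReal_min_rpow_le_tsum {p t : ℝ} (hp : 0 < p) (ht : 0 ≤ t) :
    ENNReal.ofReal (min 1 t ^ p) ≤
      ∑' j : ℕ, ENNReal.ofReal (((1 / 2 : ℝ) ^ p) ^ j) *
        (Set.Ici ((1 / 2 : ℝ) ^ (j + 1))).indicator 1 t := by
  rcases ht.eq_or_lt with rfl | ht
  · simp [Real.zero_rpow hp.ne']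
  obtain ⟨j, hj1, hj2⟩ : ∃ j : ℕ, (1 / 2 : ℝ) ^ (j + 1) ≤ t ∧ min 1 t ≤ (1 / 2 : ℝ) ^ j := by
    rcases le_or_gt 1 t with h | h
    · exact ⟨0, by norm_num; linarith, by simp⟩
    · obtain ⟨j, h1, h2⟩ := exists_nat_pow_near_of_lt_one ht h.le (y := (1 / 2 : ℝ))
        (by norm_num) (by norm_num)
      exact ⟨j, h1.le, (min_le_right _ _).trans h2⟩
  refine le_trans ?_ (ENNReal.le_tsum j)
  rw [Set.indicator_of_mem (Set.mem_Ici.2 hj1), Pi.one_apply, mul_one]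
  apply ENNReal.ofReal_le_ofReal
  calc min 1 t ^ p ≤ ((1 / 2 : ℝ) ^ j) ^ p :=
        Real.rpow_le_rpow (by positivity) hj2 hp.le
    _ = _ := by
        rw [← Real.rpow_natCast, ← Real.rpow_natCast, ← Real.rpow_mul (by norm_num),
          ← Real.rpow_mul (by norm_num), mul_comm]

section Tail

variable {s : Fin n → ℝ} {s₀ p Λ : ℝ} {μ : Kernel (Fin n → ℝ) (Fin n → ℝ)}

/-- The tail condition controls the truncated `p`-th moment in each coordinate direction,
uniformly in the orders. -/
lemma Admissible.lintegral_min_le (hμ : Admissible p Λ s μ) (hp : 1 < p) (hΛ : 1 ≤ Λ)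
    (hs₀ : 0 < s₀) (hs : ∀ k, s₀ ≤ s k ∧ s k < 1) (x : Fin n → ℝ) (k : Fin n) {σ : ℝ}
    (hσ : 0 < σ) :
    ∫⁻ y, ENNReal.ofReal (min 1 (|x k - y k| / σ ^ (sMax s / s k)) ^ p) ∂(μ x) ≤
      ENNReal.ofReal (2 ^ (p + 1) * Λ * σ ^ (-(p * sMax s))) := by
  set a := sMax s / s k with ha
  have hsk := s_pos hs₀ hs k
  have hsk1 := (hs k).2
  have ha1 : 1 ≤ a := one_le_ratio hs₀ hs k
  have ha0 : 0 < a := by linarith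
  have hsm : sMax s = a * s k := by rw [ha]; field_simp
  have hw : 0 < σ ^ a := by positivity
  let E : ℕ → Set (Fin n → ℝ) := fun j => {y | (1 / 2 : ℝ) ^ (j + 1) ≤ |x k - y k| / σ ^ a}
  have hEm : ∀ j, MeasurableSet (E j) := fun j =>
    measurableSet_le measurable_const (by fun_prop)
  -- Chosen so that `ρ j ^ a = σ ^ a 2 ^ (-(j+1))`, which makes the dyadic layer `E j` the
  -- complement of a slab.
  let ρ : ℕ → ℝ := fun j => σ * (1 / 2 : ℝ) ^ (((j + 1 : ℕ) : ℝ) / a)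
  have hρ : ∀ j, 0 < ρ j := fun j => by positivity
  have hρa : ∀ j, ρ j ^ a = σ ^ a * (1 / 2 : ℝ) ^ (j + 1) := fun j => by
    simp only [ρ]
    rw [Real.mul_rpow hσ.le (by positivity), ← Real.rpow_mul (by norm_num),
      div_mul_cancel₀ _ ha0.ne', Real.rpow_natCast]
  have hE : ∀ j, E j = (slab s k (ρ j) x)ᶜ := fun j => by
    ext y
    simp only [E, slab, Set.mem_compl_iff, Set.mem_ofPred_eq, not_lt, ← ha, hρa]
    rw [le_div_iff₀ hw, mul_comm]
  -- The layer weight decays like `2 ^ (-p j)` and the tail bound grows like `2 ^ (p s_k j)`. Their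
  -- product is geometric with this ratio.
  set r : ℝ := (1 / 2 : ℝ) ^ (p * (1 - s k)) with hr
  have hr0 : 0 ≤ r := by positivity
  have hr1 : r ≤ 1 - (1 - s k) / 2 := by
    refine le_trans ?_ (half_rpow_le (x := 1 - s k) (by linarith) (by linarith))
    apply Real.rpow_le_rpow_of_exponent_ge (by norm_num) (by norm_num)
    nlinarith
  have hμE : ∀ j, ENNReal.ofReal (((1 / 2 : ℝ) ^ p) ^ j) * μ x (E j) ≤
      ENNReal.ofReal (Λ * (1 - s k) * σ ^ (-(p * sMax s)) * 2 ^ (p * s k) * r ^ j) := by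
    intro j
    rw [hE]
    refine (mul_le_mul_right (hμ.tail x k (ρ j) (hρ j)) _).trans ?_
    rw [← ENNReal.ofReal_mul (by positivity)]
    apply ENNReal.ofReal_le_ofReal
    apply le_of_eq
    have e1 : ρ j ^ (-(p * sMax s)) = σ ^ (-(p * sMax s)) * 2 ^ (((j + 1 : ℕ) : ℝ) * (p * s k)) := by
      simp only [ρ]
      rw [Real.mul_rpow hσ.le (by positivity), ← Real.rpow_mul (by norm_num), one_div,
        Real.inv_rpow (by norm_num), ← Real.rpow_neg (by norm_num)]
      congr 2
      rw [hsm]; field_simp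
    have e2 : r ^ j = ((1 / 2 : ℝ) ^ p) ^ j * 2 ^ ((j : ℝ) * (p * s k)) := by
      rw [hr, ← Real.rpow_natCast, ← Real.rpow_natCast, ← Real.rpow_mul (by norm_num),
        ← Real.rpow_mul (by norm_num), one_div, Real.inv_rpow (by norm_num),
        ← Real.rpow_neg (by norm_num), Real.inv_rpow (by norm_num),
        ← Real.rpow_neg (by norm_num), ← Real.rpow_add (by norm_num)]
      congr 1; ring
    rw [e1, e2]
    push_cast
    rw [show ((j : ℝ) + 1) * (p * s k) = j * (p * s k) + p * s k by ring,
      Real.rpow_add (by norm_num)]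
    ring
  calc ∫⁻ y, ENNReal.ofReal (min 1 (|x k - y k| / σ ^ a) ^ p) ∂(μ x)
      ≤ ∫⁻ y, ∑' j : ℕ, ENNReal.ofReal (((1 / 2 : ℝ) ^ p) ^ j) * (E j).indicator 1 y ∂(μ x) := by
        refine lintegral_mono fun y => ?_
        exact ofReal_min_rpow_le_tsum (t := |x k - y k| / σ ^ a) (by linarith) (by positivity)
    _ = ∑' j : ℕ, ENNReal.ofReal (((1 / 2 : ℝ) ^ p) ^ j) * μ x (E j) := by
        rw [lintegral_tsum fun j => ((measurable_one.indicator (hEm j)).const_mul _).aemeasurable]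
        congr 1; ext j
        rw [lintegral_const_mul _ (measurable_one.indicator (hEm j)),
          lintegral_indicator_one (hEm j)]
    _ ≤ ∑' j : ℕ, ENNReal.ofReal
          (Λ * (1 - s k) * σ ^ (-(p * sMax s)) * 2 ^ (p * s k) * r ^ j) :=
        ENNReal.tsum_le_tsum hμE
    _ = ENNReal.ofReal (Λ * (1 - s k) * σ ^ (-(p * sMax s)) * 2 ^ (p * s k) * (1 - r)⁻¹) := by
        rw [← ENNReal.ofReal_tsum_of_nonneg (fun j => by positivity)
          ((summable_geometric_of_lt_one hr0 (by linarith)).mul_left _), tsum_mul_left,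
          tsum_geometric_of_lt_one hr0 (by linarith)]
    _ ≤ _ := by
        apply ENNReal.ofReal_le_ofReal
        -- This is the robustness in the order: the geometric sum blows up no faster than `2 / (1 -
        -- s_k)`.
        have h1 : (1 - s k) * (1 - r)⁻¹ ≤ 2 := by
          rw [← div_eq_mul_inv, div_le_iff₀ (by linarith)]; linarith
        have h2 : (2 : ℝ) ^ (p * s k) ≤ 2 ^ p := by
          apply Real.rpow_le_rpow_of_exponent_le (by norm_num); nlinarith
        have h4 : 0 ≤ (1 - s k) * (1 - r)⁻¹ :=
          mul_nonneg (by linarith) (inv_nonneg.2 (by linarith))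
        calc _ = Λ * σ ^ (-(p * sMax s)) * (2 ^ (p * s k) * ((1 - s k) * (1 - r)⁻¹)) := by ring
          _ ≤ Λ * σ ^ (-(p * sMax s)) * (2 ^ p * 2) := by gcongr
          _ = _ := by rw [Real.rpow_add_one (by norm_num)]; ring

end Tail

section Cutoff

variable {s : Fin n → ℝ} {s₀ p Λ : ℝ} {μ : Kernel (Fin n → ℝ) (Fin n → ℝ)}

/-- A cutoff function between `rect s ρ z` and `rect s (18 / 17 * ρ) z`. -/
def cutoff (s : Fin n → ℝ) (ρ : ℝ) (z x : Fin n → ℝ) : ℝ :=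
  max 0 (1 - ∑ k, min 1 (max 0 ((|x k - z k| - ρ ^ (sMax s / s k)) / (ρ / 17) ^ (sMax s / s k))))

lemma cutoff_nonneg (s : Fin n → ℝ) (ρ : ℝ) (z x : Fin n → ℝ) : 0 ≤ cutoff s ρ z x :=
  le_max_left _ _

lemma cutoff_le_one (s : Fin n → ℝ) (ρ : ℝ) (z x : Fin n → ℝ) : cutoff s ρ z x ≤ 1 := by
  refine max_le zero_le_one ?_
  rw [sub_le_self_iff]
  exact Finset.sum_nonneg fun k _ => le_min zero_le_one (le_max_left _ _)

lemma measurable_cutoff (s : Fin n → ℝ) (ρ : ℝ) (z : Fin n → ℝ) : Measurable (cutoff s ρ z) := by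
  unfold cutoff
  fun_prop

lemma cutoff_eq_one {ρ : ℝ} (hρ : 0 < ρ) {z x : Fin n → ℝ} (hx : x ∈ rect s ρ z) :
    cutoff s ρ z x = 1 := by
  rw [mem_rect] at hx
  have : ∀ k ∈ Finset.univ, min 1 (max 0 ((|x k - z k| - ρ ^ (sMax s / s k)) /
      (ρ / 17) ^ (sMax s / s k))) = 0 := fun k _ => by
    rw [max_eq_left, min_eq_right zero_le_one]
    exact div_nonpos_of_nonpos_of_nonneg (by linarith [hx k]) (by positivity)
  rw [cutoff, Finset.sum_eq_zero this]
  simp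

lemma cutoff_eq_zero (hs₀ : 0 < s₀) (hs : ∀ k, s₀ ≤ s k ∧ s k < 1) {ρ : ℝ} (hρ : 0 < ρ)
    {z x : Fin n → ℝ} (hx : x ∉ rect s (18 / 17 * ρ) z) : cutoff s ρ z x = 0 := by
  rw [mem_rect] at hx
  push Not at hx
  obtain ⟨k, hk⟩ := hx
  refine max_eq_left ?_
  rw [sub_nonpos]
  have h1 : 1 = min 1 (max 0 ((|x k - z k| - ρ ^ (sMax s / s k)) /
      (ρ / 17) ^ (sMax s / s k))) := by
    rw [min_eq_left]
    refine le_max_of_le_right ?_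
    rw [one_le_div (by positivity)]
    -- Since `a = s_max / s_k ≥ 1`, powers are superadditive, so the ramp of width `(ρ / 17) ^ a`
    -- fits between the rectangles of radii `ρ` and `18 ρ / 17`.
    have := Real.add_rpow_le_rpow_add hρ.le (by positivity : 0 ≤ ρ / 17)
      (one_le_ratio hs₀ hs k)
    rw [show ρ + ρ / 17 = 18 / 17 * ρ by ring] at this
    linarith
  conv_lhs => rw [h1]
  exact Finset.single_le_sum (f := fun k => min 1 (max 0 ((|x k - z k| - ρ ^ (sMax s / s k)) /
      (ρ / 17) ^ (sMax s / s k)))) (fun k _ => le_min zero_le_one (le_max_left _ _))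
      (Finset.mem_univ k)

lemma abs_clamp_sub_le (a b : ℝ) :
    |min 1 (max 0 a) - min 1 (max 0 b)| ≤ min 1 |a - b| := by
  refine le_min ?_ ?_
  · have h : ∀ a : ℝ, 0 ≤ min 1 (max 0 a) ∧ min 1 (max 0 a) ≤ 1 := fun a =>
      ⟨le_min zero_le_one (le_max_left _ _), min_le_left _ _⟩
    rw [abs_le]
    constructor <;> linarith [(h a).1, (h a).2, (h b).1, (h b).2]
  · refine (abs_min_sub_min_le_max _ _ _ _).trans ?_
    rw [sub_self, abs_zero]
    refine max_le (abs_nonneg _) ((abs_max_sub_max_le_max _ _ _ _).trans ?_)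
    rw [sub_self, abs_zero]
    exact max_le (abs_nonneg _) le_rfl

lemma abs_cutoff_sub_le {ρ : ℝ} (hρ : 0 < ρ) (z x y : Fin n → ℝ) :
    |cutoff s ρ z y - cutoff s ρ z x| ≤
      ∑ k, min 1 (|x k - y k| / (ρ / 17) ^ (sMax s / s k)) := by
  unfold cutoff
  refine (abs_max_sub_max_le_max _ _ _ _).trans ?_
  rw [sub_self, abs_zero]
  refine max_le (Finset.sum_nonneg fun k _ => by positivity) ?_
  rw [sub_sub_sub_cancel_left, ← Finset.sum_sub_distrib]
  refine (Finset.abs_sum_le_sum_abs _ _).trans (Finset.sum_le_sum fun k _ => ?_)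
  refine (abs_clamp_sub_le _ _).trans (min_le_min_left _ ?_)
  rw [← sub_div, abs_div, abs_of_pos (by positivity : 0 < (ρ / 17) ^ (sMax s / s k))]
  refine div_le_div_of_nonneg_right ?_ (by positivity)
  rw [sub_sub_sub_cancel_right]
  refine (abs_abs_sub_abs_le (x k - z k) (y k - z k)).trans ?_
  rw [sub_sub_sub_cancel_right]

/-- The difference of the cutoff is at most a sum of `n` truncated coordinate differences at scale
`ρ / 17`. Convexity of the power costs `n ^ (p-1)` and summing the `n` truncated moments costs
another `n`. -/
lemma Admissible.lintegral_cutoff_le (hμ : Admissible p Λ s μ) (hp : 1 < p) (hΛ : 1 ≤ Λ)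
    (hs₀ : 0 < s₀) (hs : ∀ k, s₀ ≤ s k ∧ s k < 1) {ρ : ℝ} (hρ : 0 < ρ) (z x : Fin n → ℝ) :
    ∫⁻ y, ENNReal.ofReal (|cutoff s ρ z y - cutoff s ρ z x| ^ p) ∂(μ x) ≤
      ENNReal.ofReal ((n : ℝ) ^ p * (2 ^ (p + 1) * Λ * (ρ / 17) ^ (-(p * sMax s)))) := by
  set m : Fin n → (Fin n → ℝ) → ℝ := fun k y => min 1 (|x k - y k| / (ρ / 17) ^ (sMax s / s k))
    with hm
  have hm0 : ∀ k y, 0 ≤ m k y := fun k y => by positivity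
  have hmm : ∀ k, Measurable (m k) := fun k => by fun_prop
  calc _ ≤ ∫⁻ y, ∑ k, ENNReal.ofReal ((n : ℝ) ^ (p - 1)) * ENNReal.ofReal (m k y ^ p) ∂(μ x) := by
        refine lintegral_mono fun y => ?_
        simp_rw [← ENNReal.ofReal_mul (by positivity : (0 : ℝ) ≤ (n : ℝ) ^ (p - 1))]
        rw [← ENNReal.ofReal_sum_of_nonneg fun k _ => by have := hm0 k y; positivity]
        apply ENNReal.ofReal_le_ofReal
        refine (Real.rpow_le_rpow (abs_nonneg _) (abs_cutoff_sub_le hρ z x y)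
          (by linarith)).trans ?_
        rw [← Finset.mul_sum]
        have := Real.rpow_sum_le_const_mul_sum_rpow_of_nonneg (s := Finset.univ)
          (f := fun k => m k y) hp.le (fun k _ => hm0 k y)
        simpa using this
    _ = ∑ k, ENNReal.ofReal ((n : ℝ) ^ (p - 1)) * ∫⁻ y, ENNReal.ofReal (m k y ^ p) ∂(μ x) := by
        rw [lintegral_finsetSum _ fun k _ => by have := hmm k; fun_prop]
        refine Finset.sum_congr rfl fun k _ => ?_
        rw [lintegral_const_mul _ (by have := hmm k; fun_prop)]
    _ ≤ ∑ k : Fin n, ENNReal.ofReal ((n : ℝ) ^ (p - 1)) *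
          ENNReal.ofReal (2 ^ (p + 1) * Λ * (ρ / 17) ^ (-(p * sMax s))) := by
        gcongr with k
        exact hμ.lintegral_min_le hp hΛ hs₀ hs x k (by positivity)
    _ = _ := by
        rw [Finset.sum_const, Finset.card_univ, Fintype.card_fin, nsmul_eq_mul,
          ← ENNReal.ofReal_mul (by positivity), ← ENNReal.ofReal_natCast,
          ← ENNReal.ofReal_mul (by positivity)]
        congr 1
        rcases Nat.eq_zero_or_pos n with rfl | hn
        · simp [Real.zero_rpow (by linarith : p ≠ 0)]
        · have : (0 : ℝ) < n := by exact_mod_cast hn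
          rw [Real.rpow_sub_one this.ne']
          field_simp

end Cutoff

/-! ### The jump measure on `ℝⁿ × ℝⁿ` -/

/-- `κ` is the off-diagonal part of `μ`, it is s-finite, and the measure on `ℝⁿ × ℝⁿ` that it
induces is symmetric. -/
structure IsOffDiagonalPart (μ κ : Kernel (Fin n → ℝ) (Fin n → ℝ)) : Prop where
  sFinite : IsSFiniteKernel κ
  eq_restrict : ∀ x, κ x = (μ x).restrict {x}ᶜ
  swap : ((volume : Measure (Fin n → ℝ)) ⊗ₘ κ).map Prod.swap = volume ⊗ₘ κ

lemma dist_le_eDist (x y : Fin n → ℝ) : dist x y ≤ eDist x y := by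
  refine (dist_pi_le_iff (Real.sqrt_nonneg _)).2 ?_
  intro k
  rw [Real.dist_eq, ← Real.sqrt_sq_eq_abs]
  exact Real.sqrt_le_sqrt (Finset.single_le_sum (f := fun k => (x k - y k) ^ 2)
    (fun k _ => sq_nonneg _) (Finset.mem_univ k))

/-- By Markov's inequality the Lévy condition bounds `μ x {y | δ ≤ dist x y}` uniformly in `x` for
each `δ > 0`, which is all that s-finiteness and swap invariance require. -/
lemma Admissible.exists_offDiagonalPart {p Λ : ℝ} {s : Fin n → ℝ}
    {μ : Kernel (Fin n → ℝ) (Fin n → ℝ)} (hμ : Admissible p Λ s μ) (hp : 0 < p) :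
    ∃ κ, IsOffDiagonalPart μ κ := by
  have hb : ∀ δ : ℝ, 0 < δ → ∃ K : ℝ≥0∞, K < ∞ ∧ ∀ x, μ x {y | δ ≤ dist x y} ≤ K := by
    intro δ hδ
    have hm : 0 < min (δ ^ p) 1 := lt_min (by positivity) one_pos
    refine ⟨_, ENNReal.div_lt_top hμ.levy.ne (ENNReal.ofReal_pos.2 hm).ne', fun x => ?_⟩
    rw [ENNReal.le_div_iff_mul_le (Or.inl (ENNReal.ofReal_pos.2 hm).ne')
      (Or.inl ENNReal.ofReal_ne_top), mul_comm]
    refine le_trans ?_ (le_iSup (fun x => ∫⁻ y, ENNReal.ofReal (min (eDist x y ^ p) 1) ∂(μ x)) x)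
    refine le_trans (mul_le_mul_right (measure_mono ?_) _) (mul_meas_ge_le_lintegral₀ ?_ _)
    · intro y (hy : δ ≤ dist x y)
      refine ENNReal.ofReal_le_ofReal (min_le_min_right _ ?_)
      exact Real.rpow_le_rpow hδ.le (hy.trans (dist_le_eDist x y)) hp.le
    · unfold eDist
      exact Measurable.aemeasurable (by fun_prop)
  obtain ⟨κ, hκ1, hκ2⟩ := exists_sFinite_offDiagonal_of_bound μ hb
  exact ⟨κ, hκ1, hκ2, swap_invariant_of_symm volume μ κ hb hκ2 hμ.symm⟩

namespace IsOffDiagonalPart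

variable {μ κ : Kernel (Fin n → ℝ) (Fin n → ℝ)}

/-- An atom of `μ x` at `x`, even an infinite one, is invisible to integrands vanishing there.
Energies and the form can therefore be computed with `κ`, for which Fubini and symmetry are
available. -/
lemma lintegral_eq (h : IsOffDiagonalPart μ κ) (x : Fin n → ℝ) {B : Set (Fin n → ℝ)}
    (hB : MeasurableSet B) {F : (Fin n → ℝ) → ℝ≥0∞} (hF : F x = 0) :
    ∫⁻ y in B, F y ∂(μ x) = ∫⁻ y in B, F y ∂(κ x) := by
  have hx : MeasurableSet ({x}ᶜ : Set (Fin n → ℝ)) := (measurableSet_singleton x).compl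
  rw [h.eq_restrict, Measure.restrict_restrict hB, Set.inter_comm, ← Measure.restrict_restrict hx,
    ← lintegral_indicator hx]
  congr 1
  ext y
  by_cases hy : y = x
  · subst hy; simp [hF]
  · rw [Set.indicator_of_mem (by simpa using hy)]

lemma energy_eq (h : IsOffDiagonalPart μ κ) {p : ℝ} (hp : 0 < p) {A B : Set (Fin n → ℝ)}
    (hA : MeasurableSet A) (hB : MeasurableSet B) {u : (Fin n → ℝ) → ℝ} (hu : Measurable u) :
    energy p μ A B u =
      ∫⁻ z in A ×ˢ B, ENNReal.ofReal (|u z.2 - u z.1| ^ p) ∂(volume ⊗ₘ κ) := by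
  have := h.sFinite
  rw [Measure.setLIntegral_compProd (by fun_prop) hA hB, energy]
  congr 1
  ext x
  exact h.lintegral_eq x hB (F := fun y => ENNReal.ofReal (|u y - u x| ^ p))
    (by simp [Real.zero_rpow hp.ne'])

lemma form_eq (h : IsOffDiagonalPart μ κ) {p : ℝ} {u v : (Fin n → ℝ) → ℝ}
    (hF : Integrable (fun z : (Fin n → ℝ) × (Fin n → ℝ) =>
      |u z.2 - u z.1| ^ (p - 2) * (u z.2 - u z.1) * (v z.2 - v z.1)) (volume ⊗ₘ κ)) :
    form p μ u v = ∫ z, |u z.2 - u z.1| ^ (p - 2) * (u z.2 - u z.1) * (v z.2 - v z.1)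
      ∂(volume ⊗ₘ κ) := by
  have := h.sFinite
  rw [Measure.integral_compProd hF, form]
  congr 1
  ext x
  rw [h.eq_restrict, setIntegral_eq_integral_of_forall_compl_eq_zero]
  intro y hy
  have : y = x := by simpa using hy
  simp [this]

lemma lintegral_swap (h : IsOffDiagonalPart μ κ)
    {G : (Fin n → ℝ) × (Fin n → ℝ) → ℝ≥0∞} (hG : Measurable G) :
    ∫⁻ z, G z.swap ∂(volume ⊗ₘ κ) = ∫⁻ z, G z ∂(volume ⊗ₘ κ) := by
  conv_rhs => rw [← h.swap]
  rw [lintegral_map hG measurable_swap]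

/-- A symmetric function vanishing outside `A × ℝⁿ ∪ ℝⁿ × A` is controlled by its integral
over `A × ℝⁿ`. -/
lemma lintegral_le_two_mul (h : IsOffDiagonalPart μ κ)
    {G : (Fin n → ℝ) × (Fin n → ℝ) → ℝ≥0∞} (hG : Measurable G) (hGs : ∀ z, G z.swap = G z)
    {A : Set (Fin n → ℝ)} (hA : MeasurableSet A) (hG0 : ∀ z, z.1 ∉ A → z.2 ∉ A → G z = 0) :
    ∫⁻ z, G z ∂(volume ⊗ₘ κ) ≤ 2 * ∫⁻ z in A ×ˢ Set.univ, G z ∂(volume ⊗ₘ κ) := by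
  have hAm : MeasurableSet (A ×ˢ (Set.univ : Set (Fin n → ℝ))) := hA.prod MeasurableSet.univ
  set I := (A ×ˢ (Set.univ : Set (Fin n → ℝ))).indicator G with hI
  have hIm : Measurable I := hG.indicator hAm
  calc ∫⁻ z, G z ∂(volume ⊗ₘ κ) ≤ ∫⁻ z, (I z + I z.swap) ∂(volume ⊗ₘ κ) := by
        refine lintegral_mono fun z => ?_
        by_cases h1 : z.1 ∈ A
        · refine le_add_right ?_
          rw [hI, Set.indicator_of_mem (by simpa using h1)]
        · by_cases h2 : z.2 ∈ A
          · refine le_add_left ?_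
            rw [hI, Set.indicator_of_mem (by simpa using h2), hGs]
          · simp [hG0 z h1 h2]
    _ = _ := by
        rw [lintegral_add_left hIm, h.lintegral_swap hIm, two_mul, hI, lintegral_indicator hAm]

lemma setLIntegral_prod_le (h : IsOffDiagonalPart μ κ)
    {G : (Fin n → ℝ) × (Fin n → ℝ) → ℝ≥0∞} (hG : Measurable G)
    {A B : Set (Fin n → ℝ)} (hA : MeasurableSet A) (hB : MeasurableSet B) {K : ℝ≥0∞}
    (hK : ∀ x ∈ A, ∫⁻ y in B, G (x, y) ∂(μ x) ≤ K) :
    ∫⁻ z in A ×ˢ B, G z ∂(volume ⊗ₘ κ) ≤ K * volume A := by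
  have := h.sFinite
  rw [Measure.setLIntegral_compProd hG hA hB]
  calc _ ≤ ∫⁻ x in A, K := by
        refine setLIntegral_mono' hA fun x hx => le_trans ?_ (hK x hx)
        refine lintegral_mono' (Measure.restrict_mono le_rfl ?_) le_rfl
        rw [h.eq_restrict]
        exact Measure.restrict_le_self
    _ = _ := by simp

/-- Fubini handles the first coordinate, since a null set of base points carries no jump measure.
Swap invariance transfers this to the second coordinate. -/
lemma ae_mem_imp (h : IsOffDiagonalPart μ κ) {A : Set (Fin n → ℝ)} (hA : MeasurableSet A)
    {P : (Fin n → ℝ) → Prop} (hP : MeasurableSet {x | P x})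
    (hae : ∀ᵐ x ∂(volume.restrict A), P x) :
    ∀ᵐ z ∂((volume : Measure (Fin n → ℝ)) ⊗ₘ κ), (z.1 ∈ A → P z.1) ∧ (z.2 ∈ A → P z.2) := by
  rw [ae_restrict_iff' hA] at hae
  have hm : MeasurableSet {x | x ∈ A → P x} := hA.imp hP
  have h1 := Measure.ae_compProd_of_ae_fst κ hm hae
  have h2 : ∀ᵐ z ∂((volume : Measure (Fin n → ℝ)) ⊗ₘ κ), (z.2 ∈ A → P z.2) := by
    have h3 := h1
    rw [← h.swap] at h3
    exact ae_of_ae_map measurable_swap.aemeasurable h3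
  filter_upwards [h1, h2] with z hz1 hz2 using ⟨hz1, hz2⟩

end IsOffDiagonalPart

/-! ### Elementary bounds for the test function -/

/-- Converts a pointwise inequality into an integrated one: `F` will be the form integrand, bounded
below through the supersolution property, `G` the error terms and `H` the logarithmic energy
density. Passing through the lower integral of `G - F` avoids any integrability requirement on `H`.
-/
lemma lintegral_le_of_add_le {α : Type*} [MeasurableSpace α] {J : Measure α} {F G H : α → ℝ}
    (hF : Integrable F J) (hG : Measurable G) (hG0 : ∀ z, 0 ≤ G z) (hH : ∀ z, 0 ≤ H z)
    {a A : ℝ} (ha : 0 ≤ a) (hGa : ∫⁻ z, ENNReal.ofReal (G z) ∂J ≤ ENNReal.ofReal a)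
    (hFA : -A ≤ ∫ z, F z ∂J) (hle : ∀ᵐ z ∂J, H z + F z ≤ G z) :
    ∫⁻ z, ENNReal.ofReal (H z) ∂J ≤ ENNReal.ofReal (a + A) := by
  have hGi : Integrable G J := by
    refine ⟨hG.aestronglyMeasurable, ?_⟩
    rw [hasFiniteIntegral_iff_ofReal (Filter.Eventually.of_forall hG0)]
    exact hGa.trans_lt ENNReal.ofReal_lt_top
  have hGa' : ∫ z, G z ∂J ≤ a := by
    rw [integral_eq_lintegral_of_nonneg_ae (Filter.Eventually.of_forall hG0)
      hG.aestronglyMeasurable]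
    exact ENNReal.toReal_le_of_le_ofReal ha hGa
  calc ∫⁻ z, ENNReal.ofReal (H z) ∂J ≤ ∫⁻ z, ENNReal.ofReal (G z - F z) ∂J := by
        refine lintegral_mono_ae ?_
        filter_upwards [hle] with z hz
        exact ENNReal.ofReal_le_ofReal (by linarith)
    _ = ENNReal.ofReal (∫ z, (G z - F z) ∂J) := by
        refine (ofReal_integral_eq_lintegral_ofReal (f := fun z => G z - F z) (hGi.sub hF) ?_).symm
        filter_upwards [hle] with z hz
        have := hH z
        simp only [Pi.zero_apply]
        linarith
    _ ≤ _ := by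
        apply ENNReal.ofReal_le_ofReal
        rw [integral_sub hGi hF]
        linarith

lemma add_rpow_le_two_rpow_mul {p a b : ℝ} (hp : 0 ≤ p) (ha : 0 ≤ a) (hb : 0 ≤ b) :
    (a + b) ^ p ≤ 2 ^ p * (a ^ p + b ^ p) := by
  have h1 : a + b ≤ 2 * max a b := by
    have := le_max_left a b
    have := le_max_right a b
    linarith
  calc (a + b) ^ p ≤ (2 * max a b) ^ p := Real.rpow_le_rpow (by positivity) h1 hp
    _ = 2 ^ p * max a b ^ p := Real.mul_rpow (by norm_num) (by positivity)
    _ ≤ _ := by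
      have := Real.rpow_nonneg ha p
      have := Real.rpow_nonneg hb p
      gcongr
      rcases max_choice a b with h | h <;> rw [h] <;> linarith

lemma abs_rpow_sub_rpow_le {p a b : ℝ} (hp : 1 < p) (ha : a ∈ Set.Icc (0 : ℝ) 1)
    (hb : b ∈ Set.Icc (0 : ℝ) 1) : |b ^ p - a ^ p| ≤ p * |b - a| := by
  have := Convex.norm_image_sub_le_of_norm_hasDerivWithin_le (f := fun x : ℝ => x ^ p)
    (f' := fun x => p * x ^ (p - 1)) (s := Set.Icc (0 : ℝ) 1) (C := p)
    (fun x _ => (Real.hasDerivAt_rpow_const (Or.inr hp.le)).hasDerivWithinAt)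
    (fun x hx => by
      rw [Real.norm_of_nonneg (by have := hx.1; positivity)]
      have := Real.rpow_le_one hx.1 hx.2 (by linarith : 0 ≤ p - 1)
      nlinarith) (convex_Icc 0 1) ha hb
  simpa using this

lemma abs_rpow_one_sub_sub_le {p ε a b : ℝ} (hp : 1 < p) (hε : 0 < ε) (ha : ε ≤ a)
    (hb : ε ≤ b) : |b ^ (1 - p) - a ^ (1 - p)| ≤ (p - 1) * ε ^ (-p) * |b - a| := by
  have := Convex.norm_image_sub_le_of_norm_hasDerivWithin_le (f := fun x : ℝ => x ^ (1 - p))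
    (f' := fun x => (1 - p) * x ^ (1 - p - 1)) (s := Set.Ici ε) (C := (p - 1) * ε ^ (-p))
    (fun x hx => (Real.hasDerivAt_rpow_const
      (Or.inl (hε.trans_le hx).ne')).hasDerivWithinAt)
    (fun x hx => by
      have hx0 : 0 < x := hε.trans_le hx
      rw [norm_mul, Real.norm_of_nonneg (Real.rpow_nonneg hx0.le _), Real.norm_eq_abs,
        abs_of_neg (by linarith), show 1 - p - 1 = -p by ring, neg_sub]
      have := Real.rpow_le_rpow_of_nonpos hε hx (by linarith : -p ≤ 0)
      have : 0 ≤ p - 1 := by linarith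
      gcongr) (convex_Ici ε) ha hb
  simpa using this

/-- The test function `τ^p max(u, ε)^(1-p)` inherits a difference bound from `τ` and `u`. -/
lemma abs_testFunction_sub_le {p ε : ℝ} (hp : 1 < p) (hε : 0 < ε) :
    ∃ K : ℝ, 0 < K ∧ ∀ a b σ τ : ℝ, σ ∈ Set.Icc (0 : ℝ) 1 → τ ∈ Set.Icc (0 : ℝ) 1 →
      |τ ^ p * max b ε ^ (1 - p) - σ ^ p * max a ε ^ (1 - p)| ^ p ≤
        K * (|τ - σ| ^ p + |b - a| ^ p) := by
  set L := p * ε ^ (1 - p) + (p - 1) * ε ^ (-p) with hL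
  have hL0 : 0 < L := by positivity
  refine ⟨L ^ p * 2 ^ p, by positivity, fun a b σ τ hσ hτ => ?_⟩
  have hle : |τ ^ p * max b ε ^ (1 - p) - σ ^ p * max a ε ^ (1 - p)| ≤
      L * (|τ - σ| + |b - a|) := by
    have h1 := abs_rpow_sub_rpow_le hp hσ hτ
    have h2 := abs_rpow_one_sub_sub_le hp hε (le_max_right a ε) (le_max_right b ε)
    have h3 : |max b ε - max a ε| ≤ |b - a| := by
      have := abs_max_sub_max_le_max b ε a ε
      simpa using this
    have h4 : max b ε ^ (1 - p) ≤ ε ^ (1 - p) :=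
      Real.rpow_le_rpow_of_nonpos hε (le_max_right _ _) (by linarith)
    have h4' : 0 ≤ max b ε ^ (1 - p) := Real.rpow_nonneg (hε.le.trans (le_max_right _ _)) _
    have h5 : σ ^ p ≤ 1 := Real.rpow_le_one hσ.1 hσ.2 (by linarith)
    have h5' : 0 ≤ σ ^ p := Real.rpow_nonneg hσ.1 _
    have e : τ ^ p * max b ε ^ (1 - p) - σ ^ p * max a ε ^ (1 - p) =
        (τ ^ p - σ ^ p) * max b ε ^ (1 - p) +
          σ ^ p * (max b ε ^ (1 - p) - max a ε ^ (1 - p)) := by ring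
    rw [e]
    refine (abs_add_le _ _).trans ?_
    rw [abs_mul, abs_mul, abs_of_nonneg h4', abs_of_nonneg h5']
    calc _ ≤ (p * |τ - σ|) * ε ^ (1 - p) + 1 * ((p - 1) * ε ^ (-p) * |b - a|) := by
          gcongr
          exact h2.trans (by gcongr)
      _ ≤ _ := by
          rw [hL]
          have q1 : 0 ≤ |τ - σ| * ((p - 1) * ε ^ (-p)) := by positivity
          have q2 : 0 ≤ |b - a| * (p * ε ^ (1 - p)) := by positivity
          nlinarith
  calc _ ≤ (L * (|τ - σ| + |b - a|)) ^ p :=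
        Real.rpow_le_rpow (abs_nonneg _) hle (by linarith)
    _ = L ^ p * (|τ - σ| + |b - a|) ^ p := Real.mul_rpow hL0.le (by positivity)
    _ ≤ L ^ p * (2 ^ p * (|τ - σ| ^ p + |b - a| ^ p)) := by
        gcongr
        exact add_rpow_le_two_rpow_mul (by linarith) (abs_nonneg _) (abs_nonneg _)
    _ = _ := by ring

/-- A crude Young inequality, obtained by replacing the smaller number by the larger. It dominates
the form integrand by the `p`-energies of the solution and of the test function. -/
lemma rpow_sub_one_mul_le {p a b : ℝ} (hp : 1 < p) (ha : 0 ≤ a) (hb : 0 ≤ b) :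
    a ^ (p - 1) * b ≤ a ^ p + b ^ p := by
  rcases le_total a b with h | h
  · calc a ^ (p - 1) * b ≤ b ^ (p - 1) * b := by gcongr
      _ = b ^ p := by
        rcases hb.eq_or_lt with rfl | hb
        · rw [mul_zero, Real.zero_rpow (by linarith)]
        · rw [Real.rpow_sub_one hb.ne']; field_simp
      _ ≤ _ := by have := Real.rpow_nonneg ha p; linarith
  · calc a ^ (p - 1) * b ≤ a ^ (p - 1) * a := by gcongr
      _ = a ^ p := by
        rcases ha.eq_or_lt with rfl | ha
        · rw [mul_zero, Real.zero_rpow (by linarith)]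
        · rw [Real.rpow_sub_one ha.ne']; field_simp
      _ ≤ _ := by have := Real.rpow_nonneg hb p; linarith

lemma abs_rpow_sub_two_mul {p t : ℝ} (hp : 1 < p) : |(|t| ^ (p - 2) * t)| = |t| ^ (p - 1) := by
  rcases eq_or_ne t 0 with rfl | ht
  · simp [Real.zero_rpow (by linarith : p - 1 ≠ 0)]
  · rw [abs_mul, abs_of_nonneg (by positivity), ← Real.rpow_add_one (abs_pos.2 ht).ne']
    congr 1; ring

/-! ### The source term -/

section Source

variable {s : Fin n → ℝ} {s₀ p q : ℝ}

lemma sBar_pos [Nonempty (Fin n)] (hs₀ : 0 < s₀) (hs : ∀ k, s₀ ≤ s k ∧ s k < 1) :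
    0 < sBar s := by
  have hn : 0 < n := Fin.pos (Classical.arbitrary _)
  have : 0 < ∑ k, 1 / s k :=
    Finset.sum_pos (fun k _ => by have := s_pos hs₀ hs k; positivity) Finset.univ_nonempty
  unfold sBar
  positivity

/-- Identifies `s_max n / s̄` as the homogeneous dimension: the exponent of `ϱ` in the volume of a
rectangle. It is what makes the exponent `q / (p s̄)` scale correctly. -/
lemma sum_ratio_eq [Nonempty (Fin n)] (s : Fin n → ℝ) :
    ∑ k, sMax s / s k = sMax s * n / sBar s := by
  have hn : (0 : ℝ) < n := by exact_mod_cast Fin.pos (Classical.arbitrary (Fin n))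
  have : sBar s = n / ∑ k, 1 / s k := by
    unfold sBar
    rw [mul_inv, one_div, inv_inv, div_eq_mul_inv]
  rw [this]
  have h3 : ∑ k, sMax s / s k = sMax s * ∑ k, 1 / s k := by
    rw [Finset.mul_sum]
    exact Finset.sum_congr rfl fun k _ => by ring
  rw [h3]
  field_simp

/-- The contribution of the right-hand side, tested with a function bounded by `ε ^ (1 - p)`
and supported in an anisotropic rectangle. -/
lemma abs_integral_source_le [Nonempty (Fin n)] (hp : 1 < p) (hq : (n : ℝ) < q)
    (hs₀ : 0 < s₀) (hs : ∀ k, s₀ ≤ s k ∧ s k < 1) (hps : p < n / sBar s) {r ϱ t ε : ℝ}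
    (hϱ : 0 < ϱ) (ht : 0 < t) (htr : t ≤ r) (htϱ : t ≤ ϱ) (hε : 0 < ε)
    {Ω : Set (Fin n → ℝ)} {z : Fin n → ℝ} (hR : rect s ϱ z ⊆ Ω)
    {f ψ : (Fin n → ℝ) → ℝ}
    (hf : MemLp f (ENNReal.ofReal (q / (p * sBar s))) (volume.restrict Ω))
    (hfε : ENNReal.ofReal (r ^ (p * sMax s / (p - 1) * ((q - n) / q))) *
      eLpNorm f (ENNReal.ofReal (q / (p * sBar s))) (volume.restrict Ω) ^ (1 / (p - 1)) ≤
        ENNReal.ofReal ε)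
    (hψ0 : ∀ x, 0 ≤ ψ x) (hψ : ∀ x, ψ x ≤ ε ^ (1 - p)) (hψR : ∀ x ∉ rect s ϱ z, ψ x = 0) :
    |∫ x in Ω, f x * ψ x| ≤ t ^ (-(p * sMax s)) * (2 ^ n * ϱ ^ (∑ k, sMax s / s k)) := by
  have hn : (0 : ℝ) < n := by exact_mod_cast Fin.pos (Classical.arbitrary (Fin n))
  have hq0 : 0 < q := hn.trans hq
  have hr : 0 < r := ht.trans_le htr
  have hp1 : 0 < p - 1 := by linarith
  have hsb := sBar_pos hs₀ hs
  have hsm := sMax_pos hs₀ hs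
  set Q := q / (p * sBar s) with hQ
  have hpsb : p * sBar s < n := by rwa [lt_div_iff₀ hsb] at hps
  have hQ1 : 1 < Q := by
    rw [hQ, one_lt_div (by positivity)]; linarith
  set δ := p * sMax s / (p - 1) * ((q - n) / q) with hδ
  set N := eLpNorm f (ENNReal.ofReal Q) (volume.restrict Ω) with hN
  set V := 2 ^ n * ϱ ^ (∑ k, sMax s / s k) with hV
  have hV0 : 0 < V := by positivity
  have hRm := measurableSet_rect s ϱ z
  -- bound on the norm of `f`
  have hNle : N ≤ ENNReal.ofReal ((ε * r ^ (-δ)) ^ (p - 1)) := by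
    have h1 : N ^ (1 / (p - 1)) ≤ ENNReal.ofReal (ε * r ^ (-δ)) := by
      have h2 : ENNReal.ofReal (r ^ (-δ)) * ENNReal.ofReal (r ^ δ) = 1 := by
        rw [← ENNReal.ofReal_mul (by positivity), ← Real.rpow_add hr]; simp
      calc N ^ (1 / (p - 1)) = ENNReal.ofReal (r ^ (-δ)) *
            (ENNReal.ofReal (r ^ δ) * N ^ (1 / (p - 1))) := by rw [← mul_assoc, h2, one_mul]
        _ ≤ ENNReal.ofReal (r ^ (-δ)) * ENNReal.ofReal ε := by gcongr
        _ = _ := by rw [← ENNReal.ofReal_mul (by positivity), mul_comm]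
    have h3 := ENNReal.rpow_le_rpow h1 hp1.le
    rwa [← ENNReal.rpow_mul, one_div_mul_cancel hp1.ne', ENNReal.rpow_one,
      ENNReal.ofReal_rpow_of_nonneg (by positivity) hp1.le] at h3
  have hL1 : ∫⁻ x in rect s ϱ z, ‖f x‖ₑ ≤
      ENNReal.ofReal ((ε * r ^ (-δ)) ^ (p - 1)) * ENNReal.ofReal (V ^ (1 - 1 / Q)) := by
    have hfR : AEStronglyMeasurable f (volume.restrict (rect s ϱ z)) :=
      hf.1.mono_measure (Measure.restrict_mono hR le_rfl)
    have h1 := eLpNorm_le_eLpNorm_mul_rpow_measure_univ (p := 1) (q := ENNReal.ofReal Q)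
      (by rw [← ENNReal.ofReal_one]; exact ENNReal.ofReal_le_ofReal hQ1.le) hfR
    rw [eLpNorm_one_eq_lintegral_enorm, Measure.restrict_apply_univ, volume_rect hϱ, ← hV,
      ENNReal.toReal_ofReal (by linarith), ENNReal.toReal_one, div_one,
      ENNReal.ofReal_rpow_of_pos hV0] at h1
    refine h1.trans ?_
    gcongr
    exact (eLpNorm_mono_measure f (Measure.restrict_mono hR le_rfl)).trans hNle
  -- Hölder leaves `V ^ (-1/Q)`, of order `ϱ ^ (-p s_max n / q)`, and the bound on `f` leaves `r ^
  -- (-p s_max (q-n) / q)`. After both radii are replaced by the smaller `t`, the exponents add up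
  -- to `-p s_max`.
  have hreal : ε ^ (1 - p) * ((ε * r ^ (-δ)) ^ (p - 1) * V ^ (1 - 1 / Q)) ≤
      t ^ (-(p * sMax s)) * V := by
    have e1 : (ε * r ^ (-δ)) ^ (p - 1) = ε ^ (p - 1) * r ^ (-(p * sMax s * ((q - n) / q))) := by
      rw [Real.mul_rpow hε.le (by positivity), ← Real.rpow_mul hr.le]
      congr 2
      rw [hδ]; field_simp
    have e2 : ε ^ (1 - p) * ε ^ (p - 1) = 1 := by rw [← Real.rpow_add hε]; simp
    have e3 : V ^ (1 - 1 / Q) = V * V ^ (-(1 / Q)) := by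
      rw [sub_eq_add_neg, Real.rpow_add hV0, Real.rpow_one]
    have h1 : V ^ (-(1 / Q)) ≤ t ^ (-(p * sMax s * (n / q))) := by
      calc V ^ (-(1 / Q)) ≤ (ϱ ^ (∑ k, sMax s / s k)) ^ (-(1 / Q)) := by
            apply Real.rpow_le_rpow_of_nonpos (by positivity)
            · rw [hV]
              have : (1 : ℝ) ≤ 2 ^ n := one_le_pow₀ (by norm_num)
              nlinarith
            · rw [neg_nonpos]; positivity
        _ = ϱ ^ (-(p * sMax s * (n / q))) := by
            rw [← Real.rpow_mul hϱ.le]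
            congr 1
            rw [sum_ratio_eq s, hQ]; field_simp
        _ ≤ _ := by
            apply Real.rpow_le_rpow_of_nonpos ht htϱ
            rw [neg_nonpos]; positivity
    have h2 : r ^ (-(p * sMax s * ((q - n) / q))) ≤ t ^ (-(p * sMax s * ((q - n) / q))) := by
      apply Real.rpow_le_rpow_of_nonpos ht htr
      rw [neg_nonpos]
      have : 0 < q - n := by linarith
      positivity
    calc _ = (ε ^ (1 - p) * ε ^ (p - 1)) *
          (r ^ (-(p * sMax s * ((q - n) / q))) * V ^ (-(1 / Q)) * V) := by rw [e1, e3]; ring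
      _ ≤ 1 * (t ^ (-(p * sMax s * ((q - n) / q))) * t ^ (-(p * sMax s * (n / q))) * V) := by
          rw [e2]; gcongr
      _ = _ := by
          rw [← Real.rpow_add ht, one_mul]
          congr 2
          field_simp; ring
  have hmain : ‖∫ x in Ω, f x * ψ x‖ₑ ≤ ENNReal.ofReal (t ^ (-(p * sMax s)) * V) := by
    calc ‖∫ x in Ω, f x * ψ x‖ₑ ≤ ∫⁻ x in Ω, ‖f x * ψ x‖ₑ := enorm_integral_le_lintegral_enorm _
      _ ≤ ∫⁻ x, (rect s ϱ z).indicator (fun x => ENNReal.ofReal (ε ^ (1 - p)) * ‖f x‖ₑ) x := by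
          refine (lintegral_mono fun x => ?_).trans (setLIntegral_le_lintegral _ _)
          by_cases hx : x ∈ rect s ϱ z
          · rw [Set.indicator_of_mem hx, enorm_mul, mul_comm]
            gcongr
            rw [Real.enorm_eq_ofReal (hψ0 x)]
            exact ENNReal.ofReal_le_ofReal (hψ x)
          · simp [hψR x hx]
      _ = ENNReal.ofReal (ε ^ (1 - p)) * ∫⁻ x in rect s ϱ z, ‖f x‖ₑ := by
          rw [lintegral_indicator hRm, lintegral_const_mul' _ _ ENNReal.ofReal_ne_top]
      _ ≤ ENNReal.ofReal (ε ^ (1 - p)) * (ENNReal.ofReal ((ε * r ^ (-δ)) ^ (p - 1)) *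
            ENNReal.ofReal (V ^ (1 - 1 / Q))) := by gcongr
      _ ≤ _ := by
          rw [← ENNReal.ofReal_mul (by positivity), ← ENNReal.ofReal_mul (by positivity)]
          exact ENNReal.ofReal_le_ofReal hreal
  rw [Real.enorm_eq_ofReal_abs] at hmain
  exact (ENNReal.ofReal_le_ofReal_iff (by positivity)).1 hmain

end Source

/-! ### The logarithmic energy estimate -/

section LogEnergy

variable {s : Fin n → ℝ} {s₀ p Λ : ℝ} {μ κ : Kernel (Fin n → ℝ) (Fin n → ℝ)}

/-- The energy of a cutoff function with respect to the jump measure. -/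
lemma IsOffDiagonalPart.lintegral_cutoff_le (hκ : IsOffDiagonalPart μ κ)
    (hμ : Admissible p Λ s μ) (hp : 1 < p) (hΛ : 1 ≤ Λ)
    (hs₀ : 0 < s₀) (hs : ∀ k, s₀ ≤ s k ∧ s k < 1) {ρ : ℝ} (hρ : 0 < ρ) (z : Fin n → ℝ) :
    ∫⁻ w, ENNReal.ofReal (|cutoff s ρ z w.2 - cutoff s ρ z w.1| ^ p) ∂(volume ⊗ₘ κ) ≤
      ENNReal.ofReal (2 * ((n : ℝ) ^ p * (2 ^ (p + 1) * Λ * (ρ / 17) ^ (-(p * sMax s))))) *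
        volume (rect s (18 / 17 * ρ) z) := by
  have hτ := measurable_cutoff s ρ z
  have hR := measurableSet_rect s (18 / 17 * ρ) z
  refine (hκ.lintegral_le_two_mul (by fun_prop) (fun w => ?_) hR fun w h1 h2 => ?_).trans ?_
  · simp only [Prod.fst_swap, Prod.snd_swap, abs_sub_comm]
  · rw [cutoff_eq_zero hs₀ hs hρ h1, cutoff_eq_zero hs₀ hs hρ h2]
    simp [Real.zero_rpow (by linarith : p ≠ 0)]
  · rw [ENNReal.ofReal_mul (by norm_num), mul_assoc, ENNReal.ofReal_ofNat]
    gcongr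
    refine hκ.setLIntegral_prod_le (by fun_prop) hR MeasurableSet.univ fun x _ => ?_
    rw [Measure.restrict_univ]
    exact hμ.lintegral_cutoff_le hp hΛ hs₀ hs hρ z x

/-- The standard logarithmic test function. -/
def logTest (p : ℝ) (s : Fin n → ℝ) (ρ : ℝ) (z : Fin n → ℝ) (u : (Fin n → ℝ) → ℝ) (ε : ℝ)
    (x : Fin n → ℝ) : ℝ :=
  cutoff s ρ z x ^ p * max (u x) ε ^ (1 - p)

lemma measurable_logTest {ρ ε : ℝ} {z : Fin n → ℝ} {u : (Fin n → ℝ) → ℝ} (hu : Measurable u) :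
    Measurable (logTest p s ρ z u ε) := by
  have hτ := measurable_cutoff s ρ z
  unfold logTest
  fun_prop

lemma logTest_nonneg {ρ ε : ℝ} (hε : 0 < ε) (z : Fin n → ℝ) (u : (Fin n → ℝ) → ℝ)
    (x : Fin n → ℝ) : 0 ≤ logTest p s ρ z u ε x :=
  mul_nonneg (Real.rpow_nonneg (cutoff_nonneg _ _ _ _) _)
    (Real.rpow_nonneg (hε.le.trans (le_max_right _ _)) _)

lemma logTest_le (hp : 1 < p) {ρ ε : ℝ} (hε : 0 < ε) (z : Fin n → ℝ) (u : (Fin n → ℝ) → ℝ)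
    (x : Fin n → ℝ) : logTest p s ρ z u ε x ≤ ε ^ (1 - p) := by
  have h1 : cutoff s ρ z x ^ p ≤ 1 :=
    Real.rpow_le_one (cutoff_nonneg _ _ _ _) (cutoff_le_one _ _ _ _) (by linarith)
  have h2 : max (u x) ε ^ (1 - p) ≤ ε ^ (1 - p) :=
    Real.rpow_le_rpow_of_nonpos hε (le_max_right _ _) (by linarith)
  calc _ ≤ 1 * ε ^ (1 - p) := by unfold logTest; gcongr
    _ = _ := one_mul _

lemma logTest_eq_zero (hp : 1 < p) (hs₀ : 0 < s₀) (hs : ∀ k, s₀ ≤ s k ∧ s k < 1) {ρ ε : ℝ}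
    (hρ : 0 < ρ) {z : Fin n → ℝ} (u : (Fin n → ℝ) → ℝ) {x : Fin n → ℝ}
    (hx : x ∉ rect s (18 / 17 * ρ) z) : logTest p s ρ z u ε x = 0 := by
  rw [logTest, cutoff_eq_zero hs₀ hs hρ hx, Real.zero_rpow (by linarith), zero_mul]

section

variable {Ω : Set (Fin n → ℝ)} {u : (Fin n → ℝ) → ℝ} {ρ ε : ℝ} {z : Fin n → ℝ}

/-- Finiteness of the jump energies of the test function. -/
lemma IsOffDiagonalPart.lintegral_logTest_lt_top (hκ : IsOffDiagonalPart μ κ)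
    (hμ : Admissible p Λ s μ) (hp : 1 < p) (hΛ : 1 ≤ Λ)
    (hs₀ : 0 < s₀) (hs : ∀ k, s₀ ≤ s k ∧ s k < 1) (hρ : 0 < ρ) (hε : 0 < ε)
    (hΩ : MeasurableSet Ω) (hR : rect s (18 / 17 * ρ) z ⊆ Ω) (hu : MemV p μ Ω u) :
    ∫⁻ w, ENNReal.ofReal (|logTest p s ρ z u ε w.2 - logTest p s ρ z u ε w.1| ^ p)
      ∂(volume ⊗ₘ κ) < ∞ := by
  obtain ⟨hum, -, hue⟩ := hu
  have hτ := measurable_cutoff s ρ z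
  have hφ := measurable_logTest (p := p) (s := s) (ρ := ρ) (ε := ε) (z := z) hum
  obtain ⟨K, hK, hKb⟩ := abs_testFunction_sub_le hp hε
  refine (hκ.lintegral_le_two_mul (by fun_prop) (fun w => ?_) hΩ fun w h1 h2 => ?_).trans_lt ?_
  · simp only [Prod.fst_swap, Prod.snd_swap, abs_sub_comm]
  · rw [logTest_eq_zero hp hs₀ hs hρ u (fun h => h1 (hR h)),
      logTest_eq_zero hp hs₀ hs hρ u (fun h => h2 (hR h))]
    simp [Real.zero_rpow (by linarith : p ≠ 0)]
  refine ENNReal.mul_lt_top (by simp) ?_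
  calc _ ≤ ∫⁻ w in Ω ×ˢ Set.univ, (ENNReal.ofReal K *
          ENNReal.ofReal (|cutoff s ρ z w.2 - cutoff s ρ z w.1| ^ p) +
          ENNReal.ofReal K * ENNReal.ofReal (|u w.2 - u w.1| ^ p)) ∂(volume ⊗ₘ κ) := by
        refine lintegral_mono fun w => ?_
        rw [← mul_add, ← ENNReal.ofReal_add (by positivity) (by positivity),
          ← ENNReal.ofReal_mul hK.le]
        exact ENNReal.ofReal_le_ofReal (hKb _ _ _ _
          ⟨cutoff_nonneg _ _ _ _, cutoff_le_one _ _ _ _⟩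
          ⟨cutoff_nonneg _ _ _ _, cutoff_le_one _ _ _ _⟩)
    _ = ENNReal.ofReal K * (∫⁻ w in Ω ×ˢ Set.univ,
          ENNReal.ofReal (|cutoff s ρ z w.2 - cutoff s ρ z w.1| ^ p) ∂(volume ⊗ₘ κ)) +
          ENNReal.ofReal K * energy p μ Ω Set.univ u := by
        rw [lintegral_add_left (by fun_prop), lintegral_const_mul _ (by fun_prop),
          lintegral_const_mul _ (by fun_prop),
          hκ.energy_eq (by linarith) hΩ MeasurableSet.univ hum]
    _ < ∞ := by
        refine ENNReal.add_lt_top.2 ⟨ENNReal.mul_lt_top ENNReal.ofReal_lt_top ?_,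
          ENNReal.mul_lt_top ENNReal.ofReal_lt_top hue⟩
        refine (setLIntegral_le_lintegral _ _).trans_lt
          ((hκ.lintegral_cutoff_le hμ hp hΛ hs₀ hs hρ z).trans_lt ?_)
        exact ENNReal.mul_lt_top ENNReal.ofReal_lt_top (volume_rect_lt_top (by positivity) _)

lemma memH_logTest (hκ : IsOffDiagonalPart μ κ)
    (hμ : Admissible p Λ s μ) (hp : 1 < p) (hΛ : 1 ≤ Λ)
    (hs₀ : 0 < s₀) (hs : ∀ k, s₀ ≤ s k ∧ s k < 1) (hρ : 0 < ρ) (hε : 0 < ε)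
    (hΩ : MeasurableSet Ω) (hΩv : volume Ω < ∞) (hR : rect s (18 / 17 * ρ) z ⊆ Ω)
    (hu : MemV p μ Ω u) : MemH p μ Ω (logTest p s ρ z u ε) := by
  have hφ := measurable_logTest (p := p) (s := s) (ρ := ρ) (ε := ε) (z := z) hu.1
  refine ⟨hφ, fun x hx => logTest_eq_zero hp hs₀ hs hρ u fun h => hx (hR h), ?_⟩
  refine ENNReal.add_lt_top.2 ⟨?_, ?_⟩
  · calc _ ≤ ∫⁻ x in Ω, ENNReal.ofReal ((ε ^ (1 - p)) ^ p) := by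
          refine lintegral_mono fun x => ENNReal.ofReal_le_ofReal ?_
          rw [abs_of_nonneg (logTest_nonneg hε _ _ _)]
          exact Real.rpow_le_rpow (logTest_nonneg hε _ _ _) (logTest_le hp hε _ _ _)
            (by linarith)
      _ = ENNReal.ofReal ((ε ^ (1 - p)) ^ p) * volume Ω := by simp
      _ < ∞ := ENNReal.mul_lt_top ENNReal.ofReal_lt_top hΩv
  · rw [hκ.energy_eq (by linarith) MeasurableSet.univ MeasurableSet.univ hφ, Set.univ_prod_univ,
      Measure.restrict_univ]
    exact hκ.lintegral_logTest_lt_top hμ hp hΛ hs₀ hs hρ hε hΩ hR hu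

/-- The integrand of the form tested with the logarithmic test function is integrable. -/
lemma IsOffDiagonalPart.integrable_logTest (hκ : IsOffDiagonalPart μ κ)
    (hμ : Admissible p Λ s μ) (hp : 1 < p) (hΛ : 1 ≤ Λ)
    (hs₀ : 0 < s₀) (hs : ∀ k, s₀ ≤ s k ∧ s k < 1) (hρ : 0 < ρ) (hε : 0 < ε)
    (hΩ : MeasurableSet Ω) (hR : rect s (18 / 17 * ρ) z ⊆ Ω) (hu : MemV p μ Ω u) :
    Integrable (fun w : (Fin n → ℝ) × (Fin n → ℝ) =>
      |u w.2 - u w.1| ^ (p - 2) * (u w.2 - u w.1) *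
        (logTest p s ρ z u ε w.2 - logTest p s ρ z u ε w.1)) (volume ⊗ₘ κ) := by
  have hum := hu.1
  have hφ := measurable_logTest (p := p) (s := s) (ρ := ρ) (ε := ε) (z := z) hum
  refine ⟨Measurable.aestronglyMeasurable (by fun_prop), ?_⟩
  rw [hasFiniteIntegral_iff_enorm]
  simp_rw [Real.enorm_eq_ofReal_abs, abs_mul _ (logTest p s ρ z u ε _ - _),
    abs_rpow_sub_two_mul hp]
  refine (hκ.lintegral_le_two_mul (by fun_prop) (fun w => ?_) hΩ fun w h1 h2 => ?_).trans_lt ?_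
  · simp only [Prod.fst_swap, Prod.snd_swap, abs_sub_comm]
  · rw [logTest_eq_zero hp hs₀ hs hρ u (fun h => h1 (hR h)),
      logTest_eq_zero hp hs₀ hs hρ u (fun h => h2 (hR h))]
    simp
  refine ENNReal.mul_lt_top (by simp) ?_
  calc _ ≤ ∫⁻ w in Ω ×ˢ Set.univ, (ENNReal.ofReal (|u w.2 - u w.1| ^ p) +
          ENNReal.ofReal (|logTest p s ρ z u ε w.2 - logTest p s ρ z u ε w.1| ^ p))
          ∂(volume ⊗ₘ κ) := by
        refine lintegral_mono fun w => ?_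
        rw [← ENNReal.ofReal_add (by positivity) (by positivity)]
        exact ENNReal.ofReal_le_ofReal
          (rpow_sub_one_mul_le hp (abs_nonneg _) (abs_nonneg _))
    _ = energy p μ Ω Set.univ u + ∫⁻ w in Ω ×ˢ Set.univ,
          ENNReal.ofReal (|logTest p s ρ z u ε w.2 - logTest p s ρ z u ε w.1| ^ p)
          ∂(volume ⊗ₘ κ) := by
        rw [lintegral_add_left (by fun_prop),
          hκ.energy_eq (by linarith) hΩ MeasurableSet.univ hum]
    _ < ∞ := ENNReal.add_lt_top.2 ⟨hu.2.2, (setLIntegral_le_lintegral _ _).trans_lt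
          (hκ.lintegral_logTest_lt_top hμ hp hΛ hs₀ hs hρ hε hΩ hR hu)⟩

end

end LogEnergy

section LogEnergy

variable {s : Fin n → ℝ} {s₀ p Λ : ℝ} {μ κ : Kernel (Fin n → ℝ) (Fin n → ℝ)}

/-- Pointwise form of the logarithmic energy estimate. -/
lemma log_energy_pointwise {c C : ℝ} (hp : 1 < p) (hc : 0 < c) (hC : 0 < C)
    (hcC : ∀ a b σ τ : ℝ, 0 < a → 0 < b → 0 ≤ σ → 0 ≤ τ →
      |b - a| ^ (p - 2) * (b - a) * (τ ^ p * b ^ (1 - p) - σ ^ p * a ^ (1 - p)) ≤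
        -(c * (min σ τ ^ p * |Real.log b - Real.log a| ^ p)) + C * |τ - σ| ^ p)
    (hs₀ : 0 < s₀) (hs : ∀ k, s₀ ≤ s k ∧ s k < 1) {ρ ε : ℝ} (hρ : 0 < ρ) (hε : 0 < ε)
    {z : Fin n → ℝ} {Ω : Set (Fin n → ℝ)} (hR : rect s (18 / 17 * ρ) z ⊆ Ω)
    (u : (Fin n → ℝ) → ℝ) {x y : Fin n → ℝ} (hx : x ∈ Ω → ε ≤ u x) (hy : y ∈ Ω → ε ≤ u y) :
    (rect s ρ z ×ˢ rect s ρ z).indicator (fun w : (Fin n → ℝ) × (Fin n → ℝ) =>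
        c * |Real.log (max (u w.2) ε) - Real.log (max (u w.1) ε)| ^ p) (x, y) +
      |u y - u x| ^ (p - 2) * (u y - u x) * (logTest p s ρ z u ε y - logTest p s ρ z u ε x) ≤
    (C + 2 ^ (p - 1)) * |cutoff s ρ z y - cutoff s ρ z x| ^ p +
      2 ^ (p - 1) * ε ^ (1 - p) *
        ((rect s (18 / 17 * ρ) z ×ˢ Ωᶜ).indicator (fun w => max (-u w.2) 0 ^ (p - 1)) (x, y) +
         (rect s (18 / 17 * ρ) z ×ˢ Ωᶜ).indicator (fun w => max (-u w.2) 0 ^ (p - 1)) (y, x)) := by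
  have hMΩ : rect s ρ z ⊆ Ω := (rect_mono hs₀ hs hρ.le (by linarith) z).trans hR
  have hind : ∀ x y, 0 ≤ (rect s (18 / 17 * ρ) z ×ˢ Ωᶜ).indicator
      (fun w : (Fin n → ℝ) × (Fin n → ℝ) => max (-u w.2) 0 ^ (p - 1)) (x, y) := fun x y =>
    Set.indicator_nonneg (fun w _ => Real.rpow_nonneg (le_max_right _ _) _) _
  have hτ0 := cutoff_nonneg s ρ z
  have hτ1 := cutoff_le_one s ρ z
  -- With `y` outside `Ω`, cutoff and test function vanish at `y`. The difference of cutoffs is then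
  -- `τ(x)` itself, and what remains is the tail of `u_-`.
  have hcross : ∀ x y, x ∈ Ω → y ∉ Ω → ε ≤ u x →
      |u y - u x| ^ (p - 2) * (u y - u x) * (logTest p s ρ z u ε y - logTest p s ρ z u ε x) ≤
      2 ^ (p - 1) * |cutoff s ρ z y - cutoff s ρ z x| ^ p + 2 ^ (p - 1) * ε ^ (1 - p) *
        (rect s (18 / 17 * ρ) z ×ˢ Ωᶜ).indicator (fun w => max (-u w.2) 0 ^ (p - 1)) (x, y) := by
    intro x y hx hy hux
    have hyR : y ∉ rect s (18 / 17 * ρ) z := fun h => hy (hR h)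
    rw [logTest_eq_zero hp hs₀ hs hρ u hyR, logTest, max_eq_left hux,
      cutoff_eq_zero hs₀ hs hρ hyR, zero_sub (cutoff s ρ z x), abs_neg, abs_of_nonneg (hτ0 x)]
    refine (cross_inequality hp hε hux (hτ0 x)).trans ?_
    rw [← mul_assoc]
    gcongr
    by_cases hxR : x ∈ rect s (18 / 17 * ρ) z
    · rw [Set.indicator_of_mem (Set.mk_mem_prod hxR hy)]
      have h1 : cutoff s ρ z x ^ p ≤ 1 := Real.rpow_le_one (hτ0 x) (hτ1 x) (by linarith)
      have h2 : 0 ≤ max (-u y) 0 ^ (p - 1) := Real.rpow_nonneg (le_max_right _ _) _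
      exact mul_le_of_le_one_left h2 h1
    · rw [cutoff_eq_zero hs₀ hs hρ hxR, Real.zero_rpow (by linarith), zero_mul]
      exact hind _ _
  have hA : 0 ≤ |cutoff s ρ z y - cutoff s ρ z x| ^ p := by positivity
  have h2p : (0 : ℝ) < 2 ^ (p - 1) := by positivity
  have hεp : 0 < ε ^ (1 - p) := by positivity
  have hCA := mul_nonneg hC.le hA
  have h2A := mul_nonneg h2p.le hA
  have hT1 := mul_nonneg (mul_pos h2p hεp).le (hind x y)
  have hT2 := mul_nonneg (mul_pos h2p hεp).le (hind y x)
  by_cases hxΩ : x ∈ Ω <;> by_cases hyΩ : y ∈ Ω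
  · have h := hcC (u x) (u y) (cutoff s ρ z x) (cutoff s ρ z y) (hε.trans_le (hx hxΩ))
      (hε.trans_le (hy hyΩ)) (hτ0 x) (hτ0 y)
    have hI : (rect s ρ z ×ˢ rect s ρ z).indicator (fun w : (Fin n → ℝ) × (Fin n → ℝ) =>
        c * |Real.log (max (u w.2) ε) - Real.log (max (u w.1) ε)| ^ p) (x, y) ≤
        c * (min (cutoff s ρ z x) (cutoff s ρ z y) ^ p * |Real.log (u y) - Real.log (u x)| ^ p) := by
      by_cases hm : (x, y) ∈ rect s ρ z ×ˢ rect s ρ z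
      · rw [Set.indicator_of_mem hm, cutoff_eq_one hρ hm.1, cutoff_eq_one hρ hm.2, min_self,
          Real.one_rpow, one_mul, max_eq_left (hx hxΩ), max_eq_left (hy hyΩ)]
      · rw [Set.indicator_of_notMem hm]
        have : 0 ≤ min (cutoff s ρ z x) (cutoff s ρ z y) := le_min (hτ0 x) (hτ0 y)
        positivity
    simp only [logTest, max_eq_left (hx hxΩ), max_eq_left (hy hyΩ)] at hI ⊢
    linarith
  · have h := hcross x y hxΩ hyΩ (hx hxΩ)
    rw [Set.indicator_of_notMem (fun hm => hyΩ (hMΩ hm.2))]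
    linarith
  · have h := hcross y x hyΩ hxΩ (hy hyΩ)
    rw [Set.indicator_of_notMem (fun hm => hxΩ (hMΩ hm.1))]
    have e : |u y - u x| ^ (p - 2) * (u y - u x) *
        (logTest p s ρ z u ε y - logTest p s ρ z u ε x) =
        |u x - u y| ^ (p - 2) * (u x - u y) *
        (logTest p s ρ z u ε x - logTest p s ρ z u ε y) := by
      rw [abs_sub_comm]; ring
    rw [e, abs_sub_comm (cutoff s ρ z y)]
    rw [abs_sub_comm] at hCA
    linarith
  · rw [Set.indicator_of_notMem (fun hm => hyΩ (hMΩ hm.2)),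
      logTest_eq_zero hp hs₀ hs hρ u (fun h => hxΩ (hR h)),
      logTest_eq_zero hp hs₀ hs hρ u (fun h => hyΩ (hR h))]
    linarith

/-- The energy of `log u` on anisotropic rectangles, for weak supersolutions bounded below. -/
lemma exists_log_energy_le (n : ℕ) {s₀ p q Λ : ℝ} (hp : 1 < p) (hs₀ : 0 < s₀)
    (hq : (n : ℝ) < q) (hΛ : 1 ≤ Λ) :
    ∃ C : ℝ, 0 < C ∧ ∀ s : Fin n → ℝ, (∀ k, s₀ ≤ s k ∧ s k < 1) → p < n / sBar s →
      ∀ (x₀ : Fin n → ℝ) (r : ℝ), 0 < r →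
      ∀ f : (Fin n → ℝ) → ℝ, MemLp f (ENNReal.ofReal (q / (p * sBar s)))
          (volume.restrict (rect s (5 * r / 4) x₀)) →
      ∀ μ : Kernel (Fin n → ℝ) (Fin n → ℝ), Admissible p Λ s μ →
      ∀ u : (Fin n → ℝ) → ℝ, MemV p μ (rect s (5 * r / 4) x₀) u →
        WeakSupersolution p μ (rect s (5 * r / 4) x₀) f u →
      ∀ ε : ℝ, 0 < ε → (∀ᵐ x ∂(volume.restrict (rect s (5 * r / 4) x₀)), ε ≤ u x) →
        ENNReal.ofReal (r ^ (p * sMax s / (p - 1) * ((q - n) / q))) *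
              eLpNorm f (ENNReal.ofReal (q / (p * sBar s)))
                (volume.restrict (rect s (5 * r / 4) x₀)) ^ (1 / (p - 1)) +
            (ENNReal.ofReal (r ^ (p * sMax s)) *
              tailTerm p μ (rect s (9 * r / 8) x₀) (rect s (5 * r / 4) x₀) u) ^ (1 / (p - 1))
          < ENNReal.ofReal ε →
      ∀ (z : Fin n → ℝ) (ρ : ℝ), 0 < ρ → ρ ≤ 2 * r →
        rect s (18 / 17 * ρ) z ⊆ rect s (9 * r / 8) x₀ →
        energy p μ (rect s ρ z) (rect s ρ z) (fun x => Real.log (max (u x) ε)) ≤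
          ENNReal.ofReal (C * ρ ^ (-(p * sMax s))) * volume (rect s (18 / 17 * ρ) z) := by
  obtain ⟨c, C, hc, hC, hcC⟩ := exists_log_inequality hp
  -- The first summand is the cutoff energy, the second the tail counted once for each order of the
  -- two points, and the final `1` the source term.
  set C₁ := (C + 2 ^ (p - 1)) * (2 * ((n : ℝ) ^ p * (2 ^ (p + 1) * Λ))) +
    2 * 2 ^ (p - 1) + 1 with hC₁
  have hC₁0 : 0 < C₁ := by positivity
  refine ⟨c⁻¹ * (C₁ * 17 ^ p), by positivity, ?_⟩
  intro s hs hps x₀ r hr f hf μ hμ u hu hsuper ε hε hae hεlt z ρ hρ hρr hzA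
  -- For `n = 0` the hypothesis on `p` reads `p < 0`.
  have hn : Nonempty (Fin n) := by
    rcases Nat.eq_zero_or_pos n with rfl | hn
    · simp at hps; linarith
    · exact ⟨⟨0, hn⟩⟩
  obtain ⟨κ, hκ⟩ := hμ.exists_offDiagonalPart (by linarith)
  set Ω := rect s (5 * r / 4) x₀ with hΩdef
  set A := rect s (9 * r / 8) x₀ with hAdef
  set R := rect s (18 / 17 * ρ) z with hRdef
  have hΩ : MeasurableSet Ω := measurableSet_rect _ _ _
  have hRm : MeasurableSet R := measurableSet_rect _ _ _
  have hMm : MeasurableSet (rect s ρ z) := measurableSet_rect _ _ _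
  have hAΩ : A ⊆ Ω := rect_mono hs₀ hs (by positivity) (by linarith) x₀
  have hR : R ⊆ Ω := hzA.trans hAΩ
  have hum := hu.1
  have hp1 : 0 < p - 1 := by linarith
  have hsm := sMax_pos hs₀ hs
  have hsm1 := sMax_le_one hs
  set t := ρ / 17 with ht
  have ht0 : 0 < t := by positivity
  set V := 2 ^ n * (18 / 17 * ρ) ^ (∑ k, sMax s / s k) with hV
  have hV0 : 0 < V := by positivity
  have hRV : volume R = ENNReal.ofReal V := volume_rect (by positivity) z
  -- the tail
  have htail : tailTerm p μ A Ω u ≤ ENNReal.ofReal (t ^ (-(p * sMax s)) * ε ^ (p - 1)) := by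
    have h1 : (ENNReal.ofReal (r ^ (p * sMax s)) * tailTerm p μ A Ω u) ^ (1 / (p - 1)) ≤
        ENNReal.ofReal ε := le_add_self.trans hεlt.le
    have h2 := ENNReal.rpow_le_rpow h1 hp1.le
    rw [← ENNReal.rpow_mul, one_div_mul_cancel hp1.ne', ENNReal.rpow_one,
      ENNReal.ofReal_rpow_of_pos hε] at h2
    have h3 : ENNReal.ofReal (r ^ (-(p * sMax s))) * ENNReal.ofReal (r ^ (p * sMax s)) = 1 := by
      rw [← ENNReal.ofReal_mul (by positivity), ← Real.rpow_add hr]; simp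
    calc tailTerm p μ A Ω u = ENNReal.ofReal (r ^ (-(p * sMax s))) *
          (ENNReal.ofReal (r ^ (p * sMax s)) * tailTerm p μ A Ω u) := by
          rw [← mul_assoc, h3, one_mul]
      _ ≤ ENNReal.ofReal (t ^ (-(p * sMax s))) * ENNReal.ofReal (ε ^ (p - 1)) := by
          gcongr ENNReal.ofReal ?_ * ?_
          apply Real.rpow_le_rpow_of_nonpos ht0 (by linarith)
          rw [neg_nonpos]; positivity
      _ = _ := by rw [← ENNReal.ofReal_mul (by positivity)]
  -- the source term
  have hsource : -(t ^ (-(p * sMax s)) * V) ≤ ∫ x in Ω, f x * logTest p s ρ z u ε x := by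
    have := abs_integral_source_le hp hq hs₀ hs hps (r := r) (ϱ := 18 / 17 * ρ) (t := t) (z := z)
      (ψ := logTest p s ρ z u ε) (by positivity) ht0 (by linarith) (by linarith) hε hR hf
      (le_self_add.trans hεlt.le) (logTest_nonneg hε z u) (logTest_le hp hε z u)
      (fun x hx => logTest_eq_zero hp hs₀ hs hρ u hx)
    exact neg_le_of_abs_le this
  have hint := hκ.integrable_logTest hμ hp hΛ hs₀ hs hρ hε hΩ hR hu
  have hform : -(t ^ (-(p * sMax s)) * V) ≤ ∫ w : (Fin n → ℝ) × (Fin n → ℝ),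
      |u w.2 - u w.1| ^ (p - 2) * (u w.2 - u w.1) *
        (logTest p s ρ z u ε w.2 - logTest p s ρ z u ε w.1) ∂(volume ⊗ₘ κ) := by
    rw [← hκ.form_eq hint]
    exact hsource.trans (hsuper _ (memH_logTest hκ hμ hp hΛ hs₀ hs hρ hε hΩ
      (volume_rect_lt_top (by positivity) _) hR hu) (logTest_nonneg hε z u))
  -- The base point ranges over `R ⊆ M_{9r/8}`, where the supremum in the tail term controls the
  -- inner integral.
  set T : (Fin n → ℝ) × (Fin n → ℝ) → ℝ :=
    (R ×ˢ Ωᶜ).indicator (fun w => max (-u w.2) 0 ^ (p - 1)) with hT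
  have hT0 : ∀ w, 0 ≤ T w := fun w =>
    Set.indicator_nonneg (fun w _ => Real.rpow_nonneg (le_max_right _ _) _) _
  have hTm : Measurable T := Measurable.indicator (by fun_prop) (hRm.prod hΩ.compl)
  have hTint : ∫⁻ w, ENNReal.ofReal (T w) ∂(volume ⊗ₘ κ) ≤
      ENNReal.ofReal (t ^ (-(p * sMax s)) * ε ^ (p - 1) * V) := by
    have e : ∀ w, ENNReal.ofReal (T w) = (R ×ˢ Ωᶜ).indicator
        (fun w => ENNReal.ofReal (max (-u w.2) 0 ^ (p - 1))) w := fun w => by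
      simp only [hT, Set.indicator]
      split_ifs <;> simp
    simp_rw [e]
    rw [lintegral_indicator (hRm.prod hΩ.compl), ENNReal.ofReal_mul (by positivity), ← hRV]
    refine hκ.setLIntegral_prod_le (by fun_prop) hRm hΩ.compl fun x hx => le_trans ?_ htail
    exact le_iSup₂ (f := fun x (_ : x ∈ A) =>
      ∫⁻ y in Ωᶜ, ENNReal.ofReal (max (-u y) 0 ^ (p - 1)) ∂(μ x)) x (hzA hx)
  have hτm := measurable_cutoff s ρ z
  have hτint := hκ.lintegral_cutoff_le hμ hp hΛ hs₀ hs hρ z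
  rw [← hRdef, hRV, ← ht, ← ENNReal.ofReal_mul (by positivity)] at hτint
  have key := lintegral_le_of_add_le
    (H := fun w => (rect s ρ z ×ˢ rect s ρ z).indicator (fun w =>
        c * |Real.log (max (u w.2) ε) - Real.log (max (u w.1) ε)| ^ p) w)
    (G := fun w => (C + 2 ^ (p - 1)) * |cutoff s ρ z w.2 - cutoff s ρ z w.1| ^ p +
      2 ^ (p - 1) * ε ^ (1 - p) * (T w + T w.swap))
    (a := (C₁ - 1) * (t ^ (-(p * sMax s)) * V)) hint (by fun_prop)
    (fun w => by
      have := hT0 w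
      have := hT0 w.swap
      positivity)
    (fun w => Set.indicator_nonneg (fun w _ => by positivity) w)
    (by
      have : 0 ≤ C₁ - 1 := by rw [hC₁, add_sub_cancel_right]; positivity
      positivity)
    (by
      calc _ = ∫⁻ w, (ENNReal.ofReal (C + 2 ^ (p - 1)) *
              ENNReal.ofReal (|cutoff s ρ z w.2 - cutoff s ρ z w.1| ^ p) +
            ENNReal.ofReal (2 ^ (p - 1) * ε ^ (1 - p)) *
              (ENNReal.ofReal (T w) + ENNReal.ofReal (T w.swap))) ∂(volume ⊗ₘ κ) := by
            congr 1
            ext w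
            have q1 := hT0 w
            have q2 := hT0 w.swap
            rw [ENNReal.ofReal_add (by positivity) (by positivity),
              ENNReal.ofReal_mul (by positivity),
              ENNReal.ofReal_mul (p := 2 ^ (p - 1) * ε ^ (1 - p)) (by positivity),
              ENNReal.ofReal_add q1 q2]
        _ = ENNReal.ofReal (C + 2 ^ (p - 1)) * ∫⁻ w,
              ENNReal.ofReal (|cutoff s ρ z w.2 - cutoff s ρ z w.1| ^ p) ∂(volume ⊗ₘ κ) +
            ENNReal.ofReal (2 ^ (p - 1) * ε ^ (1 - p)) *
              (∫⁻ w, ENNReal.ofReal (T w) ∂(volume ⊗ₘ κ) +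
               ∫⁻ w, ENNReal.ofReal (T w) ∂(volume ⊗ₘ κ)) := by
            rw [lintegral_add_left (by fun_prop), lintegral_const_mul _ (by fun_prop),
              lintegral_const_mul _ (by fun_prop), lintegral_add_left (by fun_prop),
              hκ.lintegral_swap (G := fun w => ENNReal.ofReal (T w)) (by fun_prop)]
        _ ≤ ENNReal.ofReal (C + 2 ^ (p - 1)) * ENNReal.ofReal
              (2 * ((n : ℝ) ^ p * (2 ^ (p + 1) * Λ * t ^ (-(p * sMax s)))) * V) +
            ENNReal.ofReal (2 ^ (p - 1) * ε ^ (1 - p)) *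
              (ENNReal.ofReal (t ^ (-(p * sMax s)) * ε ^ (p - 1) * V) +
               ENNReal.ofReal (t ^ (-(p * sMax s)) * ε ^ (p - 1) * V)) := by gcongr
        _ = _ := by
            rw [← ENNReal.ofReal_add (by positivity) (by positivity),
              ← ENNReal.ofReal_mul (by positivity), ← ENNReal.ofReal_mul (by positivity),
              ← ENNReal.ofReal_add (by positivity) (by positivity)]
            congr 1
            have e2 : ε ^ (1 - p) * ε ^ (p - 1) = 1 := by rw [← Real.rpow_add hε]; simp
            rw [hC₁]
            linear_combination (2 * 2 ^ (p - 1) * t ^ (-(p * sMax s)) * V) * e2)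
    hform (by
      filter_upwards [hκ.ae_mem_imp hΩ (measurableSet_le measurable_const hum) hae] with w hw
      exact log_energy_pointwise hp hc hC hcC hs₀ hs hρ hε hR u hw.1 hw.2)
  have hHe : ∫⁻ w, ENNReal.ofReal ((rect s ρ z ×ˢ rect s ρ z).indicator (fun w =>
        c * |Real.log (max (u w.2) ε) - Real.log (max (u w.1) ε)| ^ p) w) ∂(volume ⊗ₘ κ) =
      ENNReal.ofReal c *
        energy p μ (rect s ρ z) (rect s ρ z) (fun x => Real.log (max (u x) ε)) := by
    rw [hκ.energy_eq (by linarith) hMm hMm (by fun_prop), ← lintegral_const_mul _ (by fun_prop),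
      ← lintegral_indicator (hMm.prod hMm)]
    congr 1
    ext w
    simp only [Set.indicator]
    split_ifs
    · rw [ENNReal.ofReal_mul hc.le]
    · simp
  rw [hHe] at key
  -- Here `s_max ≤ 1` makes the constant independent of the orders.
  have h17 : t ^ (-(p * sMax s)) ≤ 17 ^ p * ρ ^ (-(p * sMax s)) := by
    rw [ht, Real.div_rpow hρ.le (by norm_num), Real.rpow_neg (by norm_num : (0 : ℝ) ≤ 17),
      div_inv_eq_mul, mul_comm]
    gcongr
    · norm_num
    · nlinarith
  have hcc : ENNReal.ofReal c⁻¹ * ENNReal.ofReal c = 1 := by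
    rw [← ENNReal.ofReal_mul (by positivity), inv_mul_cancel₀ hc.ne', ENNReal.ofReal_one]
  calc _ = ENNReal.ofReal c⁻¹ * (ENNReal.ofReal c *
        energy p μ (rect s ρ z) (rect s ρ z) (fun x => Real.log (max (u x) ε))) := by
        rw [← mul_assoc, hcc, one_mul]
    _ ≤ ENNReal.ofReal c⁻¹ * ENNReal.ofReal
          ((C₁ - 1) * (t ^ (-(p * sMax s)) * V) + t ^ (-(p * sMax s)) * V) := by gcongr
    _ ≤ _ := by
        rw [hRV, ← ENNReal.ofReal_mul (by positivity), ← ENNReal.ofReal_mul (by positivity)]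
        apply ENNReal.ofReal_le_ofReal
        calc _ = c⁻¹ * (C₁ * t ^ (-(p * sMax s))) * V := by ring
          _ ≤ c⁻¹ * (C₁ * (17 ^ p * ρ ^ (-(p * sMax s)))) * V := by gcongr
          _ = _ := by ring

end LogEnergy

/-! ### A robust fractional Poincaré inequality on an interval -/

section Interval

lemma lintegral_midpoint (F : ℝ → ℝ≥0∞) (hF : Measurable F) (x : ℝ) :
    ∫⁻ y, F ((x + y) / 2) = 2 * ∫⁻ m, F m := by
  have h1 : ∫⁻ y, F ((x + y) / 2) = ∫⁻ y, F (2⁻¹ * y) := by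
    rw [← lintegral_add_left_eq_self (fun y => F (2⁻¹ * y)) x]
    congr 1; ext y; congr 1; ring
  rw [h1, ← lintegral_map (f := F) hF (measurable_const_mul (2⁻¹ : ℝ)),
    Real.map_volume_mul_left (by norm_num), lintegral_smul_measure]
  simp

/-- The part of `J × J` at distance less than `h` from the diagonal. -/
def nearDiagSet (J : Set ℝ) (h : ℝ) : Set (ℝ × ℝ) :=
  {w : ℝ × ℝ | w.1 ∈ J ∧ w.2 ∈ J ∧ |w.1 - w.2| < h}

lemma mem_nearDiagSet {J : Set ℝ} {h x y : ℝ} :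
    (x, y) ∈ nearDiagSet J h ↔ x ∈ J ∧ y ∈ J ∧ |x - y| < h := Iff.rfl

/-- The part of `∬ g` over `J × J` at distance less than `h` from the diagonal. -/
def nearDiag (J : Set ℝ) (g : ℝ → ℝ → ℝ≥0∞) (h : ℝ) : ℝ≥0∞ :=
  ∫⁻ x, ∫⁻ y, (nearDiagSet J h).indicator
    (fun w => g w.1 w.2) (x, y)

variable {J : Set ℝ} {g : ℝ → ℝ → ℝ≥0∞}

lemma measurableSet_nearDiag (hJ : MeasurableSet J) (h : ℝ) :
    MeasurableSet (nearDiagSet J h) := by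
  refine (measurable_fst hJ).inter ((measurable_snd hJ).inter ?_)
  exact measurableSet_lt (measurable_fst.sub measurable_snd).abs measurable_const

lemma measurable_nearDiag (hJ : MeasurableSet J) (hg : Measurable (Function.uncurry g)) (h : ℝ) :
    Measurable ((nearDiagSet J h).indicator
      (fun w => g w.1 w.2)) :=
  Measurable.indicator hg (measurableSet_nearDiag hJ h)

/-- Halving the distance to the diagonal costs a factor `2 ^ (p + 1)`. -/
lemma nearDiag_le_half {p : ℝ} (hJ : MeasurableSet J) (hJc : J.OrdConnected)
    (hg : Measurable (Function.uncurry g))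
    (htri : ∀ x m y, g x y ≤ 2 ^ (p - 1) * (g x m + g m y)) (h : ℝ) :
    nearDiag J g h ≤ 2 ^ (p + 1) * nearDiag J g (h / 2) := by
  set I : ℝ → ℝ × ℝ → ℝ≥0∞ := fun h =>
    (nearDiagSet J h).indicator (fun w => g w.1 w.2) with hI
  have hIm : ∀ h, Measurable (I h) := fun h => measurable_nearDiag hJ hg h
  -- Inserting the midpoint, which stays in the interval `J`, replaces a pair at distance below `h`
  -- by two pairs at distance below `h / 2`. The triangle inequality costs `2 ^ (p-1)`, each
  -- substitution by the midpoint costs `2`, and there are two terms, which gives `2 ^ (p+1)`.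
  have hpt : ∀ x y, I h (x, y) ≤ 2 ^ (p - 1) *
      (I (h / 2) (x, (x + y) / 2) + I (h / 2) ((y + x) / 2, y)) := by
    intro x y
    by_cases hxy : (x, y) ∈ (nearDiagSet J h)
    · obtain ⟨hx, hy, hd⟩ := hxy
      have hm : (x + y) / 2 ∈ J := by
        rcases le_total x y with hle | hle
        · exact hJc.out hx hy ⟨by linarith, by linarith⟩
        · exact hJc.out hy hx ⟨by linarith, by linarith⟩
      simp only [hI]
      rw [abs_lt] at hd
      rw [Set.indicator_of_mem (mem_nearDiagSet.2 ⟨hx, hy, abs_lt.2 hd⟩), Set.indicator_of_mem, Set.indicator_of_mem]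
      · rw [add_comm y x]
        exact htri _ _ _
      · refine mem_nearDiagSet.2 ⟨by simpa [add_comm] using hm, hy, ?_⟩
        rw [abs_lt]; constructor <;> linarith [hd.1, hd.2]
      · refine mem_nearDiagSet.2 ⟨hx, hm, ?_⟩
        rw [abs_lt]; constructor <;> linarith [hd.1, hd.2]
    · simp only [hI]
      rw [Set.indicator_of_notMem hxy]
      exact zero_le
  have hIx : ∀ x, Measurable fun y => I (h / 2) (x, (x + y) / 2) := fun x =>
    (hIm _).comp (by fun_prop)
  have hA : Measurable fun x => ∫⁻ y, I (h / 2) (x, (x + y) / 2) :=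
    Measurable.lintegral_prod_right' (f := fun w : ℝ × ℝ => I (h / 2) (w.1, (w.1 + w.2) / 2))
      ((hIm _).comp (by fun_prop))
  calc nearDiag J g h = ∫⁻ x, ∫⁻ y, I h (x, y) := rfl
    _ ≤ ∫⁻ x, ∫⁻ y, 2 ^ (p - 1) * (I (h / 2) (x, (x + y) / 2) + I (h / 2) ((y + x) / 2, y)) :=
        lintegral_mono fun x => lintegral_mono fun y => hpt x y
    _ = 2 ^ (p - 1) * ((∫⁻ x, ∫⁻ y, I (h / 2) (x, (x + y) / 2)) +
          ∫⁻ y, ∫⁻ x, I (h / 2) ((y + x) / 2, y)) := by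
        have hc : (2 : ℝ≥0∞) ^ (p - 1) ≠ ∞ := by
          rw [show (2 : ℝ≥0∞) = ENNReal.ofReal 2 by simp,
            ENNReal.ofReal_rpow_of_pos (by norm_num)]
          exact ENNReal.ofReal_ne_top
        rw [lintegral_lintegral_swap (f := fun y x => I (h / 2) ((y + x) / 2, y))
          (Measurable.aemeasurable ((hIm _).comp (by fun_prop) :
            Measurable fun w : ℝ × ℝ => I (h / 2) ((w.1 + w.2) / 2, w.1))),
          ← lintegral_add_left hA, ← lintegral_const_mul' _ _ hc]
        congr 1; ext x
        rw [lintegral_const_mul' _ _ hc, lintegral_add_left (hIx x)]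
    _ = 2 ^ (p - 1) * ((∫⁻ x, 2 * ∫⁻ m, I (h / 2) (x, m)) +
          ∫⁻ y, 2 * ∫⁻ m, I (h / 2) (m, y)) := by
        congr 2
        · congr 1; ext x
          exact lintegral_midpoint (fun m => I (h / 2) (x, m)) ((hIm _).comp (by fun_prop)) x
        · congr 1; ext y
          exact lintegral_midpoint (fun m => I (h / 2) (m, y)) ((hIm _).comp (by fun_prop)) y
    _ = 2 ^ (p - 1) * (2 * nearDiag J g (h / 2) + 2 * nearDiag J g (h / 2)) := by
        rw [lintegral_const_mul' _ _ (by simp), lintegral_const_mul' _ _ (by simp),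
          lintegral_lintegral_swap (f := fun y m => I (h / 2) (m, y))
            (Measurable.aemeasurable ((hIm _).comp (by fun_prop) :
              Measurable fun w : ℝ × ℝ => I (h / 2) (w.2, w.1)))]
        rfl
    _ = _ := by
        rw [show p + 1 = (p - 1) + 1 + 1 by ring, ENNReal.rpow_add _ _ (by simp) (by simp),
          ENNReal.rpow_add _ _ (by simp) (by simp), ENNReal.rpow_one]
        ring

lemma nearDiag_le_pow {p : ℝ} (hJ : MeasurableSet J) (hJc : J.OrdConnected)
    (hg : Measurable (Function.uncurry g))
    (htri : ∀ x m y, g x y ≤ 2 ^ (p - 1) * (g x m + g m y)) (L : ℝ) (j : ℕ) :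
    nearDiag J g L ≤ (2 ^ (p + 1)) ^ j * nearDiag J g (L * (1 / 2) ^ j) := by
  induction j with
  | zero => simp
  | succ j ih =>
    refine ih.trans ?_
    rw [pow_succ, mul_assoc]
    gcongr
    refine (nearDiag_le_half hJ hJc hg htri _).trans_eq ?_
    congr 2
    ring

/-- A dyadic lower bound for the kernel `t ↦ t ^ (-α)`, `α ≥ 1`. -/
lemma sum_dyadic_le {α L t : ℝ} (hα : 1 ≤ α) (hL : 0 < L) (ht : 0 < t) (N : ℕ) :
    ∑ j ∈ Finset.range N, (if t < L * (1 / 2) ^ j then 1 / 2 * (L * (1 / 2 : ℝ) ^ j) ^ (-α) else 0)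
      ≤ t ^ (-α) ∧
    ∑ j ∈ Finset.range (N + 1),
      (if t < L * (1 / 2) ^ j then 1 / 2 * (L * (1 / 2 : ℝ) ^ j) ^ (-α) else 0)
      ≤ (L * (1 / 2 : ℝ) ^ N) ^ (-α) := by
  have hpos : ∀ j : ℕ, 0 < L * (1 / 2 : ℝ) ^ j := fun j => by positivity
  have hstep : ∀ j : ℕ, 2 * (L * (1 / 2 : ℝ) ^ j) ^ (-α) ≤ (L * (1 / 2 : ℝ) ^ (j + 1)) ^ (-α) := by
    intro j
    rw [pow_succ, ← mul_assoc, Real.mul_rpow (hpos j).le (by norm_num), mul_comm]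
    gcongr
    rw [one_div, Real.inv_rpow (by norm_num), Real.rpow_neg (by norm_num), inv_inv]
    calc (2 : ℝ) = 2 ^ (1 : ℝ) := by simp
      _ ≤ _ := Real.rpow_le_rpow_of_exponent_le (by norm_num) hα
  have hterm : ∀ j : ℕ, (if t < L * (1 / 2) ^ j then 1 / 2 * (L * (1 / 2 : ℝ) ^ j) ^ (-α) else 0)
      ≤ 1 / 2 * (L * (1 / 2 : ℝ) ^ j) ^ (-α) := fun j => by
    split_ifs
    · exact le_rfl
    · have := hpos j; positivity
  -- The second bound is the one that carries the induction: as `α ≥ 1`, each weight is at least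
  -- twice its predecessor, so the last one dominates the sum. The first bound follows by stopping
  -- at the last scale exceeding `t`.
  induction N with
  | zero =>
    refine ⟨by simp; positivity, ?_⟩
    rw [zero_add, Finset.sum_range_one]
    refine (hterm 0).trans ?_
    have : 0 < (L * (1 / 2 : ℝ) ^ 0) ^ (-α) := by have := hpos 0; positivity
    linarith
  | succ N ih =>
    constructor
    · by_cases h : t < L * (1 / 2) ^ N
      · exact ih.2.trans (Real.rpow_le_rpow_of_nonpos ht h.le (by linarith))
      · rw [Finset.sum_range_succ, if_neg h, add_zero]
        exact ih.1
    · rw [Finset.sum_range_succ]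
      linarith [ih.2, hterm (N + 1), hstep N]

/-- Fractional Poincaré inequality on an interval, robust as the order tends to one. -/
lemma fractional_poincare {p σ L : ℝ} (hp : 1 < p) (hσ : 0 < σ) (hσ1 : σ < 1) (hL : 0 < L)
    (hJ : MeasurableSet J) (hJc : J.OrdConnected) (hJL : ∀ x ∈ J, ∀ y ∈ J, |x - y| < L)
    {v : ℝ → ℝ} (hv : Measurable v) :
    ∫⁻ x in J, ∫⁻ y in J, ENNReal.ofReal (|v y - v x| ^ p) ≤
      ENNReal.ofReal (2 * p * (1 - σ) * L ^ (1 + σ * p)) *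
        ∫⁻ x in J, ∫⁻ y in J, ENNReal.ofReal (|x - y| ^ (-1 - σ * p)) *
          ENNReal.ofReal (|v y - v x| ^ p) := by
  set g : ℝ → ℝ → ℝ≥0∞ := fun x y => ENNReal.ofReal (|v y - v x| ^ p) with hg
  have hgm : Measurable (Function.uncurry g) := by
    change Measurable fun w : ℝ × ℝ => ENNReal.ofReal (|v w.2 - v w.1| ^ p)
    fun_prop
  have htri : ∀ x m y, g x y ≤ 2 ^ (p - 1) * (g x m + g m y) := by
    intro x m y
    have e : ∀ a : ℝ, ENNReal.ofReal (|a| ^ p) = ENNReal.ofReal |a| ^ p := fun a =>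
      (ENNReal.ofReal_rpow_of_nonneg (abs_nonneg a) (by linarith)).symm
    simp only [hg, e]
    refine le_trans ?_ (ENNReal.rpow_add_le_mul_rpow_add_rpow _ _ hp.le)
    gcongr
    rw [← ENNReal.ofReal_add (abs_nonneg _) (abs_nonneg _)]
    apply ENNReal.ofReal_le_ofReal
    have := abs_sub_le (v y) (v m) (v x)
    linarith
  have hS : ∫⁻ x in J, ∫⁻ y in J, g x y = nearDiag J g L := by
    rw [nearDiag, ← lintegral_indicator hJ]
    congr 1; ext x
    by_cases hx : x ∈ J
    · rw [Set.indicator_of_mem hx, ← lintegral_indicator hJ]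
      congr 1; ext y
      by_cases hy : y ∈ J
      · rw [Set.indicator_of_mem hy, Set.indicator_of_mem (mem_nearDiagSet.2 ⟨hx, hy, hJL x hx y hy⟩)]
      · rw [Set.indicator_of_notMem hy, Set.indicator_of_notMem fun h => hy h.2.1]
    · rw [Set.indicator_of_notMem hx]
      refine (lintegral_eq_zero_of_ae_eq_zero (Filter.Eventually.of_forall fun y => ?_)).symm
      exact Set.indicator_of_notMem (fun h => hx h.1) _
  set α := 1 + σ * p with hα
  have hα1 : 1 ≤ α := by have : 0 < σ * p := by positivity
                         linarith
  set W := ∫⁻ x in J, ∫⁻ y in J, ENNReal.ofReal (|x - y| ^ (-1 - σ * p)) * g x y with hW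
  set c : ℕ → ℝ := fun j => 1 / 2 * (L * (1 / 2 : ℝ) ^ j) ^ (-α) with hc
  have hc0 : ∀ j, 0 ≤ c j := fun j => by positivity
  -- the dyadic decomposition of the singular kernel
  have hlower : ∑' j : ℕ, ENNReal.ofReal (c j) * nearDiag J g (L * (1 / 2) ^ j) ≤ W := by
    have hm : ∀ h, Measurable ((nearDiagSet J h).indicator
      (fun w => g w.1 w.2)) := fun h => measurable_nearDiag hJ hgm h
    calc _ = ∫⁻ x, ∫⁻ y, ∑' j : ℕ, ENNReal.ofReal (c j) *
          (nearDiagSet J (L * (1 / 2) ^ j)).indicator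
            (fun w => g w.1 w.2) (x, y) := by
          have h1 : ∀ x, ∫⁻ y, ∑' j : ℕ, ENNReal.ofReal (c j) *
              (nearDiagSet J (L * (1 / 2) ^ j)).indicator
                (fun w => g w.1 w.2) (x, y) = ∑' j : ℕ, ENNReal.ofReal (c j) *
              ∫⁻ y, (nearDiagSet J (L * (1 / 2) ^ j)).indicator
                (fun w => g w.1 w.2) (x, y) := fun x => by
            rw [lintegral_tsum fun j => Measurable.aemeasurable
              (Measurable.const_mul (f := fun y => (nearDiagSet J (L * (1 / 2) ^ j)).indicator
                (fun w => g w.1 w.2) (x, y)) ((hm _).comp measurable_prodMk_left) _)]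
            congr 1; ext j
            exact lintegral_const_mul' _ _ ENNReal.ofReal_ne_top
          simp_rw [h1]
          rw [lintegral_tsum fun j => ((hm _).lintegral_prod_right'.const_mul _).aemeasurable]
          congr 1; ext j
          rw [lintegral_const_mul' _ _ ENNReal.ofReal_ne_top, nearDiag]
      _ ≤ ∫⁻ x, J.indicator (fun x => ∫⁻ y, J.indicator
            (fun y => ENNReal.ofReal (|x - y| ^ (-1 - σ * p)) * g x y) y) x := by
          refine lintegral_mono fun x => ?_
          by_cases hx : x ∈ J
          · rw [Set.indicator_of_mem hx]
            refine lintegral_mono fun y => ?_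
            by_cases hy : y ∈ J
            · rw [Set.indicator_of_mem hy]
              rcases eq_or_ne x y with rfl | hxy
              · have : g x x = 0 := by simp [hg, Real.zero_rpow (by linarith : p ≠ 0)]
                simp [Set.indicator, this]
              have ht : 0 < |x - y| := abs_pos.2 (sub_ne_zero.2 hxy)
              refine ENNReal.tsum_le_of_sum_range_le fun N => ?_
              have e : ∀ j, ENNReal.ofReal (c j) *
                  (nearDiagSet J (L * (1 / 2) ^ j)).indicator
                  (fun w => g w.1 w.2) (x, y) =
                  ENNReal.ofReal (if |x - y| < L * (1 / 2) ^ j then c j else 0) * g x y := by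
                intro j
                by_cases h : |x - y| < L * (1 / 2) ^ j
                · rw [Set.indicator_of_mem (mem_nearDiagSet.2 ⟨hx, hy, h⟩), if_pos h]
                · rw [Set.indicator_of_notMem fun hh => h hh.2.2, if_neg h]
                  simp
              simp_rw [e]
              rw [← Finset.sum_mul, ← ENNReal.ofReal_sum_of_nonneg fun j _ => by
                split_ifs
                · exact hc0 j
                · exact le_rfl]
              gcongr
              rw [show -1 - σ * p = -α by rw [hα]; ring]
              exact (sum_dyadic_le hα1 hL ht N).1
            · rw [Set.indicator_of_notMem hy]
              simp [Set.indicator, mem_nearDiagSet, hy]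
          · simp [Set.indicator, mem_nearDiagSet, hx]
      _ = W := by
          rw [hW, lintegral_indicator hJ]
          congr 1; ext x
          rw [lintegral_indicator hJ]
  -- Each halving loses `2 ^ (p+1)` while the kernel gains `2 ^ (1 + σ p)`; the net ratio is `r`.
  -- All scales contribute, and the sum `1 / (1 - r) ≥ 1 / (p (1 - σ))` produces the factor `1 - σ`
  -- in the constant.
  set r : ℝ := (1 / 2) ^ (p * (1 - σ)) with hr
  have hr0 : 0 ≤ r := by positivity
  have hpσ : 0 < p * (1 - σ) := mul_pos (by linarith) (by linarith)
  have hr1 : r < 1 := Real.rpow_lt_one (by norm_num) (by norm_num) hpσ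
  have hr2 : 1 - r ≤ p * (1 - σ) := by
    have h1 : r = Real.exp (Real.log (1 / 2) * (p * (1 - σ))) :=
      Real.rpow_def_of_pos (by norm_num) _
    have h2 := Real.add_one_le_exp (Real.log (1 / 2) * (p * (1 - σ)))
    have h3 : -1 ≤ Real.log (1 / 2) := by
      rw [one_div, Real.log_inv]; linarith [Real.log_two_lt_d9]
    rw [← h1] at h2
    nlinarith
  have hterm : ∀ j : ℕ, ENNReal.ofReal (1 / 2 * L ^ (-α) * r ^ j) * nearDiag J g L ≤
      ENNReal.ofReal (c j) * nearDiag J g (L * (1 / 2) ^ j) := by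
    intro j
    have h1 := nearDiag_le_pow hJ hJc hgm htri L j
    have h2 : (2 : ℝ≥0∞) ^ (p + 1) = ENNReal.ofReal (2 ^ (p + 1)) := by
      rw [← ENNReal.ofReal_rpow_of_pos (by norm_num)]; simp
    rw [h2, ← ENNReal.ofReal_pow (by positivity)] at h1
    calc _ ≤ ENNReal.ofReal (1 / 2 * L ^ (-α) * r ^ j) *
          (ENNReal.ofReal ((2 ^ (p + 1)) ^ j) * nearDiag J g (L * (1 / 2) ^ j)) := by gcongr
      _ = _ := by
          rw [← mul_assoc, ← ENNReal.ofReal_mul (by positivity)]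
          congr 2
          have e1 : (L * (1 / 2 : ℝ) ^ j) ^ (-α) = L ^ (-α) * ((1 / 2 : ℝ) ^ (-α)) ^ j := by
            rw [Real.mul_rpow hL.le (by positivity), ← Real.rpow_natCast, ← Real.rpow_natCast,
              ← Real.rpow_mul (by norm_num), ← Real.rpow_mul (by norm_num), mul_comm (j : ℝ)]
          have e2 : r * 2 ^ (p + 1) = (1 / 2 : ℝ) ^ (-α) := by
            rw [hr, one_div, Real.inv_rpow (by norm_num), Real.inv_rpow (by norm_num),
              ← Real.rpow_neg (by norm_num), ← Real.rpow_neg (by norm_num),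
              ← Real.rpow_add (by norm_num)]
            congr 1
            rw [hα]; ring
          simp only [hc]
          rw [e1, ← e2, mul_pow]
          ring
  have hsum : ENNReal.ofReal (1 / 2 * L ^ (-α) * (1 - r)⁻¹) * nearDiag J g L ≤ W := by
    refine le_trans (le_of_eq ?_) ((ENNReal.tsum_le_tsum hterm).trans hlower)
    rw [ENNReal.tsum_mul_right, ← ENNReal.ofReal_tsum_of_nonneg (fun j => by positivity)
      ((summable_geometric_of_lt_one hr0 hr1).mul_left _), tsum_mul_left,
      tsum_geometric_of_lt_one hr0 hr1]
  rw [hS]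
  have h1r : 0 < 1 - r := by linarith
  have hone : 1 ≤ 2 * p * (1 - σ) * L ^ α * (1 / 2 * L ^ (-α) * (1 - r)⁻¹) := by
    have e : L ^ α * L ^ (-α) = 1 := by rw [← Real.rpow_add hL]; simp
    calc (1 : ℝ) = (1 - r) * (1 - r)⁻¹ := (mul_inv_cancel₀ h1r.ne').symm
      _ ≤ p * (1 - σ) * (1 - r)⁻¹ := by gcongr
      _ = (L ^ α * L ^ (-α)) * (p * (1 - σ) * (1 - r)⁻¹) := by rw [e, one_mul]
      _ = _ := by ring
  calc nearDiag J g L = ENNReal.ofReal 1 * nearDiag J g L := by simp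
    _ ≤ ENNReal.ofReal (2 * p * (1 - σ) * L ^ α * (1 / 2 * L ^ (-α) * (1 - r)⁻¹)) *
          nearDiag J g L := by gcongr
    _ = ENNReal.ofReal (2 * p * (1 - σ) * L ^ α) *
          (ENNReal.ofReal (1 / 2 * L ^ (-α) * (1 - r)⁻¹) * nearDiag J g L) := by
        rw [← mul_assoc (ENNReal.ofReal _), ← ENNReal.ofReal_mul (by positivity)]
    _ ≤ _ := by gcongr

end Interval

/-! ### From one coordinate to boxes: tensorization -/

section Measurability

variable {ι : Type*} [DecidableEq ι]

lemma measurable_update_pair (k : ι) :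
    Measurable fun w : (ι → ℝ) × ℝ => Function.update w.1 k w.2 := by
  refine measurable_pi_iff.2 fun i => ?_
  by_cases hi : i = k
  · subst hi; simp only [Function.update_self]; fun_prop
  · simp only [Function.update_of_ne hi]; fun_prop

lemma measurable_update_eval (k : ι) :
    Measurable fun w : (ι → ℝ) × (ι → ℝ) => Function.update w.1 k (w.2 k) :=
  (measurable_update_pair k).comp
    (by fun_prop : Measurable fun w : (ι → ℝ) × (ι → ℝ) => (w.1, w.2 k))

lemma measurable_piecewise_pair (S : Finset ι) :
    Measurable fun w : (ι → ℝ) × (ι → ℝ) => S.piecewise w.2 w.1 := by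
  refine measurable_pi_iff.2 fun i => ?_
  by_cases hi : i ∈ S
  · simp only [Finset.piecewise_eq_of_mem _ _ _ hi]; fun_prop
  · simp only [Finset.piecewise_eq_of_notMem _ _ _ hi]; fun_prop

end Measurability

section Product

variable {ι : Type*} [Fintype ι] [DecidableEq ι] (P : ι → Measure ℝ)
  [∀ i, IsProbabilityMeasure (P i)]

/-- Exchanging some of the coordinates of two independent points preserves their joint law. -/
lemma measurePreserving_exchange (S : Finset ι) :
    MeasurePreserving (fun w : (ι → ℝ) × (ι → ℝ) => (S.piecewise w.2 w.1, S.piecewise w.1 w.2))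
      ((Measure.pi P).prod (Measure.pi P)) ((Measure.pi P).prod (Measure.pi P)) := by
  have he := measurePreserving_arrowProdEquivProdArrow ℝ ℝ ι P P
  -- In the coordinates `ι → ℝ × ℝ` the exchange acts factor by factor, as the swap on `P i × P i`
  -- for `i ∈ S`.
  have hf : MeasurePreserving (fun (a : ι → ℝ × ℝ) i => (if i ∈ S then Prod.swap else id) (a i))
      (Measure.pi fun i => (P i).prod (P i)) (Measure.pi fun i => (P i).prod (P i)) := by
    refine measurePreserving_pi _ _ (f := fun i => if i ∈ S then Prod.swap else id) fun i => ?_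
    split_ifs
    · exact Measure.measurePreserving_swap
    · exact MeasurePreserving.id _
  have h := (he.comp hf).comp he.symm
  convert h using 1
  ext w i
  · by_cases hi : i ∈ S <;>
      simp [hi, MeasurableEquiv.arrowProdEquivProdArrow, Equiv.arrowProdEquivProdArrow]
  · by_cases hi : i ∈ S <;>
      simp [hi, MeasurableEquiv.arrowProdEquivProdArrow, Equiv.arrowProdEquivProdArrow]

/-- Resampling one coordinate preserves the law. -/
lemma lintegral_update (k : ι) {F : (ι → ℝ) → ℝ≥0∞} (hF : Measurable F) :
    ∫⁻ x, ∫⁻ t, F (Function.update x k t) ∂(P k) ∂(Measure.pi P) = ∫⁻ x, F x ∂(Measure.pi P) := by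
  have h1 : ∀ x : ι → ℝ, ∫⁻ t, F (Function.update x k t) ∂(P k) =
      ∫⁻ y, F (Function.update x k (y k)) ∂(Measure.pi P) := fun x => by
    exact ((measurePreserving_eval P k).lintegral_comp
      (f := fun t => F (Function.update x k t)) (hF.comp (measurable_update x))).symm
  have h2 := (measurePreserving_exchange P {k}).lintegral_comp (f := fun w => F w.1)
    (hF.comp measurable_fst)
  have hm : Measurable fun w : (ι → ℝ) × (ι → ℝ) => F (Function.update w.1 k (w.2 k)) :=
    hF.comp (measurable_update_eval k)
  simp_rw [h1]
  rw [← lintegral_prod (f := fun w : (ι → ℝ) × (ι → ℝ) => F (Function.update w.1 k (w.2 k)))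
    hm.aemeasurable]
  simp only [Finset.piecewise_singleton] at h2
  rw [h2, lintegral_prod (fun w => F w.1) (hF.comp measurable_fst).aemeasurable]
  simp

/-- The mean oscillation of the `k`-th coordinate. -/
def coordOsc (p : ℝ) (v : (ι → ℝ) → ℝ) (k : ι) : ℝ≥0∞ :=
  ∫⁻ x, ∫⁻ t, ENNReal.ofReal (|v (Function.update x k t) - v x| ^ p) ∂(P k) ∂(Measure.pi P)

lemma coordOsc_eq {p : ℝ} {v : (ι → ℝ) → ℝ} (hv : Measurable v) (k : ι) :
    coordOsc P p v k = ∫⁻ w, ENNReal.ofReal (|v (Function.update w.1 k (w.2 k)) - v w.1| ^ p)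
      ∂((Measure.pi P).prod (Measure.pi P)) := by
  have hm : Measurable fun w : (ι → ℝ) × ℝ => v (Function.update w.1 k w.2) :=
    hv.comp (measurable_update_pair k)
  rw [lintegral_prod _ (by fun_prop), coordOsc]
  congr 1; ext x
  have : Measurable fun t => v (Function.update x k t) := hm.comp measurable_prodMk_left
  exact ((measurePreserving_eval P k).lintegral_comp
    (f := fun t => ENNReal.ofReal (|v (Function.update x k t) - v x| ^ p)) (by fun_prop)).symm

/-- Changing the coordinates one after the other. -/
lemma lintegral_piecewise_le {p : ℝ} (hp : 1 < p) {v : (ι → ℝ) → ℝ} (hv : Measurable v)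
    (S : Finset ι) :
    ∫⁻ w, ENNReal.ofReal (|v (S.piecewise w.2 w.1) - v w.1| ^ p)
      ∂((Measure.pi P).prod (Measure.pi P)) ≤
      ENNReal.ofReal ((2 ^ p) ^ S.card) * ∑ k ∈ S, coordOsc P p v k := by
  have hp0 : p ≠ 0 := by linarith
  induction S using Finset.induction_on with
  | empty => simp [Real.zero_rpow hp0]
  | insert k S hk ih =>
    have hmS := hv.comp (measurable_piecewise_pair S)
    simp only [Function.comp_def] at hmS
    -- Exchanging the coordinates in `S` between the two independent points turns this intermediate
    -- increment into a pure change of coordinate `k`, with the same law.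
    have hstep : ∫⁻ w, ENNReal.ofReal (|v ((insert k S).piecewise w.2 w.1) -
        v (S.piecewise w.2 w.1)| ^ p) ∂((Measure.pi P).prod (Measure.pi P)) =
        coordOsc P p v k := by
      have hex := (measurePreserving_exchange P S).lintegral_comp
        (f := fun w => ENNReal.ofReal (|v (Function.update w.1 k (w.2 k)) - v w.1| ^ p))
        (by fun_prop)
      rw [coordOsc_eq P hv k, ← hex]
      congr 1; ext w
      rw [Finset.piecewise_insert]
      simp [hk]
    have hT : Measurable fun w : (ι → ℝ) × (ι → ℝ) =>
        ENNReal.ofReal (|v (S.piecewise w.2 w.1) - v w.1| ^ p) :=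
      ((hmS.sub (hv.comp measurable_fst)).abs.pow_const p).ennreal_ofReal
    calc _ ≤ ∫⁻ w, ENNReal.ofReal (2 ^ p) *
          (ENNReal.ofReal (|v (S.piecewise w.2 w.1) - v w.1| ^ p) +
            ENNReal.ofReal (|v ((insert k S).piecewise w.2 w.1) -
              v (S.piecewise w.2 w.1)| ^ p)) ∂((Measure.pi P).prod (Measure.pi P)) := by
          refine lintegral_mono fun w => ?_
          rw [← ENNReal.ofReal_add (by positivity) (by positivity),
            ← ENNReal.ofReal_mul (by positivity)]
          apply ENNReal.ofReal_le_ofReal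
          refine le_trans ?_ (add_rpow_le_two_rpow_mul (by linarith) (abs_nonneg _) (abs_nonneg _))
          apply Real.rpow_le_rpow (abs_nonneg _) _ (by linarith)
          rw [add_comm]
          exact abs_sub_le _ _ _
      _ ≤ ENNReal.ofReal (2 ^ p) * (ENNReal.ofReal ((2 ^ p) ^ S.card) * ∑ k ∈ S, coordOsc P p v k
            + coordOsc P p v k) := by
          rw [lintegral_const_mul' _ _ ENNReal.ofReal_ne_top, lintegral_add_left hT, hstep]
          gcongr
      _ ≤ ENNReal.ofReal (2 ^ p) * (ENNReal.ofReal ((2 ^ p) ^ S.card) * ∑ k ∈ S, coordOsc P p v k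
            + ENNReal.ofReal ((2 ^ p) ^ S.card) * coordOsc P p v k) := by
          gcongr
          conv_lhs => rw [← one_mul (coordOsc P p v k)]
          gcongr
          rw [ENNReal.one_le_ofReal]
          exact one_le_pow₀ (Real.one_le_rpow (by norm_num) (by linarith))
      _ = _ := by
          rw [Finset.card_insert_of_notMem hk, Finset.sum_insert hk, pow_succ,
            mul_comm ((2 ^ p : ℝ) ^ S.card), ENNReal.ofReal_mul (by positivity)]
          ring

/-- A one-dimensional inequality on the `k`-th factor gives a bound on `coordOsc`. -/
lemma coordOsc_le {p : ℝ} {v : (ι → ℝ) → ℝ} (hv : Measurable v) (k : ι) {K : ℝ → ℝ → ℝ≥0∞}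
    (hK : Measurable (Function.uncurry K)) {c : ℝ≥0∞} (hc : c ≠ ∞)
    (h : ∀ w : ℝ → ℝ, Measurable w →
      ∫⁻ x, ∫⁻ y, ENNReal.ofReal (|w y - w x| ^ p) ∂(P k) ∂(P k) ≤
        c * ∫⁻ x, ∫⁻ y, K x y * ENNReal.ofReal (|w y - w x| ^ p) ∂(P k) ∂(P k)) :
    coordOsc P p v k ≤ c * ∫⁻ x, ∫⁻ t, K (x k) t *
      ENNReal.ofReal (|v (Function.update x k t) - v x| ^ p) ∂(P k) ∂(Measure.pi P) := by
  have hm : Measurable fun w : (ι → ℝ) × ℝ => v (Function.update w.1 k w.2) :=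
    hv.comp (measurable_update_pair k)
  have hF1 : Measurable fun x : ι → ℝ =>
      ∫⁻ t, ENNReal.ofReal (|v (Function.update x k t) - v x| ^ p) ∂(P k) :=
    Measurable.lintegral_prod_right' (f := fun w : (ι → ℝ) × ℝ =>
      ENNReal.ofReal (|v (Function.update w.1 k w.2) - v w.1| ^ p)) (by fun_prop)
  have hF2 : Measurable fun x : ι → ℝ => ∫⁻ t, K (x k) t *
      ENNReal.ofReal (|v (Function.update x k t) - v x| ^ p) ∂(P k) :=
    Measurable.lintegral_prod_right' (f := fun w : (ι → ℝ) × ℝ => K (w.1 k) w.2 *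
      ENNReal.ofReal (|v (Function.update w.1 k w.2) - v w.1| ^ p)) (by fun_prop)
  -- Resampling `x k` first makes both sides average, over the other coordinates, the double
  -- integral along a line in direction `k`, where the one-dimensional hypothesis applies.
  rw [coordOsc, ← lintegral_update P k hF1, ← lintegral_update P k hF2,
    ← lintegral_const_mul' _ _ hc]
  refine lintegral_mono fun x => ?_
  have := h (fun t => v (Function.update x k t)) (hm.comp measurable_prodMk_left)
  simpa only [Function.update_idem, Function.update_self] using this

end Product

lemma pi_smul_measure {ι : Type*} [Fintype ι] (ν : ι → Measure ℝ) [∀ i, IsFiniteMeasure (ν i)]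
    {c : ι → ℝ≥0∞} (hc : ∀ i, c i ≠ ∞) :
    Measure.pi (fun i => c i • ν i) = (∏ i, c i) • Measure.pi ν := by
  have : ∀ i, IsFiniteMeasure (c i • ν i) := fun i => Measure.smul_finite _ (hc i)
  refine Measure.pi_eq fun t _ => ?_
  rw [Measure.smul_apply, Measure.pi_pi, smul_eq_mul, ← Finset.prod_mul_distrib]
  rfl

/-- Half-open boxes. -/
def box (a b : Fin n → ℝ) : Set (Fin n → ℝ) := Set.univ.pi fun k => Set.Ico (a k) (b k)

lemma mem_box {a b x : Fin n → ℝ} : x ∈ box a b ↔ ∀ k, a k ≤ x k ∧ x k < b k := by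
  simp [box, Set.mem_pi]

lemma measurableSet_box (a b : Fin n → ℝ) : MeasurableSet (box a b) :=
  MeasurableSet.univ_pi fun _ => measurableSet_Ico

lemma volume_box {a b : Fin n → ℝ} (hab : ∀ k, a k < b k) :
    volume (box a b) = ENNReal.ofReal (∏ k, (b k - a k)) := by
  rw [box, volume_pi_pi, ENNReal.ofReal_prod_of_nonneg fun k _ => (sub_pos.2 (hab k)).le]
  simp

/-- One coordinate direction of the axes energy on a box. -/
lemma lintegral_coord_le_energy {p : ℝ} {s a b : Fin n → ℝ} {v : (Fin n → ℝ) → ℝ}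
    (hv : Measurable v) (k : Fin n) :
    ENNReal.ofReal (s k * (1 - s k)) * ∫⁻ x in box a b, ∫⁻ t in Set.Ico (a k) (b k),
      ENNReal.ofReal (|x k - t| ^ (-1 - s k * p)) *
        ENNReal.ofReal (|v (Function.update x k t) - v x| ^ p) ≤
      energy p (muAxes p s) (box a b) (box a b) v := by
  rw [← lintegral_const_mul' _ _ ENNReal.ofReal_ne_top, energy]
  refine setLIntegral_mono' (measurableSet_box a b) fun x hx => ?_
  set ν : Measure ℝ := (volume : Measure ℝ).withDensity
    (fun t => ENNReal.ofReal (|x k - t| ^ (-1 - s k * p))) with hν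
  have hupd : Measurable fun t => Function.update x k t := measurable_update x
  have hle : ENNReal.ofReal (s k * (1 - s k)) • ν.map (fun t => Function.update x k t) ≤
      muAxes p s x := by
    unfold muAxes
    intro B
    rw [Measure.finsetSum_apply]
    exact Finset.single_le_sum (f := fun k => (ENNReal.ofReal (s k * (1 - s k)) •
      ((volume : Measure ℝ).withDensity
        (fun t => ENNReal.ofReal (|x k - t| ^ (-1 - s k * p)))).map
          (fun t => Function.update x k t)) B) (fun _ _ => zero_le) (Finset.mem_univ k)
  refine le_trans ?_ (lintegral_mono' (Measure.restrict_mono le_rfl hle) le_rfl)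
  rw [Measure.restrict_smul, lintegral_smul_measure, smul_eq_mul]
  gcongr
  rw [setLIntegral_map (measurableSet_box a b) (by fun_prop) hupd, hν]
  have hpre : (fun t => Function.update x k t) ⁻¹' box a b = Set.Ico (a k) (b k) := by
    ext t
    rw [Set.mem_preimage, mem_box, Set.mem_Ico]
    constructor
    · intro h
      simpa using h k
    · intro h i
      by_cases hi : i = k
      · subst hi; simpa using h
      · simpa [hi] using mem_box.1 hx i
  rw [hpre, setLIntegral_withDensity_eq_setLIntegral_mul _ (by fun_prop) (by
    have := hv.comp hupd
    simp only [Function.comp_def] at this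
    fun_prop) measurableSet_Ico]
  exact le_rfl

/-- Poincaré inequality for the axes energy on boxes. -/
lemma poincare_box {p s₀ D : ℝ} {s a b : Fin n → ℝ} (hp : 1 < p) (hs₀ : 0 < s₀)
    (hs : ∀ k, s₀ ≤ s k ∧ s k < 1) (hab : ∀ k, a k < b k)
    (hD : ∀ k, (b k - a k) ^ (s k * p) ≤ D) {v : (Fin n → ℝ) → ℝ} (hv : Measurable v) :
    ∫⁻ x in box a b, ∫⁻ y in box a b, ENNReal.ofReal (|v y - v x| ^ p) ≤
      ENNReal.ofReal ((2 ^ p) ^ n * (n * (2 * p / s₀)) * D) * volume (box a b) *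
        energy p (muAxes p s) (box a b) (box a b) v := by
  set L : Fin n → ℝ := fun k => b k - a k with hL
  have hL0 : ∀ k, 0 < L k := fun k => sub_pos.2 (hab k)
  set c : Fin n → ℝ≥0∞ := fun k => ENNReal.ofReal (L k)⁻¹ with hc
  -- Lebesgue measure on each side is normalized so that coordinates can be resampled independently;
  -- the product is normalized Lebesgue measure on the box.
  set P : Fin n → Measure ℝ := fun k => c k • (volume.restrict (Set.Ico (a k) (b k))) with hP
  have hcL : ∀ k, c k * ENNReal.ofReal (L k) = 1 := fun k => by
    rw [hc, ← ENNReal.ofReal_mul (inv_nonneg.2 (hL0 k).le), inv_mul_cancel₀ (hL0 k).ne',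
      ENNReal.ofReal_one]
  have hPp : ∀ k, IsProbabilityMeasure (P k) := fun k => ⟨by
    rw [hP, Measure.smul_apply, Measure.restrict_apply_univ, Real.volume_Ico, smul_eq_mul]
    exact hcL k⟩
  set Vr : ℝ := ∏ k, L k with hVr
  have hVr0 : 0 < Vr := Finset.prod_pos fun k _ => hL0 k
  have hV : volume (box a b) = ENNReal.ofReal Vr := volume_box hab
  set C : ℝ≥0∞ := ENNReal.ofReal Vr⁻¹ with hC
  have hpi : Measure.pi P = C • volume.restrict (box a b) := by
    rw [hP, pi_smul_measure _ fun k => ENNReal.ofReal_ne_top, box, volume_pi,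
      Measure.restrict_pi_pi,
      ← ENNReal.ofReal_prod_of_nonneg fun k _ => inv_nonneg.2 (hL0 k).le, Finset.prod_inv_distrib]
  set E := energy p (muAxes p s) (box a b) (box a b) v with hE
  have hcoord : ∀ k, coordOsc P p v k ≤ ENNReal.ofReal (2 * p / s₀ * D) * (C * E) := by
    intro k
    have hsk := s_pos hs₀ hs k
    have hsk1 := (hs k).2
    have h1 := coordOsc_le P (p := p) hv k
      (K := fun x y => ENNReal.ofReal (|x - y| ^ (-1 - s k * p)))
      (by
        change Measurable fun w : ℝ × ℝ => ENNReal.ofReal (|w.1 - w.2| ^ (-1 - s k * p))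
        have : Measurable fun w : ℝ × ℝ => |w.1 - w.2| := (measurable_fst.sub measurable_snd).abs
        exact (this.pow_const _).ennreal_ofReal)
      (c := ENNReal.ofReal (2 * p * (1 - s k) * L k ^ (1 + s k * p))) ENNReal.ofReal_ne_top
      (fun w hw => by
        have := fractional_poincare hp hsk hsk1 (hL0 k) measurableSet_Ico Set.ordConnected_Ico
          (J := Set.Ico (a k) (b k)) (fun x hx y hy => by
            rw [abs_lt]; constructor <;> simp only [hL] <;> linarith [hx.1, hx.2, hy.1, hy.2]) hw
        simp only [hP, lintegral_smul_measure, smul_eq_mul]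
        rw [lintegral_const_mul' _ _ ENNReal.ofReal_ne_top,
          lintegral_const_mul' _ _ ENNReal.ofReal_ne_top]
        calc _ = c k * c k * ∫⁻ x in Set.Ico (a k) (b k), ∫⁻ y in Set.Ico (a k) (b k),
              ENNReal.ofReal (|w y - w x| ^ p) := by ring
          _ ≤ c k * c k * (ENNReal.ofReal (2 * p * (1 - s k) * L k ^ (1 + s k * p)) * _) :=
              mul_le_mul_right this _
          _ = _ := by ring)
    refine h1.trans ?_
    have h2 := lintegral_coord_le_energy (p := p) (s := s) (a := a) (b := b) hv k
    rw [hpi, lintegral_smul_measure, smul_eq_mul]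
    simp only [hP, lintegral_smul_measure, smul_eq_mul]
    rw [lintegral_const_mul' _ _ ENNReal.ofReal_ne_top]
    set W := ∫⁻ x in box a b, ∫⁻ t in Set.Ico (a k) (b k),
      ENNReal.ofReal (|x k - t| ^ (-1 - s k * p)) *
        ENNReal.ofReal (|v (Function.update x k t) - v x| ^ p) with hW
    have hLs : L k ^ (1 + s k * p) = L k * L k ^ (s k * p) := by
      rw [Real.rpow_add (hL0 k), Real.rpow_one]
    have hLk := hL0 k
    calc _ = ENNReal.ofReal (2 * p * (1 - s k) * L k ^ (1 + s k * p)) * c k * (C * W) := by ring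
      _ = ENNReal.ofReal (2 * p / s k * L k ^ (s k * p)) *
            (C * (ENNReal.ofReal (s k * (1 - s k)) * W)) := by
          -- The factor `1 - s_k` of the Poincaré constant is spent on the weight `s_k (1 - s_k)` of
          -- `μ_axes`, leaving only `1 / s_k ≤ 1 / s₀`.
          have e : ENNReal.ofReal (2 * p * (1 - s k) * L k ^ (1 + s k * p)) * c k =
              ENNReal.ofReal (2 * p / s k * L k ^ (s k * p)) *
                ENNReal.ofReal (s k * (1 - s k)) := by
            rw [hc, ← ENNReal.ofReal_mul (by positivity), ← ENNReal.ofReal_mul (by positivity), hLs]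
            congr 1
            field_simp
          rw [e]; ring
      _ ≤ ENNReal.ofReal (2 * p / s₀ * D) * (C * E) := by
          gcongr
          · exact (hs k).1
          · exact hD k
  have hosc := lintegral_piecewise_le P hp hv Finset.univ
  simp only [Finset.piecewise_univ, Finset.card_univ, Fintype.card_fin] at hosc
  rw [lintegral_prod _ (by fun_prop), hpi] at hosc
  simp only [lintegral_smul_measure, smul_eq_mul] at hosc
  rw [lintegral_const_mul' _ _ ENNReal.ofReal_ne_top] at hosc
  have hVC : volume (box a b) * C = 1 := by
    rw [hV, ← ENNReal.ofReal_mul hVr0.le, mul_inv_cancel₀ hVr0.ne', ENNReal.ofReal_one]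
  set I := ∫⁻ x in box a b, ∫⁻ y in box a b, ENNReal.ofReal (|v y - v x| ^ p) with hI
  -- For `n = 0` the bound on `D` is vacuous and `D` may be negative.
  have hD0 : 0 ≤ D ∨ n = 0 := by
    rcases Nat.eq_zero_or_pos n with h | h
    · exact Or.inr h
    · exact Or.inl ((Real.rpow_nonneg (hL0 ⟨0, h⟩).le _).trans (hD ⟨0, h⟩))
  calc I = (volume (box a b) * C) * ((volume (box a b) * C) * I) := by rw [hVC]; ring
    _ = volume (box a b) * volume (box a b) * (C * (C * I)) := by ring
    _ ≤ volume (box a b) * volume (box a b) * (ENNReal.ofReal ((2 ^ p) ^ n) *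
          ∑ k, coordOsc P p v k) := mul_le_mul_right hosc _
    _ ≤ volume (box a b) * volume (box a b) * (ENNReal.ofReal ((2 ^ p) ^ n) *
          ∑ k : Fin n, ENNReal.ofReal (2 * p / s₀ * D) * (C * E)) := by
        gcongr with k
        exact hcoord k
    _ = (volume (box a b) * C) * (ENNReal.ofReal ((2 ^ p) ^ n) * (n *
          ENNReal.ofReal (2 * p / s₀ * D)) * volume (box a b) * E) := by
        rw [Finset.sum_const, Finset.card_univ, Fintype.card_fin, nsmul_eq_mul]; ring
    _ = _ := by
        rw [hVC, one_mul]
        congr 2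
        rcases hD0 with h | h
        · rw [← ENNReal.ofReal_natCast, ← ENNReal.ofReal_mul (by positivity),
            ← ENNReal.ofReal_mul (by positivity)]
          congr 1; ring
        · subst h; simp

/-! ### John–Nirenberg along a filtration -/

section JohnNirenberg

variable {X : Type*} {m0 : MeasurableSpace X} {ν : Measure X} [IsFiniteMeasure ν]
  {ℱ : Filtration ℕ m0} {g : ℕ → X → ℝ} {v : X → ℝ} {B D c : ℝ}

/-- The set where the sequence `g m, g (m + 1), …` leaves the `lam`-neighbourhood of `g m` for
the first time after `i` steps. -/
def exitSet (g : ℕ → X → ℝ) (m : ℕ) (lam : ℝ) (S : Set X) (i : ℕ) : Set X :=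
  S ∩ ({x | lam < |g (m + i) x - g m x|} ∩ ⋂ i' : Fin i, {x | |g (m + i') x - g m x| ≤ lam})

lemma mem_exitSet {m i : ℕ} {lam : ℝ} {S : Set X} {x : X} :
    x ∈ exitSet g m lam S i ↔
      x ∈ S ∧ lam < |g (m + i) x - g m x| ∧ ∀ i' < i, |g (m + i') x - g m x| ≤ lam := by
  simp only [exitSet, Set.mem_inter_iff, Set.mem_ofPred_eq, Set.mem_iInter]
  exact ⟨fun h => ⟨h.1, h.2.1, fun i' hi' => h.2.2 ⟨i', hi'⟩⟩,
    fun h => ⟨h.1, h.2.1, fun i' => h.2.2 i' i'.2⟩⟩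

lemma measurableSet_exitSet_of_measurable {Y : Type*} [MeasurableSpace Y] {g : ℕ → Y → ℝ}
    {m i : ℕ} (hg : ∀ i' ≤ i, Measurable (g (m + i'))) (lam : ℝ) {S : Set Y}
    (hS : MeasurableSet S) : MeasurableSet (exitSet g m lam S i) := by
  have hgd : ∀ i' ≤ i, Measurable fun x => |g (m + i') x - g m x| := fun i' hi' =>
    ((hg i' hi').sub (hg 0 (Nat.zero_le _))).abs
  refine MeasurableSet.inter hS (MeasurableSet.inter ?_ ?_)
  · exact measurableSet_lt measurable_const (hgd i le_rfl)
  · exact MeasurableSet.iInter fun i' => measurableSet_le (hgd i' i'.2.le) measurable_const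

/-- Exiting after `i` steps is decided by time `m + i`, so the oscillation hypothesis at level `m +
i` may be applied on the exit set itself. -/
lemma measurableSet_exitSet (hg : ∀ j, Measurable[ℱ j] (g j)) {m : ℕ} (lam : ℝ) {S : Set X}
    (hS : MeasurableSet[ℱ m] S) (i : ℕ) : MeasurableSet[ℱ (m + i)] (exitSet g m lam S i) :=
  @measurableSet_exitSet_of_measurable X (ℱ (m + i)) g m i
    (fun i' hi' => (hg _).mono (ℱ.mono (by omega)) le_rfl) lam S (ℱ.mono (by omega) _ hS)

lemma disjoint_exitSet {m : ℕ} {lam : ℝ} {S : Set X} :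
    Pairwise (Function.onFun Disjoint (exitSet g m lam S)) := by
  intro i j hij
  refine Set.disjoint_left.2 fun x hi hj => ?_
  rw [mem_exitSet] at hi hj
  rcases lt_or_gt_of_ne hij with h | h
  · exact absurd (hj.2.2 i h) (not_le.2 hi.2.1)
  · exact absurd (hi.2.2 j h) (not_le.2 hj.2.1)

/-- The exit sets have small total measure. -/
lemma sum_measure_exitSet_le (hv : Measurable v) (hg : ∀ j, Measurable[ℱ j] (g j)) (hB : 0 < B)
    (hosc : ∀ j S, MeasurableSet[ℱ j] S →
      ∫⁻ x in S, ENNReal.ofReal |v x - g j x| ∂ν ≤ ENNReal.ofReal B * ν S)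
    {m : ℕ} {S : Set X} (hS : MeasurableSet[ℱ m] S) (T : Finset ℕ) :
    8 * ∑ i ∈ T, ν (exitSet g m (9 * B) S i) ≤ ν S := by
  have hg0 : ∀ j, Measurable (g j) := fun j => (hg j).mono (ℱ.le j) le_rfl
  have hm0 : ∀ i, MeasurableSet (exitSet g m (9 * B) S i) := fun i =>
    ℱ.le _ _ (measurableSet_exitSet hg _ hS i)
  have hstep : ∀ i, ENNReal.ofReal (8 * B) * ν (exitSet g m (9 * B) S i) ≤
      ∫⁻ x in exitSet g m (9 * B) S i, ENNReal.ofReal |v x - g m x| ∂ν := by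
    intro i
    set A := exitSet g m (9 * B) S i with hA
    -- On the exit set `g m` and `g (m + i)` differ by more than `9 B`, while `v` is within `B` of
    -- `g (m + i)` on average. Hence `|v - g m|` averages at least `8 B` there, against `B` on all
    -- of `S`.
    have h1 : ENNReal.ofReal (9 * B) * ν A ≤ ENNReal.ofReal B * ν A +
        ∫⁻ x in A, ENNReal.ofReal |v x - g m x| ∂ν := by
      calc ENNReal.ofReal (9 * B) * ν A = ∫⁻ _ in A, ENNReal.ofReal (9 * B) ∂ν := by simp
        _ ≤ ∫⁻ x in A, (ENNReal.ofReal |v x - g (m + i) x| + ENNReal.ofReal |v x - g m x|) ∂ν := by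
            refine setLIntegral_mono' (hm0 i) fun x hx => ?_
            rw [← ENNReal.ofReal_add (abs_nonneg _) (abs_nonneg _)]
            apply ENNReal.ofReal_le_ofReal
            have h2 := (mem_exitSet.1 hx).2.1
            have h3 := abs_sub_le (g (m + i) x) (v x) (g m x)
            rw [abs_sub_comm (g (m + i) x) (v x)] at h3
            linarith
        _ = ∫⁻ x in A, ENNReal.ofReal |v x - g (m + i) x| ∂ν +
            ∫⁻ x in A, ENNReal.ofReal |v x - g m x| ∂ν := by
            have := hg0 (m + i)
            rw [lintegral_add_left (by fun_prop)]
        _ ≤ _ := by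
            gcongr
            exact hosc (m + i) A (measurableSet_exitSet hg _ hS i)
    have h2 : ENNReal.ofReal (9 * B) = ENNReal.ofReal B + ENNReal.ofReal (8 * B) := by
      rw [← ENNReal.ofReal_add hB.le (by positivity)]
      congr 1; ring
    rw [h2, add_mul] at h1
    exact (ENNReal.add_le_add_iff_left
      (ENNReal.mul_ne_top ENNReal.ofReal_ne_top (measure_ne_top _ _))).1 h1
  have hsum : ENNReal.ofReal (8 * B) * ∑ i ∈ T, ν (exitSet g m (9 * B) S i) ≤
      ENNReal.ofReal B * ν S := by
    calc _ ≤ ∑ i ∈ T, ∫⁻ x in exitSet g m (9 * B) S i, ENNReal.ofReal |v x - g m x| ∂ν := by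
          rw [Finset.mul_sum]
          exact Finset.sum_le_sum fun i _ => hstep i
      _ = ∫⁻ x in ⋃ i ∈ T, exitSet g m (9 * B) S i, ENNReal.ofReal |v x - g m x| ∂ν := by
          rw [lintegral_biUnion_finset (disjoint_exitSet.set_pairwise _) fun i _ => hm0 i]
      _ ≤ ∫⁻ x in S, ENNReal.ofReal |v x - g m x| ∂ν :=
          lintegral_mono_set (Set.iUnion₂_subset fun i _ x hx => (mem_exitSet.1 hx).1)
      _ ≤ _ := hosc m S hS
  rw [mul_comm 8 B, ENNReal.ofReal_mul hB.le, mul_assoc,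
    ENNReal.mul_le_mul_iff_right (ENNReal.ofReal_pos.2 hB).ne' ENNReal.ofReal_ne_top] at hsum
  simpa using hsum

/-- A discrete John–Nirenberg inequality. -/
lemma john_nirenberg_discrete (hv : Measurable v) (hg : ∀ j, Measurable[ℱ j] (g j)) (hB : 0 < B)
    (hosc : ∀ j S, MeasurableSet[ℱ j] S →
      ∫⁻ x in S, ENNReal.ofReal |v x - g j x| ∂ν ≤ ENNReal.ofReal B * ν S)
    (hD : ∀ j x, |g (j + 1) x - g j x| ≤ D) (hc : 0 ≤ c) (hc2 : Real.exp (c * (9 * B + D)) ≤ 2)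
    (d : ℕ) : ∀ (m : ℕ) (S : Set X), MeasurableSet[ℱ m] S →
      ∫⁻ x in S, ENNReal.ofReal (Real.exp (c * |g (m + d) x - g m x|)) ∂ν ≤ 4 * ν S := by
  -- Restart at the first exit. Without exit the integrand is at most `2`; at an exit the overshoot
  -- costs a factor `2` and the induction hypothesis a factor `4`, on sets of total measure at most
  -- `ν S / 8`. The total `2 + 8 / 8 = 3` stays below `4`.
  induction d using Nat.strong_induction_on with
  | _ d ih =>
  intro m S hS
  have hS0 : MeasurableSet S := ℱ.le _ _ hS
  set F : X → ℝ≥0∞ := fun x => ENNReal.ofReal (Real.exp (c * |g (m + d) x - g m x|)) with hF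
  set A : ℕ → Set X := exitSet g m (9 * B) S with hA
  set U : Set X := ⋃ i ∈ Finset.range (d + 1), A i with hU
  have hA0 : ∀ i, MeasurableSet (A i) := fun i => ℱ.le _ _ (measurableSet_exitSet hg _ hS i)
  have hU0 : MeasurableSet U := Finset.measurableSet_biUnion _ fun i _ => hA0 i
  have hUS : U ⊆ S := Set.iUnion₂_subset fun i _ x hx => (mem_exitSet.1 hx).1
  have hout : ∫⁻ x in S \ U, F x ∂ν ≤ 2 * ν S := by
    calc ∫⁻ x in S \ U, F x ∂ν ≤ ∫⁻ _ in S \ U, 2 ∂ν := by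
          refine setLIntegral_mono' (hS0.diff hU0) fun x hx => ?_
          rw [hF, ← ENNReal.ofReal_ofNat]
          apply ENNReal.ofReal_le_ofReal
          refine le_trans (Real.exp_le_exp.2 ?_) hc2
          refine mul_le_mul_of_nonneg_left ?_ hc
          have hD0 : 0 ≤ D := (abs_nonneg _).trans (hD 0 x)
          by_contra! hlt
          have hex : ∃ i, 9 * B < |g (m + i) x - g m x| := ⟨d, by linarith⟩
          classical
          refine hx.2 (Set.mem_biUnion (x := Nat.find hex) ?_ (mem_exitSet.2
            ⟨hx.1, Nat.find_spec hex, fun i' hi' => not_lt.1 (Nat.find_min hex hi')⟩))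
          exact Finset.mem_coe.2 (Finset.mem_range.2
            (Nat.lt_succ_of_le (Nat.find_min' hex (by linarith))))
      _ ≤ 2 * ν S := by
          rw [setLIntegral_const]
          gcongr
          exact Set.sdiff_subset
  -- The step before the exit is within `9 B` and one increment is at most `D`, so the exit value is
  -- within `9 B + D` of `g m`. No exit occurs at `i = 0`, so fewer than `d` steps remain.
  have hin : ∀ i ∈ Finset.range (d + 1), ∫⁻ x in A i, F x ∂ν ≤ 8 * ν (A i) := by
    intro i hi
    rcases Nat.eq_zero_or_pos i with rfl | hi0
    · have : A 0 = ∅ := by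
        ext x
        simp only [hA, mem_exitSet, add_zero, sub_self, abs_zero, Set.mem_empty_iff_false,
          iff_false, not_and]
        intro _ h
        linarith
      simp [this]
    · have hid : i ≤ d := Nat.lt_succ_iff.1 (Finset.mem_range.1 hi)
      have hI := ih (d - i) (by omega) (m + i) (A i) (measurableSet_exitSet hg _ hS i)
      rw [show m + i + (d - i) = m + d by omega] at hI
      calc ∫⁻ x in A i, F x ∂ν ≤ ∫⁻ x in A i, 2 *
            ENNReal.ofReal (Real.exp (c * |g (m + d) x - g (m + i) x|)) ∂ν := by
            refine setLIntegral_mono' (hA0 i) fun x hx => ?_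
            obtain ⟨-, -, h2⟩ := mem_exitSet.1 hx
            have h3 := h2 (i - 1) (by omega)
            have h4 := hD (m + (i - 1)) x
            rw [show m + (i - 1) + 1 = m + i by omega] at h4
            have h5 := abs_sub_le (g (m + i) x) (g (m + (i - 1)) x) (g m x)
            have h6 := abs_sub_le (g (m + d) x) (g (m + i) x) (g m x)
            rw [hF, ← ENNReal.ofReal_ofNat, ← ENNReal.ofReal_mul (by norm_num)]
            apply ENNReal.ofReal_le_ofReal
            calc Real.exp (c * |g (m + d) x - g m x|) ≤
                  Real.exp (c * (9 * B + D) + c * |g (m + d) x - g (m + i) x|) := by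
                  rw [← mul_add]
                  gcongr
                  linarith
              _ ≤ _ := by rw [Real.exp_add]; gcongr
        _ ≤ 2 * (4 * ν (A i)) := by
            rw [lintegral_const_mul' _ _ (by simp)]
            gcongr
        _ = 8 * ν (A i) := by rw [← mul_assoc]; norm_num
  have hsum := sum_measure_exitSet_le hv hg hB hosc hS (Finset.range (d + 1))
  calc ∫⁻ x in S, F x ∂ν = ∫⁻ x in U, F x ∂ν + ∫⁻ x in S \ U, F x ∂ν := by
        rw [← lintegral_inter_add_sdiff F S hU0, Set.inter_eq_right.2 hUS]
    _ ≤ ν S + 2 * ν S := by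
        gcongr
        refine le_trans ?_ hsum
        rw [hU, lintegral_biUnion_finset (disjoint_exitSet.set_pairwise _) fun i _ => hA0 i,
          Finset.mul_sum]
        exact Finset.sum_le_sum hin
    _ ≤ 4 * ν S := by
        rw [show (4 : ℝ≥0∞) = 1 + 3 by norm_num, add_mul, one_mul]
        gcongr
        norm_num

/-- A John–Nirenberg inequality: bounded mean oscillation along a filtration with bounded
increments implies exponential integrability. -/
lemma john_nirenberg (hv : Measurable v) (hg : ∀ j, Measurable[ℱ j] (g j)) (hB : 0 < B)
    (hosc : ∀ j S, MeasurableSet[ℱ j] S →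
      ∫⁻ x in S, ENNReal.ofReal |v x - g j x| ∂ν ≤ ENNReal.ofReal B * ν S)
    (hD : ∀ j x, |g (j + 1) x - g j x| ≤ D) (hc : 0 ≤ c) (hc2 : Real.exp (c * (9 * B + D)) ≤ 2)
    (hlim : Filter.Tendsto (fun j => ∫⁻ x, ENNReal.ofReal |v x - g j x| ∂ν) Filter.atTop (nhds 0)) :
    ∫⁻ x, ENNReal.ofReal (Real.exp (c * |v x - g 0 x|)) ∂ν ≤ 4 * ν Set.univ := by
  have hg0 : ∀ j, Measurable (g j) := fun j => (hg j).mono (ℱ.le j) le_rfl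
  -- Convergence in `L¹` yields an almost everywhere convergent subsequence, along which Fatou
  -- carries over the bounds, uniform in the number of steps.
  have hmeas : TendstoInMeasure ν g Filter.atTop v := by
    refine tendstoInMeasure_of_tendsto_eLpNorm (p := 1) one_ne_zero
      (fun j => (hg0 j).aestronglyMeasurable) hv.aestronglyMeasurable ?_
    refine hlim.congr fun j => ?_
    rw [eLpNorm_one_eq_lintegral_enorm]
    congr 1; ext x
    rw [Real.enorm_eq_ofReal_abs, Pi.sub_apply, abs_sub_comm]
  obtain ⟨φ, hφ, hae⟩ := hmeas.exists_seq_tendsto_ae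
  calc ∫⁻ x, ENNReal.ofReal (Real.exp (c * |v x - g 0 x|)) ∂ν =
        ∫⁻ x, Filter.liminf (fun i => ENNReal.ofReal (Real.exp (c * |g (φ i) x - g 0 x|)))
          Filter.atTop ∂ν := by
        refine lintegral_congr_ae ?_
        filter_upwards [hae] with x hx
        refine (Filter.Tendsto.liminf_eq ?_).symm
        refine (ENNReal.continuous_ofReal.tendsto _).comp ((Real.continuous_exp.tendsto _).comp ?_)
        exact ((hx.sub_const _).abs).const_mul _
    _ ≤ Filter.liminf (fun i => ∫⁻ x, ENNReal.ofReal (Real.exp (c * |g (φ i) x - g 0 x|)) ∂ν)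
          Filter.atTop := by
        refine lintegral_liminf_le fun i => ?_
        have := hg0 (φ i)
        have := hg0 0
        fun_prop
    _ ≤ Filter.liminf (fun _ : ℕ => 4 * ν Set.univ) Filter.atTop := by
        refine Filter.liminf_le_liminf (Filter.Eventually.of_forall fun i => ?_)
        have := john_nirenberg_discrete hv hg hB hosc hD hc hc2 (φ i) 0 Set.univ MeasurableSet.univ
        simpa using this
    _ = _ := by simp

end JohnNirenberg

/-! ### John–Nirenberg for nested partitions -/

section Cells

variable {X ι : Type*} [MeasurableSpace X] [MeasurableSpace ι] [DiscreteMeasurableSpace ι]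
  [Countable ι]

/-- An estimate on every cell of a countable partition sums up to unions of cells. -/
lemma setLIntegral_preimage_le {I : X → ι} (hI : Measurable I) {F : X → ℝ≥0∞} {μ M : Measure X}
    {T : Set ι} (h : ∀ x, I x ∈ T → ∫⁻ y in I ⁻¹' {I x}, F y ∂μ ≤ M (I ⁻¹' {I x})) :
    ∫⁻ y in I ⁻¹' T, F y ∂μ ≤ M (I ⁻¹' T) := by
  have hT : I ⁻¹' T = ⋃ i ∈ T, I ⁻¹' {i} := by ext x; simp
  have hm : ∀ i, MeasurableSet (I ⁻¹' {i}) := fun i => hI (measurableSet_singleton i)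
  have hd : T.PairwiseDisjoint fun i => I ⁻¹' {i} := fun i _ i' _ hii' =>
    Disjoint.preimage _ (Set.disjoint_singleton.2 hii')
  rw [hT, lintegral_biUnion T.to_countable (fun i _ => hm i) hd,
    measure_biUnion T.to_countable hd fun i _ => hm i]
  refine ENNReal.tsum_le_tsum fun i => ?_
  rcases (I ⁻¹' {(i : ι)}).eq_empty_or_nonempty with he | ⟨x, hx⟩
  · simp [he]
  · have hx' : I x = i := hx
    have := h x (hx' ▸ i.2)
    rwa [hx'] at this

/-- The John–Nirenberg inequality for a nested sequence of countable partitions. -/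
lemma lintegral_exp_le_of_cells {I : ℕ → X → ι} (hI : ∀ j, Measurable (I j)) {par : ℕ → ι → ι}
    (hpar : ∀ j x, I j x = par j (I (j + 1) x)) (x₁ : X) {μ m : Measure X}
    (hμ : μ (I 0 ⁻¹' {I 0 x₁}) ≠ ∞) (hm : m (I 0 ⁻¹' {I 0 x₁}) ≠ ∞) {v : X → ℝ} (hv : Measurable v)
    {G : ℕ → ι → ℝ} {B K c : ℝ} (hB : 0 < B) (hK : 0 ≤ K)
    (hpos : ∀ j x, μ (I j ⁻¹' {I j x}) ≠ 0)
    (hdouble : ∀ j x, μ (I j ⁻¹' {I j x}) ≤ ENNReal.ofReal K * μ (I (j + 1) ⁻¹' {I (j + 1) x}))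
    (hosc : ∀ j x, I 0 x = I 0 x₁ → ∫⁻ y in I j ⁻¹' {I j x}, ENNReal.ofReal |v y - G j (I j x)| ∂μ ≤
      ENNReal.ofReal B * μ (I j ⁻¹' {I j x}))
    {η : ℕ → ℝ} (hη : Filter.Tendsto η Filter.atTop (nhds 0))
    (hsmall : ∀ j x, I 0 x = I 0 x₁ →
      ∫⁻ y in I j ⁻¹' {I j x}, ENNReal.ofReal |v y - G j (I j x)| ∂μ ≤
        ENNReal.ofReal (η j) * (μ + m) (I j ⁻¹' {I j x}))
    (hc : 0 ≤ c) (hc2 : Real.exp (c * (9 * B + B * (1 + K))) ≤ 2) :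
    ∃ g₀ : ℝ, ∫⁻ x in I 0 ⁻¹' {I 0 x₁}, ENNReal.ofReal (Real.exp (c * |v x - g₀|)) ∂μ ≤
      4 * μ (I 0 ⁻¹' {I 0 x₁}) := by
  classical
  set Q := I 0 ⁻¹' {I 0 x₁} with hQ
  have hstep : ∀ j, Measurable[MeasurableSpace.comap (I (j + 1)) inferInstance] (I j) := fun j => by
    rw [show I j = par j ∘ I (j + 1) from funext (hpar j)]
    exact (Measurable.of_discrete (f := par j)).comp (comap_measurable _)
  let ℱ : Filtration ℕ ‹MeasurableSpace X› :=
    { seq := fun j => MeasurableSpace.comap (I j) inferInstance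
      mono' := monotone_nat_of_le_succ fun j => (hstep j).comap_le
      le' := fun j => (hI j).comap_le }
  have hQℱ : ∀ j, MeasurableSet[ℱ j] Q := fun j =>
    ℱ.mono (Nat.zero_le j) _ ⟨{I 0 x₁}, measurableSet_singleton _, rfl⟩
  have hT : ∀ j, ∃ T : Set ι, I j ⁻¹' T = Q := fun j => by
    obtain ⟨T, -, hT⟩ := hQℱ j
    exact ⟨T, hT⟩
  choose T₀ hT₀ using hT
  have hQm : MeasurableSet Q := hI 0 (measurableSet_singleton _)
  have hmem : ∀ j x, I j x ∈ T₀ j ↔ I 0 x = I 0 x₁ := fun j x => by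
    have : x ∈ I j ⁻¹' T₀ j ↔ x ∈ Q := by rw [hT₀]
    exact this
  -- Oscillation bounds hold only in the root cell `Q`. Setting `g` to zero elsewhere keeps it
  -- adapted, since `Q` is a union of cells of every generation, and keeps its increments bounded.
  set g : ℕ → X → ℝ := fun j x => if I j x ∈ T₀ j then G j (I j x) else 0 with hg
  have hgm : ∀ j, Measurable[ℱ j] (g j) := fun j =>
    (Measurable.of_discrete (f := fun i => if i ∈ T₀ j then G j i else 0)).comp
      (comap_measurable (I j))
  have : IsFiniteMeasure (μ.restrict Q) := ⟨by
    rw [Measure.restrict_apply_univ]; exact hμ.lt_top⟩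
  have hgcell : ∀ j x, I 0 x = I 0 x₁ → ∀ (M : Measure X),
      ∫⁻ y in I j ⁻¹' {I j x}, ENNReal.ofReal |v y - g j y| ∂M =
      ∫⁻ y in I j ⁻¹' {I j x}, ENNReal.ofReal |v y - G j (I j x)| ∂M := fun j x hx M => by
    refine setLIntegral_congr_fun (hI j (measurableSet_singleton _)) fun y hy => ?_
    have : I j y = I j x := hy
    simp only [hg, this, (hmem j x).2 hx, if_true]
  have hsum : ∀ (j : ℕ) (S : Set X) (M : Measure X), MeasurableSet[ℱ j] S →
      (∀ x, I 0 x = I 0 x₁ →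
        ∫⁻ y in I j ⁻¹' {I j x}, ENNReal.ofReal |v y - G j (I j x)| ∂μ ≤ M (I j ⁻¹' {I j x})) →
      ∫⁻ y in S, ENNReal.ofReal |v y - g j y| ∂(μ.restrict Q) ≤ M (S ∩ Q) := by
    intro j S M hS h
    have hSQ : MeasurableSet[ℱ j] (S ∩ Q) := MeasurableSet.inter hS (hQℱ j)
    obtain ⟨T, -, hTS⟩ := hSQ
    rw [Measure.restrict_restrict (ℱ.le j _ hS), ← hTS]
    refine setLIntegral_preimage_le (hI j) fun x hx => ?_
    have hxQ : x ∈ S ∩ Q := hTS ▸ hx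
    rw [hgcell j x hxQ.2]
    exact h x hxQ.2
  refine ⟨G 0 (I 0 x₁), ?_⟩
  have key := john_nirenberg (ν := μ.restrict Q) (ℱ := ℱ) (g := g) (D := B * (1 + K)) hv hgm hB
    ?_ ?_ hc hc2 ?_
  · rw [Measure.restrict_apply_univ] at key
    refine le_of_eq_of_le (setLIntegral_congr_fun hQm fun x hx => ?_) key
    have hx' : I 0 x = I 0 x₁ := hx
    simp only [hg, if_pos ((hmem 0 x).2 hx')]
    rw [hx']
  · intro j S hS
    have := hsum j S (ENNReal.ofReal B • μ) hS fun x hx => hosc j x hx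
    rwa [Measure.smul_apply, smul_eq_mul, ← Measure.restrict_apply (ℱ.le j _ hS)] at this
  · intro j x
    by_cases hx : I 0 x = I 0 x₁
    · simp only [hg, (hmem _ x).2 hx, if_true]
      set c' := I (j + 1) ⁻¹' {I (j + 1) x} with hc'
      have hsub : c' ⊆ I j ⁻¹' {I j x} := fun y hy => by
        have hy' : I (j + 1) y = I (j + 1) x := hy
        change I j y = I j x
        rw [hpar, hpar j x, hy']
      have hc'fin : μ c' ≠ ∞ := by
        refine ne_top_of_le_ne_top hμ (measure_mono ?_)
        rw [← hT₀ (j + 1)]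
        intro y hy
        have hy' : I (j + 1) y = I (j + 1) x := hy
        change I (j + 1) y ∈ T₀ (j + 1)
        rw [hy']; exact (hmem _ x).2 hx
      set a := G (j + 1) (I (j + 1) x)
      set b := G j (I j x)
      -- On the child cell `v` is on average within `B` of its own constant and, after paying the
      -- volume ratio `K`, within `B K` of that of the parent.
      have h1 : ENNReal.ofReal |a - b| * μ c' ≤ ENNReal.ofReal (B * (1 + K)) * μ c' := by
        calc ENNReal.ofReal |a - b| * μ c' = ∫⁻ _ in c', ENNReal.ofReal |a - b| ∂μ := by
              rw [setLIntegral_const]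
          _ ≤ ∫⁻ y in c', (ENNReal.ofReal |v y - a| + ENNReal.ofReal |v y - b|) ∂μ := by
              refine lintegral_mono fun y => ?_
              rw [← ENNReal.ofReal_add (abs_nonneg _) (abs_nonneg _)]
              refine ENNReal.ofReal_le_ofReal ?_
              have := abs_sub_le a (v y) b
              rwa [abs_sub_comm a (v y)] at this
          _ = ∫⁻ y in c', ENNReal.ofReal |v y - a| ∂μ + ∫⁻ y in c', ENNReal.ofReal |v y - b| ∂μ :=
              lintegral_add_left (by fun_prop) _
          _ ≤ ENNReal.ofReal B * μ c' + ENNReal.ofReal B * (ENNReal.ofReal K * μ c') := by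
              gcongr
              · exact hosc (j + 1) x hx
              · exact (lintegral_mono_set hsub).trans ((hosc j x hx).trans
                  (mul_le_mul_right (hdouble j x) _))
          _ = ENNReal.ofReal (B * (1 + K)) * μ c' := by
              rw [ENNReal.ofReal_mul hB.le, ENNReal.ofReal_add zero_le_one hK, ENNReal.ofReal_one]
              ring
      rw [ENNReal.mul_le_mul_iff_left (hpos (j + 1) x) hc'fin,
        ENNReal.ofReal_le_ofReal_iff (by positivity)] at h1
      exact h1
    · have h1 := fun j => mt (hmem j x).1 hx
      simp only [hg, h1, if_false, sub_zero, abs_zero]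
      positivity
  -- The auxiliary measure `m` lets the cellwise errors be summed over a whole generation, giving `η
  -- j` times the fixed finite number `(μ + m) Q`, hence convergence in `L¹`.
  · have hfin : (μ + m) Q ≠ ∞ := by
      rw [Measure.add_apply]; exact ENNReal.add_ne_top.2 ⟨hμ, hm⟩
    have hlim : Filter.Tendsto (fun j => ENNReal.ofReal (η j) * (μ + m) Q) Filter.atTop (nhds 0) := by
      have := ENNReal.Tendsto.mul_const (ENNReal.tendsto_ofReal hη) (Or.inr hfin)
      rwa [ENNReal.ofReal_zero, zero_mul] at this
    refine tendsto_of_tendsto_of_tendsto_of_le_of_le tendsto_const_nhds hlim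
      (fun _ => zero_le) fun j => ?_
    have := hsum j Set.univ (ENNReal.ofReal (η j) • (μ + m)) MeasurableSet.univ
      fun x hx => hsmall j x hx
    rwa [Set.univ_inter, setLIntegral_univ] at this

end Cells

/-! ### The anisotropic dyadic grid -/

section Grid

/-- The index of the cell containing `x` in the grid with corner `lo` and side lengths `L`. -/
def gridIndex (lo L : Fin n → ℝ) (x : Fin n → ℝ) : Fin n → ℤ := fun k => ⌊(x k - lo k) / L k⌋

lemma measurable_gridIndex (lo L : Fin n → ℝ) : Measurable (gridIndex lo L) := by
  refine measurable_pi_lambda _ fun k => Int.measurable_floor.comp ?_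
  fun_prop

lemma gridIndex_preimage {lo L : Fin n → ℝ} (hL : ∀ k, 0 < L k) (i : Fin n → ℤ) :
    gridIndex lo L ⁻¹' {i} =
      box (fun k => lo k + L k * i k) (fun k => lo k + L k * (i k + 1)) := by
  ext x
  rw [Set.mem_preimage, Set.mem_singleton_iff, mem_box, funext_iff]
  refine forall_congr' fun k => ?_
  rw [gridIndex, Int.floor_eq_iff, le_div_iff₀ (hL k), div_lt_iff₀ (hL k)]
  constructor <;> rintro ⟨h1, h2⟩ <;> constructor <;> linarith

lemma volume_gridIndex_preimage {lo L : Fin n → ℝ} (hL : ∀ k, 0 < L k) (i : Fin n → ℤ) :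
    volume (gridIndex lo L ⁻¹' {i}) = ENNReal.ofReal (∏ k, L k) := by
  rw [gridIndex_preimage hL, volume_box fun k => by have := hL k; linarith]
  congr 1
  exact Finset.prod_congr rfl fun k _ => by ring

/-- With a common corner and integer side ratios the coarse index is the integer quotient of the
fine one, so the grids are nested. -/
lemma gridIndex_coarsen {lo L L' : Fin n → ℝ} {N : Fin n → ℕ} (hLL : ∀ k, L k = L' k * N k)
    (x : Fin n → ℝ) : gridIndex lo L x = fun k => gridIndex lo L' x k / N k := by
  funext k
  rw [gridIndex, gridIndex, ← Int.floor_div_natCast, hLL k, div_mul_eq_div_div]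

lemma abs_sub_lt_of_gridIndex_eq {lo L x y : Fin n → ℝ} (hL : ∀ k, 0 < L k)
    (h : gridIndex lo L y = gridIndex lo L x) (k : Fin n) : |y k - x k| < L k := by
  have := Int.abs_sub_lt_one_of_floor_eq_floor (congrFun h k)
  rwa [← sub_div, sub_sub_sub_cancel_right, abs_div, abs_of_pos (hL k), div_lt_one (hL k)] at this

end Grid

/-- The mean oscillation is bounded by the double integral of the differences. -/
lemma lintegral_sub_average_le {X : Type*} [MeasurableSpace X] {μ : Measure X} {Q : Set X}
    (h0 : μ Q ≠ 0) (hfin : μ Q ≠ ∞) {v : X → ℝ} (hv : IntegrableOn v Q μ) :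
    ∫⁻ x in Q, ENNReal.ofReal |v x - ⨍ y in Q, v y ∂μ| ∂μ ≤
      (μ Q)⁻¹ * ∫⁻ x in Q, ∫⁻ y in Q, ENNReal.ofReal |v y - v x| ∂μ ∂μ := by
  rw [← lintegral_const_mul' _ _ (ENNReal.inv_ne_top.2 h0)]
  refine lintegral_mono fun x => ?_
  have hr : μ.real Q ≠ 0 := (ENNReal.toReal_pos h0 hfin).ne'
  have : IsFiniteMeasure (μ.restrict Q) := ⟨by
    rw [Measure.restrict_apply_univ]; exact hfin.lt_top⟩
  have h1 : v x - ⨍ y in Q, v y ∂μ = (μ.real Q)⁻¹ * ∫ y in Q, (v x - v y) ∂μ := by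
    rw [integral_sub (integrable_const _) hv, setIntegral_const, setAverage_eq, smul_eq_mul,
      smul_eq_mul, mul_sub, inv_mul_cancel_left₀ hr]
  calc ENNReal.ofReal |v x - ⨍ y in Q, v y ∂μ|
      = (μ Q)⁻¹ * ENNReal.ofReal |∫ y in Q, (v x - v y) ∂μ| := by
        rw [h1, abs_mul, abs_of_nonneg (by positivity), ENNReal.ofReal_mul (by positivity),
          measureReal_def, ENNReal.ofReal_inv_of_pos (ENNReal.toReal_pos h0 hfin),
          ENNReal.ofReal_toReal hfin]
    _ ≤ (μ Q)⁻¹ * ∫⁻ y in Q, ENNReal.ofReal |v y - v x| ∂μ := by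
        gcongr
        have := enorm_integral_le_lintegral_enorm (μ := μ.restrict Q) fun y => v x - v y
        simp only [Real.enorm_eq_ofReal_abs] at this
        refine this.trans (lintegral_mono fun y => ?_)
        rw [abs_sub_comm]

/-- Either `t ≤ η`, or `η ^ (1-p) t ^ p ≥ t`. The free parameter matters: `η = 1` gives bounded
oscillation, while an `η` shrinking with the cell gives `L¹` convergence. -/
lemma le_add_rpow_mul_rpow {p η t : ℝ} (hp : 1 < p) (hη : 0 < η) (ht : 0 ≤ t) :
    t ≤ η + η ^ (1 - p) * t ^ p := by
  rcases le_or_gt t η with h | h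
  · have : 0 ≤ η ^ (1 - p) * t ^ p := by positivity
    linarith
  · have ht0 : 0 < t := hη.trans h
    have h1 : t = t ^ (1 - p) * t ^ p := by
      rw [← Real.rpow_add ht0]; simp
    have h2 : t ^ (1 - p) ≤ η ^ (1 - p) :=
      Real.rpow_le_rpow_of_nonpos hη h.le (by linarith)
    have h3 : t ^ (1 - p) * t ^ p ≤ η ^ (1 - p) * t ^ p := by gcongr
    linarith

/-- The mean oscillation on a box is controlled by the axes energy. -/
lemma lintegral_sub_average_box_le {p s₀ D η : ℝ} {s a b : Fin n → ℝ} (hp : 1 < p) (hs₀ : 0 < s₀)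
    (hs : ∀ k, s₀ ≤ s k ∧ s k < 1) (hab : ∀ k, a k < b k)
    (hD : ∀ k, (b k - a k) ^ (s k * p) ≤ D) {v : (Fin n → ℝ) → ℝ}
    (hv : Measurable v) (hvi : IntegrableOn v (box a b)) (hη : 0 < η) :
    ∫⁻ x in box a b, ENNReal.ofReal |v x - ⨍ y in box a b, v y| ≤
      ENNReal.ofReal η * volume (box a b) +
        ENNReal.ofReal (η ^ (1 - p) * ((2 ^ p) ^ n * (n * (2 * p / s₀)) * D)) *
          energy p (muAxes p s) (box a b) (box a b) v := by
  set Q := box a b with hQ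
  have h0 : volume Q ≠ 0 := by
    rw [hQ, volume_box hab, Ne, ENNReal.ofReal_eq_zero, not_le]
    exact Finset.prod_pos fun k _ => sub_pos.2 (hab k)
  have hfin : volume Q ≠ ∞ := by rw [hQ, volume_box hab]; exact ENNReal.ofReal_ne_top
  have hη1 : 0 ≤ η ^ (1 - p) := by positivity
  refine (lintegral_sub_average_le h0 hfin hvi).trans ?_
  calc (volume Q)⁻¹ * ∫⁻ x in Q, ∫⁻ y in Q, ENNReal.ofReal |v y - v x|
      ≤ (volume Q)⁻¹ * ∫⁻ x in Q, (ENNReal.ofReal η * volume Q + ENNReal.ofReal (η ^ (1 - p)) *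
          ∫⁻ y in Q, ENNReal.ofReal (|v y - v x| ^ p)) := by
        gcongr with x
        rw [← setLIntegral_const, ← lintegral_const_mul' _ _ ENNReal.ofReal_ne_top,
          ← lintegral_add_left measurable_const]
        gcongr with y
        rw [← ENNReal.ofReal_mul hη1, ← ENNReal.ofReal_add hη.le (by positivity)]
        exact ENNReal.ofReal_le_ofReal (le_add_rpow_mul_rpow hp hη (abs_nonneg _))
    _ = (volume Q)⁻¹ * (ENNReal.ofReal η * volume Q * volume Q + ENNReal.ofReal (η ^ (1 - p)) *
          ∫⁻ x in Q, ∫⁻ y in Q, ENNReal.ofReal (|v y - v x| ^ p)) := by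
        rw [lintegral_add_left measurable_const, setLIntegral_const,
          lintegral_const_mul' _ _ ENNReal.ofReal_ne_top]
    _ ≤ (volume Q)⁻¹ * (ENNReal.ofReal η * volume Q * volume Q + ENNReal.ofReal (η ^ (1 - p)) *
          (ENNReal.ofReal ((2 ^ p) ^ n * (n * (2 * p / s₀)) * D) * volume Q *
            energy p (muAxes p s) Q Q v)) := by
        gcongr
        exact poincare_box hp hs₀ hs hab hD hv
    _ = ((volume Q)⁻¹ * volume Q) * (ENNReal.ofReal η * volume Q + ENNReal.ofReal (η ^ (1 - p)) *
          ENNReal.ofReal ((2 ^ p) ^ n * (n * (2 * p / s₀)) * D) *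
            energy p (muAxes p s) Q Q v) := by ring
    _ = _ := by
        rw [ENNReal.inv_mul_cancel h0 hfin, one_mul, ← ENNReal.ofReal_mul hη1]

/-- The side lengths of the anisotropic dyadic cells of generation `j`. -/
def cellSide (s : Fin n → ℝ) (r : ℝ) (j : ℕ) (k : Fin n) : ℝ :=
  2 * r ^ (sMax s / s k) / 2 ^ ⌊sMax s / s k * j⌋₊

/-- The anisotropic dyadic cell of generation `j` containing `x`. -/
def cell (s : Fin n → ℝ) (x₀ : Fin n → ℝ) (r : ℝ) (j : ℕ) (x : Fin n → ℝ) : Set (Fin n → ℝ) :=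
  gridIndex (fun k => x₀ k - r ^ (sMax s / s k)) (cellSide s r j) ⁻¹'
    {gridIndex (fun k => x₀ k - r ^ (sMax s / s k)) (cellSide s r j) x}

section CellSide

variable {s : Fin n → ℝ} {s₀ r : ℝ}

lemma cellSide_pos (hr : 0 < r) (j : ℕ) (k : Fin n) : 0 < cellSide s r j k := by
  unfold cellSide; positivity

/-- The natural side is `2 (r / 2 ^ j) ^ (s_max / s_k)`, but its exponent of two need not be an
integer. Rounding it down, for the sake of exact nesting, enlarges the side by at most a factor two.
-/
lemma cellSide_bounds (hs₀ : 0 < s₀) (hs : ∀ k, s₀ ≤ s k ∧ s k < 1) (hr : 0 < r) (j : ℕ)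
    (k : Fin n) : 2 * (r / 2 ^ j) ^ (sMax s / s k) ≤ cellSide s r j k ∧
      cellSide s r j k ≤ 4 * (r / 2 ^ j) ^ (sMax s / s k) := by
  set a := sMax s / s k with ha
  have ha1 : 1 ≤ a := one_le_ratio hs₀ hs k
  have h2 : ((2 : ℝ) ^ j) ^ a = 2 ^ (a * j) := by
    rw [← Real.rpow_natCast, ← Real.rpow_mul zero_le_two, mul_comm]
  have h3 : (2 : ℝ) ^ ⌊a * j⌋₊ ≤ 2 ^ (a * j) := by
    rw [← Real.rpow_natCast]
    exact Real.rpow_le_rpow_of_exponent_le one_le_two (Nat.floor_le (by positivity))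
  have h4 : (2 : ℝ) ^ (a * j) ≤ 2 * 2 ^ ⌊a * j⌋₊ := by
    rw [← pow_succ', ← Real.rpow_natCast]
    refine Real.rpow_le_rpow_of_exponent_le one_le_two ?_
    push_cast
    exact (Nat.lt_floor_add_one _).le
  have hra : 0 < r ^ a := by positivity
  rw [Real.div_rpow hr.le (by positivity), h2, cellSide, ← ha]
  constructor
  · rw [mul_div_assoc]; gcongr
  · rw [← mul_div_assoc, div_le_div_iff₀ (by positivity) (by positivity)]
    nlinarith

/-- The ratio is a power of two whose exponent is a difference of two floors, hence at most `s_max /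
s_k + 1 ≤ 1 / s₀ + 1`. This bounds the doubling constant independently of the orders. -/
lemma exists_cellSide_eq (hs₀ : 0 < s₀) (hs : ∀ k, s₀ ≤ s k ∧ s k < 1) (r : ℝ) (j : ℕ)
    (k : Fin n) : ∃ N : ℕ, cellSide s r j k = cellSide s r (j + 1) k * N ∧
      (N : ℝ) ≤ 2 ^ (1 / s₀ + 1) := by
  set a := sMax s / s k with ha
  have ha1 : 1 ≤ a := one_le_ratio hs₀ hs k
  have haj : 0 ≤ a * j := by positivity
  have haj1 : 0 ≤ a * (j + 1 : ℕ) := by positivity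
  have hle : ⌊a * j⌋₊ ≤ ⌊a * (j + 1 : ℕ)⌋₊ := Nat.floor_mono (by gcongr; simp)
  refine ⟨2 ^ (⌊a * (j + 1 : ℕ)⌋₊ - ⌊a * j⌋₊), ?_, ?_⟩
  · rw [cellSide, cellSide, ← ha]
    push_cast
    rw [pow_sub₀ _ two_ne_zero (by exact_mod_cast hle)]
    field_simp
  · push_cast
    rw [← Real.rpow_natCast]
    refine Real.rpow_le_rpow_of_exponent_le one_le_two ?_
    rw [Nat.cast_sub (by exact_mod_cast hle)]
    have h1 := Nat.floor_le haj1
    have h2 := Nat.lt_floor_add_one (a * j)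
    have h3 : a ≤ 1 / s₀ := ratio_le hs₀ hs k
    push_cast at h1 ⊢
    linarith

lemma cell_zero (hr : 0 < r) (x₀ : Fin n → ℝ) : cell s x₀ r 0 x₀ =
    box (fun k => x₀ k - r ^ (sMax s / s k)) (fun k => x₀ k + r ^ (sMax s / s k)) := by
  have hi : gridIndex (fun k => x₀ k - r ^ (sMax s / s k)) (cellSide s r 0) x₀ = 0 := by
    funext k
    have : 0 < r ^ (sMax s / s k) := by positivity
    rw [gridIndex, Int.floor_eq_iff]
    simp only [cellSide, Nat.cast_zero, mul_zero, Nat.floor_zero, pow_zero, div_one, sub_sub_cancel,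
      Pi.zero_apply, Int.cast_zero, zero_add]
    exact ⟨by positivity, by rw [div_lt_one (by positivity)]; linarith⟩
  rw [cell, hi, gridIndex_preimage (cellSide_pos hr 0)]
  congr 1 <;> funext k <;> simp [cellSide]
  ring

lemma volume_cell (hr : 0 < r) (x₀ : Fin n → ℝ) (j : ℕ) (x : Fin n → ℝ) :
    volume (cell s x₀ r j x) = ENNReal.ofReal (∏ k, cellSide s r j k) :=
  volume_gridIndex_preimage (cellSide_pos hr j) _

end CellSide

lemma cell_subset {s₀ r : ℝ} {s : Fin n → ℝ} (hs₀ : 0 < s₀) (hs : ∀ k, s₀ ≤ s k ∧ s k < 1)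
    {x₀ x : Fin n → ℝ} (j : ℕ) (hx : x ∈ cell s x₀ r 0 x₀) :
    cell s x₀ r j x ⊆ cell s x₀ r 0 x₀ := by
  set lo : Fin n → ℝ := fun k => x₀ k - r ^ (sMax s / s k) with hlo
  induction j with
  | zero =>
    intro y hy
    exact (show gridIndex lo (cellSide s r 0) y = gridIndex lo (cellSide s r 0) x from hy).trans hx
  | succ j ih =>
    intro y hy
    refine ih ?_
    choose N hN _ using fun k => exists_cellSide_eq hs₀ hs r j k
    have hy' : gridIndex lo (cellSide s r (j + 1)) y = gridIndex lo (cellSide s r (j + 1)) x := hy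
    change gridIndex lo (cellSide s r j) y = gridIndex lo (cellSide s r j) x
    rw [gridIndex_coarsen hN, gridIndex_coarsen hN x, hy']

/-- Exponential integrability of functions with controlled axes energy on dyadic cells. -/
lemma exists_lintegral_exp_le (n : ℕ) {s₀ p E : ℝ} (hs₀ : 0 < s₀) (hp : 1 < p) (hE : 0 < E) :
    ∃ c : ℝ, 0 < c ∧ ∀ s : Fin n → ℝ, (∀ k, s₀ ≤ s k ∧ s k < 1) → Nonempty (Fin n) →
      ∀ (x₀ : Fin n → ℝ) (r : ℝ), 0 < r → ∀ v : (Fin n → ℝ) → ℝ, Measurable v →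
        IntegrableOn v (cell s x₀ r 0 x₀) →
        (∀ j, ∀ x ∈ cell s x₀ r 0 x₀,
          energy p (muAxes p s) (cell s x₀ r j x) (cell s x₀ r j x) v ≤
            ENNReal.ofReal (E * (r / 2 ^ j) ^ (-(p * sMax s))) * volume (cell s x₀ r j x)) →
        ∃ g₀ : ℝ, ∫⁻ x in cell s x₀ r 0 x₀, ENNReal.ofReal (Real.exp (c * |v x - g₀|)) ≤
          4 * volume (cell s x₀ r 0 x₀) := by
  -- `P` is the Poincaré constant for cells, with `4 ^ p` from the upper bound on their sides. `B`
  -- bounds the mean oscillation (the case `η = 1`), and `K` bounds the volume ratio of consecutive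
  -- generations.
  set P : ℝ := (2 ^ p) ^ n * (n * (2 * p / s₀)) * 4 ^ p with hP
  set B : ℝ := 1 + P * E with hB
  have hB0 : 0 < B := by positivity
  set K : ℝ := (2 ^ (1 / s₀ + 1)) ^ n with hK
  have hK0 : 0 ≤ K := by positivity
  refine ⟨Real.log 2 / (9 * B + B * (1 + K)), div_pos (Real.log_pos one_lt_two) (by positivity), ?_⟩
  intro s hs hn x₀ r hr v hv hvi hen
  have hM : 0 < sMax s := sMax_pos hs₀ hs
  set lo : Fin n → ℝ := fun k => x₀ k - r ^ (sMax s / s k) with hlo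
  set L := cellSide s r with hL
  have hL0 : ∀ j k, 0 < L j k := fun j k => cellSide_pos hr j k
  have hR : ∀ j : ℕ, 0 < r / 2 ^ j := fun j => by positivity
  have hcell : ∀ j x, gridIndex lo (L j) ⁻¹' {gridIndex lo (L j) x} = cell s x₀ r j x :=
    fun j x => rfl
  choose N hN hN' using fun j k => exists_cellSide_eq hs₀ hs r j k
  have hpar : ∀ j x, gridIndex lo (L j) x =
      (fun i k => i k / (N j k : ℤ)) (gridIndex lo (L (j + 1)) x) := fun j x =>
    gridIndex_coarsen (hN j) x
  have hcell_sub : ∀ j, ∀ x ∈ cell s x₀ r 0 x₀, cell s x₀ r j x ⊆ cell s x₀ r 0 x₀ := fun j x hx =>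
    cell_subset hs₀ hs j hx
  have hvol : ∀ j x, volume (cell s x₀ r j x) = ENNReal.ofReal (∏ k, L j k) :=
    fun j x => volume_cell hr x₀ j x
  have hmeas : ∀ j x, MeasurableSet (cell s x₀ r j x) := fun j x =>
    measurable_gridIndex lo (L j) (measurableSet_singleton _)
  have hosc : ∀ j x, x ∈ cell s x₀ r 0 x₀ → ∀ η : ℝ, 0 < η →
      ∫⁻ y in cell s x₀ r j x, ENNReal.ofReal |v y - ⨍ z in cell s x₀ r j x, v z| ≤
        ENNReal.ofReal η * volume (cell s x₀ r j x) +
          ENNReal.ofReal (η ^ (1 - p) * (P * (r / 2 ^ j) ^ (p * sMax s))) *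
            energy p (muAxes p s) (cell s x₀ r j x) (cell s x₀ r j x) v := by
    intro j x hx η hη
    have hvx : IntegrableOn v (cell s x₀ r j x) := hvi.mono_set (hcell_sub j x hx)
    have hbox := gridIndex_preimage (lo := lo) (hL0 j) (gridIndex lo (L j) x)
    rw [hcell] at hbox
    rw [hbox] at hvx ⊢
    rw [show P * (r / 2 ^ j) ^ (p * sMax s) = (2 ^ p) ^ n * (n * (2 * p / s₀)) *
      (4 ^ p * (r / 2 ^ j) ^ (p * sMax s)) by rw [hP]; ring]
    have := lintegral_sub_average_box_le (D := 4 ^ p * (r / 2 ^ j) ^ (p * sMax s)) (v := v) hp hs₀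
      hs (fun k => ?_) (fun k => ?_) hv hvx hη
    · refine this.trans (le_of_eq ?_)
      ring_nf
    · have := hL0 j k; linarith
    · have hsk := s_pos hs₀ hs k
      have hb := (cellSide_bounds hs₀ hs hr j k).2
      rw [show lo k + L j k * ((gridIndex lo (L j) x k : ℤ) + 1 : ℝ) -
        (lo k + L j k * (gridIndex lo (L j) x k : ℤ)) = L j k by ring]
      calc L j k ^ (s k * p) ≤ (4 * (r / 2 ^ j) ^ (sMax s / s k)) ^ (s k * p) :=
            Real.rpow_le_rpow (hL0 j k).le hb (by positivity)
        _ = 4 ^ (s k * p) * (r / 2 ^ j) ^ (p * sMax s) := by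
            rw [Real.mul_rpow (by norm_num) (by positivity), ← Real.rpow_mul (hR j).le]
            congr 2
            field_simp
        _ ≤ 4 ^ p * (r / 2 ^ j) ^ (p * sMax s) := by
            gcongr
            · norm_num
            · nlinarith [(hs k).2]
  -- A multiple of the axes energy density relative to the root cell. It dominates the energy of
  -- each cell while being additive over cells.
  set m : Measure (Fin n → ℝ) := ENNReal.ofReal P • volume.withDensity fun x =>
    ∫⁻ y in cell s x₀ r 0 x₀, ENNReal.ofReal (|v y - v x| ^ p) ∂(muAxes p s x) with hm
  have hmc : ∀ j x, x ∈ cell s x₀ r 0 x₀ → ENNReal.ofReal P *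
      energy p (muAxes p s) (cell s x₀ r j x) (cell s x₀ r j x) v ≤ m (cell s x₀ r j x) := by
    intro j x hx
    rw [hm, Measure.smul_apply, smul_eq_mul, withDensity_apply _ (hmeas j x)]
    gcongr
    exact lintegral_mono fun y => lintegral_mono_set (hcell_sub j x hx)
  -- With `η j = (r / 2 ^ j) ^ s_max` one has `η ^ (1-p) (r / 2 ^ j) ^ (p s_max) = η`, so both terms
  -- of the oscillation bound carry the same vanishing factor.
  refine lintegral_exp_le_of_cells (I := fun j => gridIndex lo (L j))
    (par := fun j i k => i k / (N j k : ℤ)) (G := fun j i => ⨍ z in gridIndex lo (L j) ⁻¹' {i}, v z)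
    (fun j => measurable_gridIndex _ _) hpar x₀ (m := m) ?_ ?_ hv hB0 hK0 ?_ ?_ ?_
    (η := fun j => (r / 2 ^ j) ^ sMax s) ?_ ?_ (div_nonneg (Real.log_nonneg one_le_two)
      (by positivity)) ?_
  · rw [hcell, hvol]; exact ENNReal.ofReal_ne_top
  · rw [hcell, hm, Measure.smul_apply, smul_eq_mul, withDensity_apply _ (hmeas 0 x₀)]
    refine ENNReal.mul_ne_top ENNReal.ofReal_ne_top (ne_top_of_le_ne_top ?_ (hen 0 x₀ rfl))
    rw [hvol]
    exact ENNReal.mul_ne_top ENNReal.ofReal_ne_top ENNReal.ofReal_ne_top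
  · intro j x
    rw [hcell, hvol, Ne, ENNReal.ofReal_eq_zero, not_le]
    exact Finset.prod_pos fun k _ => hL0 j k
  · intro j x
    rw [hcell, hcell, hvol, hvol, ← ENNReal.ofReal_mul hK0]
    refine ENNReal.ofReal_le_ofReal ?_
    calc ∏ k, L j k = ∏ k, L (j + 1) k * N j k := Finset.prod_congr rfl fun k _ => hN j k
      _ ≤ ∏ k, L (j + 1) k * 2 ^ (1 / s₀ + 1) := by
          refine Finset.prod_le_prod (fun k _ => ?_) fun k _ => ?_
          · have := hL0 (j + 1) k; positivity
          · have := hL0 (j + 1) k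
            gcongr
            exact hN' j k
      _ = K * ∏ k, L (j + 1) k := by
          rw [Finset.prod_mul_distrib, Finset.prod_const, Finset.card_univ, Fintype.card_fin,
            mul_comm]
  · intro j x hx
    simp only [hcell]
    have hen' := hen j x hx
    refine (hosc j x hx 1 one_pos).trans ?_
    rw [Real.one_rpow, one_mul, hB, ENNReal.ofReal_add zero_le_one (by positivity), add_mul]
    refine add_le_add le_rfl ?_
    refine (mul_le_mul_right hen' _).trans (le_of_eq ?_)
    rw [← mul_assoc, ← ENNReal.ofReal_mul (by have := hR j; positivity)]
    congr 2
    have : (r / 2 ^ j) ^ (p * sMax s) * (r / 2 ^ j) ^ (-(p * sMax s)) = 1 := by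
      rw [← Real.rpow_add (hR j)]; simp
    linear_combination (P * E) * this
  · have h1 : Filter.Tendsto (fun j : ℕ => r / 2 ^ j) Filter.atTop (nhds 0) :=
      tendsto_const_nhds.div_atTop (tendsto_pow_atTop_atTop_of_one_lt one_lt_two)
    have := h1.rpow_const (p := sMax s) (Or.inr hM.le)
    rwa [Real.zero_rpow hM.ne'] at this
  · intro j x hx
    simp only [hcell]
    have hη : 0 < (r / 2 ^ j) ^ sMax s := Real.rpow_pos_of_pos (hR j) _
    refine (hosc j x hx _ hη).trans ?_
    rw [Measure.add_apply, mul_add]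
    refine add_le_add le_rfl ?_
    refine le_trans (le_of_eq ?_) (mul_le_mul_right (hmc j x hx) _)
    rw [← mul_assoc (ENNReal.ofReal ((r / 2 ^ j) ^ sMax s)), ← ENNReal.ofReal_mul hη.le]
    congr 2
    have : ((r / 2 ^ j) ^ sMax s) ^ (1 - p) * (r / 2 ^ j) ^ (p * sMax s) = (r / 2 ^ j) ^ sMax s := by
      rw [← Real.rpow_mul (hR j).le, ← Real.rpow_add (hR j)]
      congr 1; ring
    linear_combination P * this
  · rw [div_mul_cancel₀ _ (by positivity), Real.exp_log two_pos]

/-- Coarse cells (`j < 6`) share the rectangle of radius `17 r / 16` about `x₀`, whose enlargement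
by `18 / 17` is exactly `M_{9r/8}`, and `34 = 32 · 17 / 16`. Finer cells sit in the rectangle of
radius `4 r / 2 ^ j ≤ r / 16` about `x`, and superadditivity of powers keeps its enlargement inside
`M_{9r/8}`. -/
lemma exists_rect_of_cell {s₀ r : ℝ} {s : Fin n → ℝ} (hs₀ : 0 < s₀)
    (hs : ∀ k, s₀ ≤ s k ∧ s k < 1) (hr : 0 < r) {x₀ x : Fin n → ℝ} (j : ℕ)
    (hx : x ∈ cell s x₀ r 0 x₀) :
    ∃ (z : Fin n → ℝ) (ρ : ℝ), r / 2 ^ j ≤ ρ ∧ ρ ≤ 34 * (r / 2 ^ j) ∧ ρ ≤ 2 * r ∧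
      cell s x₀ r j x ⊆ rect s ρ z ∧ rect s (18 / 17 * ρ) z ⊆ rect s (9 * r / 8) x₀ := by
  have hQ : ∀ y ∈ cell s x₀ r 0 x₀, ∀ k, |y k - x₀ k| ≤ r ^ (sMax s / s k) := by
    intro y hy k
    rw [cell_zero hr, mem_box] at hy
    have := hy k
    exact abs_le.2 ⟨by linarith, by linarith⟩
  have ha : ∀ k, 1 ≤ sMax s / s k := one_le_ratio hs₀ hs
  have h2j : (0 : ℝ) < 2 ^ j := by positivity
  have hr2 : r / 2 ^ j ≤ r := div_le_self hr.le (one_le_pow₀ one_le_two)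
  rcases lt_or_ge j 6 with hj | hj
  · refine ⟨x₀, 17 * r / 16, by linarith, ?_, by linarith, ?_, ?_⟩
    · have : (2 : ℝ) ^ j ≤ 2 ^ 5 := pow_le_pow_right₀ one_le_two (by omega)
      rw [← mul_div_assoc, le_div_iff₀ h2j]
      nlinarith
    · intro y hy
      rw [mem_rect]
      intro k
      refine (hQ y (cell_subset hs₀ hs j hx hy) k).trans_lt ?_
      exact Real.rpow_lt_rpow hr.le (by linarith) (by linarith [ha k])
    · rw [show (18 / 17 * (17 * r / 16)) = 9 * r / 8 by ring]
  · have h64 : r / 2 ^ j ≤ r / 64 := by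
      have : (2 : ℝ) ^ 6 ≤ 2 ^ j := pow_le_pow_right₀ one_le_two hj
      gcongr
      linarith
    have hR : 0 < r / 2 ^ j := by positivity
    refine ⟨x, 4 * (r / 2 ^ j), by linarith, by linarith, by linarith, ?_, ?_⟩
    · intro y hy
      rw [mem_rect]
      intro k
      refine (abs_sub_lt_of_gridIndex_eq (cellSide_pos hr j) hy k).trans_le ?_
      refine (cellSide_bounds hs₀ hs hr j k).2.trans ?_
      rw [Real.mul_rpow (by norm_num) hR.le]
      gcongr
      exact Real.self_le_rpow_of_one_le (by norm_num) (ha k)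
    · intro y hy
      rw [mem_rect] at hy ⊢
      intro k
      have h1 := hy k
      have h2 := hQ x hx k
      have h3 := abs_sub_le (y k) (x k) (x₀ k)
      have h4 := Real.add_rpow_le_rpow_add (a := 18 / 17 * (4 * (r / 2 ^ j))) (b := r)
        (by positivity) hr.le (ha k)
      have h5 : (18 / 17 * (4 * (r / 2 ^ j)) + r) ^ (sMax s / s k) ≤ (9 * r / 8) ^ (sMax s / s k) :=
        Real.rpow_le_rpow (by positivity) (by linarith) (by linarith [ha k])
      linarith

/-- Compared side by side: `36 = 18 / 17 · 34`, and its exponents `s_max / s_k` are at most `1 /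
s₀`. -/
lemma volume_rect_le_cell {s₀ r ρ : ℝ} {s : Fin n → ℝ} (hs₀ : 0 < s₀)
    (hs : ∀ k, s₀ ≤ s k ∧ s k < 1) (hr : 0 < r) (x₀ x z : Fin n → ℝ) (j : ℕ) (hρ : 0 < ρ)
    (hρj : ρ ≤ 34 * (r / 2 ^ j)) :
    volume (rect s (18 / 17 * ρ) z) ≤
      ENNReal.ofReal ((36 ^ (1 / s₀)) ^ n) * volume (cell s x₀ r j x) := by
  have hR : 0 < r / 2 ^ j := by positivity
  rw [volume_rect (by positivity), volume_cell hr, ← ENNReal.ofReal_mul (by positivity),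
    Real.rpow_sum_of_pos (by positivity)]
  refine ENNReal.ofReal_le_ofReal ?_
  calc 2 ^ n * ∏ k, (18 / 17 * ρ) ^ (sMax s / s k)
      = ∏ k, (2 * (18 / 17 * ρ) ^ (sMax s / s k)) := by simp [Finset.prod_mul_distrib]
    _ ≤ ∏ k, (36 ^ (1 / s₀) * cellSide s r j k) := by
        refine Finset.prod_le_prod (fun k _ => by positivity) fun k _ => ?_
        have ha := one_le_ratio hs₀ hs k
        calc 2 * (18 / 17 * ρ) ^ (sMax s / s k)
            ≤ 2 * (36 * (r / 2 ^ j)) ^ (sMax s / s k) := by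
              refine mul_le_mul_of_nonneg_left ?_ zero_le_two
              exact Real.rpow_le_rpow (by positivity) (by linarith) (by linarith)
          _ = 36 ^ (sMax s / s k) * (2 * (r / 2 ^ j) ^ (sMax s / s k)) := by
              rw [Real.mul_rpow (by norm_num) hR.le]; ring
          _ ≤ 36 ^ (1 / s₀) * cellSide s r j k := by
              refine mul_le_mul ?_ (cellSide_bounds hs₀ hs hr j k).1 (by positivity) (by positivity)
              exact Real.rpow_le_rpow_of_exponent_le (by norm_num) (ratio_le hs₀ hs k)
    _ = (36 ^ (1 / s₀)) ^ n * ∏ k, cellSide s r j k := by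
        simp [Finset.prod_mul_distrib]

/-! ### From exponential integrability of `log u` to its moments -/

lemma energy_mono {p : ℝ} {μ : (Fin n → ℝ) → Measure (Fin n → ℝ)} {A A' B B' : Set (Fin n → ℝ)}
    (hA : A ⊆ A') (hB : B ⊆ B') (u : (Fin n → ℝ) → ℝ) : energy p μ A B u ≤ energy p μ A' B' u :=
  (lintegral_mono_set hA).trans (lintegral_mono fun _ => lintegral_mono_set hB)

lemma abs_log_max_le {ε : ℝ} (hε : 0 < ε) (t : ℝ) :
    |Real.log (max t ε)| ≤ |Real.log ε| + |t| / ε := by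
  have h1 : Real.log ε ≤ Real.log (max t ε) := Real.log_le_log hε (le_max_right _ _)
  have h2 : Real.log (max t ε) - Real.log ε ≤ |t| / ε := by
    rw [← Real.log_div (by positivity) hε.ne']
    refine (Real.log_le_sub_one_of_pos (by positivity)).trans ?_
    rw [sub_le_iff_le_add, div_add_one hε.ne']
    gcongr
    refine max_le ?_ ?_
    · linarith [le_abs_self t]
    · linarith [abs_nonneg t]
  have h3 : 0 ≤ |t| / ε := by positivity
  rw [abs_le]
  constructor
  · linarith [neg_abs_le (Real.log ε)]
  · linarith [le_abs_self (Real.log ε)]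

lemma memLp_log_max {X : Type*} [MeasurableSpace X] {ν : Measure X} [IsFiniteMeasure ν] {q : ℝ≥0∞}
    {ε : ℝ} (hε : 0 < ε) {u : X → ℝ} (hm : Measurable u) (hu : MemLp u q ν) :
    MemLp (fun x => Real.log (max (u x) ε)) q ν := by
  refine MemLp.of_le ((memLp_const |Real.log ε|).add (hu.abs.mul_const ε⁻¹))
    (Real.measurable_log.comp (hm.max measurable_const)).aestronglyMeasurable
    (Filter.Eventually.of_forall fun x => ?_)
  refine (abs_log_max_le hε (u x)).trans ((le_abs_self _).trans (le_of_eq ?_))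
  simp [div_eq_mul_inv]

/-- Exponential integrability of `log u` makes positive and negative moments comparable. -/
lemma rpow_average_le {X : Type*} [MeasurableSpace X] {ν : Measure X} [IsFiniteMeasure ν]
    [NeZero ν] {u v : X → ℝ} (hv : Measurable v) (hu : ∀ᵐ x ∂ν, u x = Real.exp (v x)) {c g₀ : ℝ}
    (hc : 0 < c)
    (h : ∫⁻ x, ENNReal.ofReal (Real.exp (c * |v x - g₀|)) ∂ν ≤ 4 * ν Set.univ) :
    Integrable (fun x => u x ^ c) ν ∧ Integrable (fun x => u x ^ (-c)) ν ∧
      (⨍ x, u x ^ c ∂ν) ^ (1 / c) ≤ 16 ^ (1 / c) * (⨍ x, u x ^ (-c) ∂ν) ^ (-1 / c) := by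
  have hν : 0 < ν.real Set.univ := by
    rw [measureReal_def]
    exact ENNReal.toReal_pos (NeZero.ne _) (measure_ne_top _ _)
  have hE0 : ∀ x, 0 ≤ Real.exp (c * |v x - g₀|) := fun x => (Real.exp_pos _).le
  have hEi : Integrable (fun x => Real.exp (c * |v x - g₀|)) ν := by
    refine ⟨by fun_prop, ?_⟩
    rw [hasFiniteIntegral_iff_ofReal (Filter.Eventually.of_forall hE0)]
    exact h.trans_lt (ENNReal.mul_lt_top (by norm_num) (measure_lt_top _ _))
  have hE4 : ∫ x, Real.exp (c * |v x - g₀|) ∂ν ≤ 4 * ν.real Set.univ := by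
    rw [integral_eq_lintegral_of_nonneg_ae (Filter.Eventually.of_forall hE0) (by fun_prop)]
    refine (ENNReal.toReal_mono (ENNReal.mul_ne_top (by norm_num) (measure_ne_top _ _)) h).trans ?_
    rw [ENNReal.toReal_mul, measureReal_def]
    norm_num
  -- Both signs `d = ±c` are covered at once. Each average is at most `4 exp (d g₀)`, so in the
  -- product `g₀` cancels and `16` remains.
  have key : ∀ d : ℝ, |d| = c → Integrable (fun x => Real.exp (d * v x)) ν ∧
      0 < ⨍ x, Real.exp (d * v x) ∂ν ∧
      ⨍ x, Real.exp (d * v x) ∂ν ≤ 4 * Real.exp (d * g₀) := by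
    intro d hd
    have hle : ∀ x, Real.exp (d * v x) ≤ Real.exp (d * g₀) * Real.exp (c * |v x - g₀|) := by
      intro x
      rw [← Real.exp_add, Real.exp_le_exp]
      have := le_abs_self (d * (v x - g₀))
      rw [abs_mul, hd] at this
      linarith
    have hi : Integrable (fun x => Real.exp (d * v x)) ν := by
      refine (hEi.const_mul (Real.exp (d * g₀))).mono' (by fun_prop)
        (Filter.Eventually.of_forall fun x => ?_)
      rw [Real.norm_eq_abs, Real.abs_exp]
      exact hle x
    refine ⟨hi, ?_, ?_⟩
    · rw [average_eq, smul_eq_mul]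
      exact mul_pos (inv_pos.2 hν) (integral_exp_pos hi)
    · rw [average_eq, smul_eq_mul, inv_mul_le_iff₀ hν]
      calc ∫ x, Real.exp (d * v x) ∂ν
          ≤ ∫ x, Real.exp (d * g₀) * Real.exp (c * |v x - g₀|) ∂ν :=
            integral_mono hi (hEi.const_mul _) hle
        _ ≤ Real.exp (d * g₀) * (4 * ν.real Set.univ) := by
            rw [integral_const_mul]; gcongr
        _ = _ := by ring
  have hpow : ∀ d : ℝ, (fun x => u x ^ d) =ᵐ[ν] fun x => Real.exp (d * v x) := fun d => by
    filter_upwards [hu] with x hx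
    rw [hx, ← Real.exp_mul, mul_comm]
  obtain ⟨hi1, hpos1, hle1⟩ := key c (abs_of_pos hc)
  obtain ⟨hi2, hpos2, hle2⟩ := key (-c) (by rw [abs_neg, abs_of_pos hc])
  refine ⟨hi1.congr (hpow c).symm, hi2.congr (hpow (-c)).symm, ?_⟩
  rw [average_congr (hpow c), average_congr (hpow (-c))]
  have hexp : ∀ t d : ℝ, Real.exp t ^ d = Real.exp (t * d) := fun t d => (Real.exp_mul t d).symm
  calc (⨍ x, Real.exp (c * v x) ∂ν) ^ (1 / c) ≤ (4 * Real.exp (c * g₀)) ^ (1 / c) :=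
        Real.rpow_le_rpow hpos1.le hle1 (by positivity)
    _ = 16 ^ (1 / c) * (4 * Real.exp (-c * g₀)) ^ (-1 / c) := by
        rw [Real.mul_rpow (by norm_num) (Real.exp_pos _).le,
          Real.mul_rpow (by norm_num) (Real.exp_pos _).le, hexp, hexp,
          show (16 : ℝ) = 4 * 4 by norm_num, Real.mul_rpow (by norm_num) (by norm_num),
          show -c * g₀ * (-1 / c) = c * g₀ * (1 / c) by ring, neg_div,
          Real.rpow_neg (by norm_num)]
        have : (4 : ℝ) ^ (1 / c) ≠ 0 := by positivity
        field_simp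
    _ ≤ 16 ^ (1 / c) * (⨍ x, Real.exp (-c * v x) ∂ν) ^ (-1 / c) := by
        gcongr ?_ * ?_
        refine Real.rpow_le_rpow_of_nonpos hpos2 hle2 ?_
        rw [neg_div]
        exact neg_nonpos.2 (by positivity)

end AnisoNonlocal

end

theorem theorem3p2 (n : ℕ) (p s₀ q Λ : ℝ) (hp : 1 < p) (hs₀ : 0 < s₀) (hs₀' : s₀ < 1)
    (hq : (n : ℝ) < q) (hΛ : 1 ≤ Λ) :
    ∃ C : ℝ, 0 < C ∧ ∃ pbar : ℝ, 0 < pbar ∧ pbar < 1 ∧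
      ∀ s : Fin n → ℝ, (∀ k, s₀ ≤ s k ∧ s k < 1) → p < n / AnisoNonlocal.sBar s →
      ∀ (x₀ : Fin n → ℝ) (r : ℝ), 0 < r → r ≤ 1 →
      ∀ f : (Fin n → ℝ) → ℝ,
        MemLp f (ENNReal.ofReal (q / (p * AnisoNonlocal.sBar s)))
          (volume.restrict (AnisoNonlocal.rect s (5 * r / 4) x₀)) →
      ∀ μ : Kernel (Fin n → ℝ) (Fin n → ℝ), AnisoNonlocal.Admissible p Λ s μ →
      ∀ u : (Fin n → ℝ) → ℝ,
        AnisoNonlocal.MemV p μ (AnisoNonlocal.rect s (5 * r / 4) x₀) u →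
        AnisoNonlocal.WeakSupersolution p μ (AnisoNonlocal.rect s (5 * r / 4) x₀) f u →
      ∀ ε : ℝ,
        (∀ᵐ x ∂(volume.restrict (AnisoNonlocal.rect s (5 * r / 4) x₀)), ε ≤ u x) →
        ENNReal.ofReal (r ^ (p * AnisoNonlocal.sMax s / (p - 1) * ((q - n) / q))) *
              eLpNorm f (ENNReal.ofReal (q / (p * AnisoNonlocal.sBar s)))
                (volume.restrict (AnisoNonlocal.rect s (5 * r / 4) x₀)) ^ (1 / (p - 1)) +
            (ENNReal.ofReal (r ^ (p * AnisoNonlocal.sMax s)) *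
              AnisoNonlocal.tailTerm p μ (AnisoNonlocal.rect s (9 * r / 8) x₀)
                (AnisoNonlocal.rect s (5 * r / 4) x₀) u) ^ (1 / (p - 1))
          < ENNReal.ofReal ε →
        IntegrableOn (fun x => u x ^ pbar) (AnisoNonlocal.rect s r x₀) ∧
        IntegrableOn (fun x => u x ^ (-pbar)) (AnisoNonlocal.rect s r x₀) ∧
        (⨍ x in AnisoNonlocal.rect s r x₀, u x ^ pbar) ^ (1 / pbar) ≤
          C * (⨍ x in AnisoNonlocal.rect s r x₀, u x ^ (-pbar)) ^ (-1 / pbar) := by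
  obtain ⟨C₀, hC₀, henergy⟩ := AnisoNonlocal.exists_log_energy_le n hp hs₀ hq hΛ
  obtain ⟨c, hc, hexp⟩ := AnisoNonlocal.exists_lintegral_exp_le n
    (E := Λ * C₀ * (36 ^ (1 / s₀)) ^ n) hs₀ hp (by positivity)
  -- Lowering the exponent only weakens the exponential bound; the cap is there to have `pbar < 1`.
  set pbar : ℝ := min c (1 / 2) with hpbar
  have hpb0 : 0 < pbar := lt_min hc (by norm_num)
  refine ⟨16 ^ (1 / pbar), by positivity, pbar, hpb0,
    (min_le_right _ _).trans_lt (by norm_num), ?_⟩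
  intro s hs hps x₀ r hr hr1 f hf μ hμ u hu hsuper ε hae hεlt
  have hn : Nonempty (Fin n) := by
    rcases Nat.eq_zero_or_pos n with rfl | hn
    · simp at hps; linarith
    · exact ⟨⟨0, hn⟩⟩
  have hε : 0 < ε := ENNReal.ofReal_pos.1 (pos_of_gt hεlt)
  have hM : 0 < AnisoNonlocal.sMax s := AnisoNonlocal.sMax_pos hs₀ hs
  -- The truncation changes `u` only on a null set of `Ω`, and makes `v` a globally measurable
  -- function that inherits `L^p` integrability from `u`.
  set v : (Fin n → ℝ) → ℝ := fun x => Real.log (max (u x) ε) with hv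
  have hvm : Measurable v := Real.measurable_log.comp (hu.1.max measurable_const)
  set Ω := AnisoNonlocal.rect s (5 * r / 4) x₀ with hΩ
  set Q := AnisoNonlocal.cell s x₀ r 0 x₀ with hQ
  set M := AnisoNonlocal.rect s r x₀ with hMdef
  have : IsFiniteMeasure (volume.restrict Ω) := ⟨by
    rw [Measure.restrict_apply_univ]
    exact AnisoNonlocal.volume_rect_lt_top (by positivity) x₀⟩
  have hvΩ : MemLp v (ENNReal.ofReal p) (volume.restrict Ω) :=
    AnisoNonlocal.memLp_log_max hε hu.1 hu.2.1
  have hAΩ : AnisoNonlocal.rect s (9 * r / 8) x₀ ⊆ Ω :=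
    AnisoNonlocal.rect_mono hs₀ hs (by positivity) (by linarith) x₀
  have hsubΩ : ∀ (z : Fin n → ℝ) (ρ : ℝ), 0 < ρ →
      AnisoNonlocal.rect s (18 / 17 * ρ) z ⊆ AnisoNonlocal.rect s (9 * r / 8) x₀ →
      AnisoNonlocal.rect s ρ z ⊆ Ω := fun z ρ hρ h =>
    (AnisoNonlocal.rect_mono hs₀ hs hρ.le (by linarith) z).trans (h.trans hAΩ)
  have hQΩ : Q ⊆ Ω := by
    obtain ⟨z, ρ, h1, -, -, h4, h5⟩ := AnisoNonlocal.exists_rect_of_cell (x₀ := x₀) (x := x₀)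
      hs₀ hs hr 0 rfl
    exact h4.trans (hsubΩ z ρ (lt_of_lt_of_le (by positivity) h1) h5)
  have hvQ : IntegrableOn v Q := IntegrableOn.mono_set
    (hvΩ.integrable (by rw [ENNReal.one_le_ofReal]; exact hp.le)) hQΩ
  obtain ⟨g₀, hg₀⟩ := hexp s hs hn x₀ r hr v hvm hvQ fun j x hx => by
    obtain ⟨z, ρ, h1, h2, h3, h4, h5⟩ := AnisoNonlocal.exists_rect_of_cell hs₀ hs hr j hx
    have hR : 0 < r / 2 ^ j := by positivity
    have hρ : 0 < ρ := hR.trans_le h1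
    calc AnisoNonlocal.energy p (AnisoNonlocal.muAxes p s) (AnisoNonlocal.cell s x₀ r j x)
          (AnisoNonlocal.cell s x₀ r j x) v
        ≤ AnisoNonlocal.energy p (AnisoNonlocal.muAxes p s) (AnisoNonlocal.rect s ρ z)
          (AnisoNonlocal.rect s ρ z) v := AnisoNonlocal.energy_mono h4 h4 v
      _ ≤ ENNReal.ofReal Λ * AnisoNonlocal.energy p μ (AnisoNonlocal.rect s ρ z)
          (AnisoNonlocal.rect s ρ z) v :=
          -- Comparability is available since `ρ ≤ 2 r ≤ 2 < 3`.
          (hμ.comparable z ρ hρ (by linarith) v hvm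
            (hvΩ.mono_measure (Measure.restrict_mono_set _ (hsubΩ z ρ hρ h5)))).2
      _ ≤ ENNReal.ofReal Λ * (ENNReal.ofReal (C₀ * (r / 2 ^ j) ^ (-(p * AnisoNonlocal.sMax s))) *
          (ENNReal.ofReal ((36 ^ (1 / s₀)) ^ n) * volume (AnisoNonlocal.cell s x₀ r j x))) := by
          gcongr ENNReal.ofReal Λ * ?_
          refine (henergy s hs hps x₀ r hr f hf μ hμ u hu hsuper ε hε hae hεlt z ρ hρ h3 h5).trans ?_
          refine mul_le_mul' (ENNReal.ofReal_le_ofReal ?_)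
            (AnisoNonlocal.volume_rect_le_cell hs₀ hs hr x₀ x z j hρ h2)
          refine mul_le_mul_of_nonneg_left ?_ hC₀.le
          refine Real.rpow_le_rpow_of_nonpos hR h1 ?_
          rw [neg_nonpos]; positivity
      _ = _ := by
          rw [← mul_assoc (ENNReal.ofReal (C₀ * _)), ← ENNReal.ofReal_mul (by positivity),
            ← mul_assoc, ← ENNReal.ofReal_mul (by positivity)]
          congr 2
          ring
  have hMQ : M ⊆ Q := by
    intro x hx
    rw [hQ, AnisoNonlocal.cell_zero hr, AnisoNonlocal.mem_box]
    intro k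
    have := abs_lt.1 (AnisoNonlocal.mem_rect.1 hx k)
    constructor <;> linarith
  -- The root cell is the half-open version of `M_r`, so the bound on `Q` restricts to `M` without
  -- changing the constant `4`.
  have hvol : volume Q = volume M := by
    rw [hQ, AnisoNonlocal.volume_cell hr, hMdef, AnisoNonlocal.volume_rect hr,
      Real.rpow_sum_of_pos hr]
    simp [AnisoNonlocal.cellSide, Finset.prod_mul_distrib]
  have hMΩ : M ⊆ Ω := hMQ.trans hQΩ
  have hM0 : volume M ≠ 0 := by
    rw [hMdef, AnisoNonlocal.volume_rect hr, Ne, ENNReal.ofReal_eq_zero, not_le]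
    positivity
  have : IsFiniteMeasure (volume.restrict M) := ⟨by
    rw [Measure.restrict_apply_univ]; exact AnisoNonlocal.volume_rect_lt_top hr x₀⟩
  have : NeZero (volume.restrict M) := ⟨by rwa [Ne, Measure.restrict_eq_zero]⟩
  refine AnisoNonlocal.rpow_average_le (v := v) (g₀ := g₀) hvm ?_ hpb0 ?_
  · filter_upwards [ae_restrict_of_ae_restrict_of_subset hMΩ hae] with x hx
    rw [hv]
    simp only [max_eq_left hx]
    rw [Real.exp_log (hε.trans_le hx)]
  · rw [Measure.restrict_apply_univ, ← hvol]
    refine le_trans ?_ ((lintegral_mono_set hMQ).trans hg₀)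
    gcongr
    exact min_le_left _ _
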